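/- Let $\mathfrak h$ be a finite-dimensional complex vector space and let $R\subset\mathfrak h^*$ be a reduced irreducible (crystallographic) root system, with coroots $\alpha^\vee\in\mathfrak h$, Weyl group $W$ and root lattice $Q=\mathbb Z R$ (equivalently, $\mathfrak h$ and $R$ are the complexification of a reduced irreducible root system in the dual of a real Euclidean space). Let $H=\mathrm{Hom}(Q,\mathbb C^\times)$ be the adjoint torus, with Lie algebra $\mathfrak h$ and exponential map given by $e^{\phi}(\exp u)=\exp(\phi(u))$ for the characters $e^\phi$, $\phi\in Q$. Let $H^\circ=\{h\in H: e^\alpha(h)\neq 1\text{ for all }\alpha\in R\}$. For $v\in\mathfrak h$ and $\phi\in\mathfrak h^*$ write $\partial_v$ and $d\phi$ for the translation invariant vector field and differential on $H$. Let $\kappa=(k_\alpha)_{\alpha\in R}\in\mathbb C^R$ be $W$-invariant and let $b^\kappa:\mathfrak h\times\mathfrak h\to\mathfrak h$ be a $W$-equivariant symmetric bilinear map. For a symmetric bilinear form $a^\kappa$ on $\mathfrak h$ let $A^\kappa$ be the associated translation invariant section of $\Omega_H\otimes\Omega_H$, and for a differential $\zeta$ let $(B^\kappa)^*(\zeta)$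 be given by $(u,v)\mapsto\zeta(\partial_{b^\kappa(u,v)})$. Let $t$ be the coordinate on $\mathbb C^\times$, let $\nabla^0$ and $\tilde\nabla^0$ be the translation invariant connections on the cotangent bundles of $H$ and $H\times\mathbb C^\times$, and define $\nabla^\kappa=\nabla^0+\Omega^\kappa$ on $H^\circ$ and $\tilde\nabla^\kappa=\tilde\nabla^0+\tilde\Omega^\kappa$ on $H^\circ\times\mathbb C^\times$ by $$\Omega^\kappa(\zeta)=\tfrac12\sum_{\alpha>0}k_\alpha\frac{e^\alpha+1}{e^\alpha-1}\,\zeta(\partial_{\alpha^\vee})\,d\alpha\otimes d\alpha+(B^\kappa)^*(\zeta),$$ $$\tilde\Omega^\kappa(\zeta)=\Omega^\kappa(\zeta)-\zeta\otimes\frac{dt}{t}-\frac{dt}{t}\otimes\zeta\quad(\zeta\in\Omega_{H^\circ}),\qquad \tilde\Omega^\kappa\Big(\frac{dt}{t}\Big)=A^\kappa-\frac{dt}{t}\otimes\frac{dt}{t}.$$ Theorem. For all such $R$, $\kappa$ and $b^\kappa$ there is a $W$-invariant symmetric bilinear form $a^\kappa$ on $\mathfrak h$ such that: 1. $\tilde\nabla^\kappa$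 is torsion free and flat on $H^\circ\times\mathbb C^\times$. 2. $\tilde\nabla^\kappa$ defines an affine structure on $H^\circ\times\mathbb C^\times$: the holomorphic charts with values in an affine space of dimension $\dim\mathfrak h+1$ all of whose coordinates $f$ satisfy $\tilde\nabla^\kappa(df)=0$ form a maximal atlas with (locally) affine-linear transition maps. 3. $\nabla^\kappa$, together with $A^\kappa$, defines a projective structure on $H^\circ$: the holomorphic charts with values in $\mathbb P^{\dim\mathfrak h}$ that have locally homogeneous coordinates $[f_0:\dots:f_{\dim\mathfrak h}]$ with $\nabla^\kappa(df_i)+f_iA^\kappa=0$ form a maximal atlas with (locally) projective-linear transition maps. This projective structure is induced by the affine structure in (2): its charts are exactly the holomorphic charts that have locally homogeneous coordinates $f=(f_0,\dots,f_{\dim\mathfrak h})$ for which $(h,t)\mapsto t f(h)$ is locally a chart of the affine structure. It is $W$-invariant: the pull-back of any of its charts along any $w\in W$ is again one of its charts. -/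

import Mathlib

open Set Filter Topology
open scoped LinearAlgebra.Projectivization

/-! ### Calculus on a commutative complex Lie group through its exponential map

`G` is a commutative complex Lie group with Lie algebra `E`, and `e : E → G` is its exponential
map, so that `u ↦ x * e u` is the standard holomorphic coordinate centred at `x : G`. The
cotangent bundle of `G` is trivialised by the translation invariant differentials: a differential
form on `G` is a function `G → Module.Dual ℂ E`. -/

section Calculus

variable {E G F : Type*} [NormedAddCommGroup E] [NormedSpace ℂ E] [CommGroup G]
  [NormedAddCommGroup F] [NormedSpace ℂ F]

/-- `f` is complex differentiable at `x`, in the coordinate `u ↦ x * e u`. -/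
def IsHolAt (e : E → G) (f : G → F) (x : G) : Prop :=
  DifferentiableAt ℂ (fun u : E => f (x * e u)) 0

/-- `f` is holomorphic on `U`. -/
def IsHolOn (e : E → G) (f : G → F) (U : Set G) : Prop :=
  ∀ x ∈ U, IsHolAt e f x

/-- The differential of `f` at `x`. The value at `X : E` is the derivative `∂_X f (x)` along the
translation invariant vector field of `X`. -/
noncomputable def invDeriv (e : E → G) (f : G → F) (x : G) : E →L[ℂ] F :=
  fderiv ℂ (fun u : E => f (x * e u)) 0

/-- The form `df`, for a function `f`. -/
noncomputable def dForm (e : E → G) (f : G → ℂ) : G → Module.Dual ℂ E :=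
  fun x => (invDeriv e f x : E →ₗ[ℂ] ℂ)

/-- The form `ω` is holomorphic on `U`. -/
def IsHolForm (e : E → G) (ω : G → Module.Dual ℂ E) (U : Set G) : Prop :=
  ∀ Y : E, IsHolOn e (fun x => ω x Y) U

/-- `dω (X, Y) = ∂_X (ω Y) - ∂_Y (ω X)`, for translation invariant (hence commuting) vector
fields. -/
noncomputable def extDer (e : E → G) (ω : G → Module.Dual ℂ E) (x : G) (X Y : E) : ℂ :=
  invDeriv e (fun y => ω y Y) x X - invDeriv e (fun y => ω y X) x Y

/-- The connection `∇ = ∇⁰ + Ω` on the cotangent bundle, where `∇⁰` is the translation invariant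
connection. The tensor `Γ` is `Ω`, seen as a section of `Ω_G ⊗ Ω_G ⊗ T_G`, so that
`Ω(ζ)(X, Y) = ζ (Γ (X, Y))`. The value `nabla e Γ ω x X Y` is
`(∇ ω)(X, Y) = (∇_X ω)(Y)` at `x`: the first argument is the direction of differentiation. -/
noncomputable def nabla (e : E → G) (Γ : G → E →ₗ[ℂ] E →ₗ[ℂ] E) (ω : G → Module.Dual ℂ E)
    (x : G) (X Y : E) : ℂ :=
  invDeriv e (fun y => ω y Y) x X + ω x (Γ x X Y)

/-- The extension `∇ : Ω¹ ⊗ Ω → Ω² ⊗ Ω` with `∇(ω ⊗ ζ) = dω ⊗ ζ - ω ∧ ∇ζ`, applied to a section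
`T` of `Ω¹ ⊗ Ω`. The first two vectors are inserted in the factor `Ω²` and the third in `Ω`. -/
noncomputable def nablaExt (e : E → G) (Γ : G → E →ₗ[ℂ] E →ₗ[ℂ] E) (T : G → E → E → ℂ)
    (x : G) (X Y Z : E) : ℂ :=
  invDeriv e (fun y => T y Y Z) x X - invDeriv e (fun y => T y X Z) x Y
    + T x Y (Γ x X Z) - T x X (Γ x Y Z)

variable [TopologicalSpace G]

/-- On the open set `N`, the composite of `∇` with `∧ : Ω ⊗ Ω → Ω²` is the exterior derivative. -/
def IsTorsionFree (e : E → G) (Γ : G → E →ₗ[ℂ] E →ₗ[ℂ] E) (N : Set G) : Prop :=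
  ∀ U : Set G, IsOpen U → U ⊆ N → ∀ ω : G → Module.Dual ℂ E, IsHolForm e ω U →
    ∀ x ∈ U, ∀ X Y : E, nabla e Γ ω x X Y - nabla e Γ ω x Y X = extDer e ω x X Y

/-- On the open set `N`, the curvature `∇² : Ω → Ω² ⊗ Ω` vanishes. -/
def IsFlat (e : E → G) (Γ : G → E →ₗ[ℂ] E →ₗ[ℂ] E) (N : Set G) : Prop :=
  ∀ U : Set G, IsOpen U → U ⊆ N → ∀ ω : G → Module.Dual ℂ E, IsHolForm e ω U →
    ∀ x ∈ U, ∀ X Y Z : E, nablaExt e Γ (nabla e Γ ω) x X Y Z = 0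

/-- `f` is an affine-linear function on the open set `U` for `∇`: it is holomorphic and
`∇(df) = 0`. -/
def IsAffineFun (e : E → G) (Γ : G → E →ₗ[ℂ] E →ₗ[ℂ] E) (f : G → ℂ) (U : Set G) : Prop :=
  IsHolOn e f U ∧ ∀ x ∈ U, ∀ X Y : E, nabla e Γ (dForm e f) x X Y = 0

end Calculus

/-! ### Affine and projective structures -/

section Structures

/-- An injective map from an open subset of `G` to `X`. -/
structure LocalChart (G X : Type*) [TopologicalSpace G] where
  source : Set G
  toFun : G → X
  open_source : IsOpen source
  injOn : Set.InjOn toFun source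

/-- The transition map from `c` to `c'` is locally the restriction of an element of `T`. -/
def LocalChart.Compatible {G X : Type*} [TopologicalSpace G] (T : Set (X → X))
    (c c' : LocalChart G X) : Prop :=
  ∀ x ∈ c.source ∩ c'.source, ∃ g ∈ T, ∀ᶠ y in 𝓝 x, c'.toFun y = g (c.toFun y)

/-- An atlas on the open subset `N` of `G`, of charts with values in `X` that satisfy `hol`, whose
transition maps are locally in `T`, and which is maximal for that property. -/
structure GeomStructure {G X : Type*} [TopologicalSpace G] (N : Set G)
    (hol : LocalChart G X → Prop) (T : Set (X → X)) where
  atlas : Set (LocalChart G X)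
  source_subset : ∀ c ∈ atlas, c.source ⊆ N
  holomorphic : ∀ c ∈ atlas, hol c
  cover : ∀ x ∈ N, ∃ c ∈ atlas, x ∈ c.source
  compatible : ∀ c ∈ atlas, ∀ c' ∈ atlas, c.Compatible T c'
  maximal : ∀ c : LocalChart G X, c.source ⊆ N → hol c →
    (∀ c' ∈ atlas, c.Compatible T c') → c ∈ atlas

variable {E G : Type*} [NormedAddCommGroup E] [NormedSpace ℂ E] [CommGroup G]
  [TopologicalSpace G]

/-- `c` is a holomorphic chart with values in the vector space `E`: it is injective on its open
domain, holomorphic, and its differential is invertible everywhere (so its inverse is holomorphic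
as well). -/
def IsHolChart (e : E → G) (c : LocalChart G E) : Prop :=
  ∀ x ∈ c.source, IsHolAt e c.toFun x ∧ Function.Bijective (invDeriv e c.toFun x)

/-- Near `x`, `F` is a holomorphic lift of the map `c` to the punctured vector space `E × ℂ`, i.e.
a system of homogeneous coordinates of `c`. -/
def IsLiftNear (e : E → G) (c : G → ℙ ℂ (E × ℂ)) (F : G → E × ℂ) (x : G) : Prop :=
  ∀ᶠ y in 𝓝 x, IsHolAt e F y ∧ ∃ h : F y ≠ 0, c y = Projectivization.mk ℂ (F y) h

/-- `c` is a holomorphic chart with values in the projective space of lines in `E × ℂ` (which has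
the dimension of `E`): it is injective on its open domain, holomorphic, i.e. locally with a
holomorphic lift `F`, and its differential, with values in
`T_[F] ℙ = Hom (ℂ F, (E × ℂ) / ℂ F)`, is invertible everywhere. -/
def IsHolProjChart (e : E → G) (c : LocalChart G (ℙ ℂ (E × ℂ))) : Prop :=
  ∀ x ∈ c.source, ∃ F : G → E × ℂ, IsLiftNear e c.toFun F x ∧
    Function.Bijective (fun p : E × ℂ => invDeriv e F x p.1 + p.2 • F x)

/-- The affine-linear automorphisms of `E`. -/
def affineMaps (E : Type*) [NormedAddCommGroup E] [NormedSpace ℂ E] : Set (E → E) :=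
  {g | ∃ A : E ≃ᵃ[ℂ] E, g = A}

/-- The projective-linear automorphisms of the space of lines in `V`. -/
def projectiveMaps (V : Type*) [AddCommGroup V] [Module ℂ V] : Set (ℙ ℂ V → ℙ ℂ V) :=
  {g | ∃ L : V ≃ₗ[ℂ] V, g = Projectivization.map L.toLinearMap L.injective}

/-- An affine structure on the open subset `N` of `G`. -/
abbrev AffineStructure (e : E → G) (N : Set G) :=
  GeomStructure N (IsHolChart e) (affineMaps E)

/-- A projective structure on the open subset `N` of `G`. -/
abbrev ProjectiveStructure (e : E → G) (N : Set G) :=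
  GeomStructure N (IsHolProjChart e) (projectiveMaps (E × ℂ))

/-- `∇` defines the affine structure `𝒜`: the charts of `𝒜` are exactly the holomorphic charts
whose coordinates are affine-linear functions for `∇`. -/
def AffineStructure.IsDefinedBy {e : E → G} {N : Set G} (𝒜 : AffineStructure e N)
    (Γ : G → E →ₗ[ℂ] E →ₗ[ℂ] E) : Prop :=
  ∀ c : LocalChart G E, c ∈ 𝒜.atlas ↔ c.source ⊆ N ∧ IsHolChart e c ∧
    ∀ ℓ : Module.Dual ℂ E, IsAffineFun e Γ (fun x => ℓ (c.toFun x)) c.source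

/-- The pair `(∇, A)` defines the projective structure `𝒬`: the charts of `𝒬` are exactly the
holomorphic charts that have locally homogeneous coordinates `f` with `∇(df) + f A = 0`. Here `A`
is translation invariant, given by the bilinear form `a`. -/
def ProjectiveStructure.IsDefinedBy {e : E → G} {N : Set G} (𝒬 : ProjectiveStructure e N)
    (Γ : G → E →ₗ[ℂ] E →ₗ[ℂ] E) (a : LinearMap.BilinForm ℂ E) : Prop :=
  ∀ c : LocalChart G (ℙ ℂ (E × ℂ)), c ∈ 𝒬.atlas ↔ c.source ⊆ N ∧ IsHolProjChart e c ∧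
    ∀ x ∈ c.source, ∃ F : G → E × ℂ, IsLiftNear e c.toFun F x ∧
      ∀ ℓ : Module.Dual ℂ (E × ℂ), ∀ᶠ y in 𝓝 x, ∀ X Y : E,
        nabla e Γ (dForm e (fun z => ℓ (F z))) y X Y + ℓ (F y) * a X Y = 0

/-- The exponential map of `G × ℂˣ`, whose Lie algebra is `E × ℂ`; the vector `(0, 1)` gives the
invariant vector field `t ∂/∂t`. -/
noncomputable def expProd (e : E → G) : E × ℂ → G × ℂˣ :=
  fun p => (e p.1, Units.mk0 (Complex.exp p.2) (Complex.exp_ne_zero p.2))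

/-- The affine structure `𝒜` on `N × ℂˣ` induces the projective structure `𝒬` on `N`: the charts
of `𝒬` are exactly the holomorphic charts that have locally a lift `F` for which
`(x, t) ↦ t F(x)` is locally a chart of `𝒜`. -/
def ProjectiveStructure.IsInducedBy {e : E → G} {N : Set G} (𝒬 : ProjectiveStructure e N)
    (𝒜 : AffineStructure (expProd e) (N ×ˢ (univ : Set ℂˣ))) : Prop :=
  ∀ c : LocalChart G (ℙ ℂ (E × ℂ)), c ∈ 𝒬.atlas ↔ c.source ⊆ N ∧ IsHolProjChart e c ∧
    ∀ x ∈ c.source, ∃ F : G → E × ℂ, IsLiftNear e c.toFun F x ∧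
      ∀ t : ℂˣ, ∃ d ∈ 𝒜.atlas, (x, t) ∈ d.source ∧
        ∀ᶠ z in 𝓝 (x, t), d.toFun z = (z.2 : ℂ) • F z.1

end Structures

/-! ### The adjoint torus of a root system -/

section Torus

variable {ι M N : Type*} [AddCommGroup M] [Module ℂ M] [NormedAddCommGroup N] [NormedSpace ℂ N]

/-- The adjoint torus `H = Hom(Q, ℂˣ)`, where `Q` is the root lattice. Its Lie algebra is `N`. -/
def AdjointTorus (P : RootPairing ι ℂ M N) : Type _ :=
  Multiplicative (P.rootSpan ℤ) →* ℂˣ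

noncomputable instance (P : RootPairing ι ℂ M N) : CommGroup (AdjointTorus P) :=
  inferInstanceAs (CommGroup (Multiplicative (P.rootSpan ℤ) →* ℂˣ))

/-- The character `e^φ` of `H`, for `φ` in the root lattice. -/
noncomputable def AdjointTorus.char {P : RootPairing ι ℂ M N} (φ : P.rootSpan ℤ) (h : AdjointTorus P) : ℂˣ :=
  DFunLike.coe (F := Multiplicative (P.rootSpan ℤ) →* ℂˣ) h (Multiplicative.ofAdd φ)

/-- The coarsest topology for which all characters are continuous. -/
noncomputable instance (P : RootPairing ι ℂ M N) : TopologicalSpace (AdjointTorus P) :=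
  TopologicalSpace.induced (fun h (φ : P.rootSpan ℤ) => h.char φ) Pi.topologicalSpace

/-- The exponential map of `H`: `e^φ (exp u) = exp (φ(u))`. -/
noncomputable def torusExp (P : RootPairing ι ℂ M N) (u : N) : AdjointTorus P :=
  MonoidHom.mk'
    (fun φ : Multiplicative (P.rootSpan ℤ) =>
      Units.mk0 (Complex.exp (P.toLinearMap (φ.toAdd : M) u)) (Complex.exp_ne_zero _))
    (by
      intro φ ψ
      ext
      simp [Complex.exp_add])

/-- The complement `H°` of the toric mirrors `e^α = 1`. -/
def mirrorComplement (P : RootPairing ι ℂ M N) : Set (AdjointTorus P) :=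
  {h | ∀ i : ι, h.char (P.rootSpanMem ℤ i) ≠ 1}

/-- The action of the Weyl group on the Lie algebra of `H`, contragredient to its action on
roots. -/
noncomputable def weylCartan (P : RootPairing ι ℂ M N) (w : P.weylGroup) : N ≃ₗ[ℂ] N :=
  (RootPairing.Equiv.coweightEquiv P P (w : P.Aut)).symm

theorem weyl_smul_mem_rootSpan (P : RootPairing ι ℂ M N) (w : P.weylGroup) {m : M}
    (hm : m ∈ P.rootSpan ℤ) : w • m ∈ P.rootSpan ℤ := by
  induction hm using Submodule.span_induction with
  | mem x hx =>
    obtain ⟨i, rfl⟩ := hx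
    rw [P.weylGroup_apply_root]
    exact Submodule.subset_span ⟨_, rfl⟩
  | zero => simp
  | add x y _ _ hx hy => rw [smul_add]; exact add_mem hx hy
  | smul n x _ hx => rw [smul_comm]; exact Submodule.smul_mem _ n hx

/-- The action of the Weyl group on `H`: `e^φ (w h) = e^(w⁻¹ φ) (h)`. -/
noncomputable def weylTorus (P : RootPairing ι ℂ M N) (w : P.weylGroup) (h : AdjointTorus P) : AdjointTorus P :=
  MonoidHom.mk'
    (fun φ : Multiplicative (P.rootSpan ℤ) =>
      h.char ⟨w⁻¹ • (φ.toAdd : M), weyl_smul_mem_rootSpan P w⁻¹ φ.toAdd.2⟩)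
    (by
      intro φ ψ
      have hφψ : (⟨w⁻¹ • ((φ * ψ).toAdd : M), weyl_smul_mem_rootSpan P w⁻¹ (φ * ψ).toAdd.2⟩ :
          P.rootSpan ℤ) = ⟨w⁻¹ • (φ.toAdd : M), weyl_smul_mem_rootSpan P w⁻¹ φ.toAdd.2⟩ +
            ⟨w⁻¹ • (ψ.toAdd : M), weyl_smul_mem_rootSpan P w⁻¹ ψ.toAdd.2⟩ := by
        ext
        simp
      rw [hφψ]
      exact MonoidHom.map_mul (show Multiplicative (P.rootSpan ℤ) →* ℂˣ from h) _ _)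

/-- The projective structure `𝒬` on `H°` is Weyl group invariant: for every chart `c` of `𝒬` and
every `w`, the pull-back of `c` along `w` is a chart of `𝒬`. -/
def ProjectiveStructure.IsWeylInvariant {P : RootPairing ι ℂ M N}
    (𝒬 : ProjectiveStructure (torusExp P) (mirrorComplement P)) : Prop :=
  ∀ w : P.weylGroup, ∀ c ∈ 𝒬.atlas, ∀ c' : LocalChart (AdjointTorus P) (ℙ ℂ (N × ℂ)),
    c'.source = weylTorus P w ⁻¹' c.source → (∀ h, c'.toFun h = c.toFun (weylTorus P w h)) →
      c' ∈ 𝒬.atlas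

end Torus

/-! ### The connections -/

section Connections

variable {ι M N : Type*} [Fintype ι] [AddCommGroup M] [Module ℂ M] [NormedAddCommGroup N]
  [NormedSpace ℂ N]

/-- The tensor `½ ∑_{α > 0} k_α (e^α + 1)/(e^α - 1) dα ⊗ dα ⊗ ∂_{α^∨} + B` of the connection `∇`
on `H°`. The terms of `α` and `-α` are equal, so that the sum is `¼` of the sum over all roots. -/
noncomputable def specialForm (P : RootPairing ι ℂ M N) (k : ι → ℂ) (b : N →ₗ[ℂ] N →ₗ[ℂ] N)
    (h : AdjointTorus P) : N →ₗ[ℂ] N →ₗ[ℂ] N :=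
  (1 / 4 : ℂ) • ∑ i, (k i * (((h.char (P.rootSpanMem ℤ i) : ℂˣ) : ℂ) + 1) /
      (((h.char (P.rootSpanMem ℤ i) : ℂˣ) : ℂ) - 1)) •
        (P.root' i).smulRight ((P.root' i).smulRight (P.coroot i)) + b

/-- The tensor of the connection `∇̃` on `H° × ℂˣ`. In the decomposition `N × ℂ` of the Lie
algebra, with `dt/t` the second coordinate, it sends `((u, s), (v, r))` to
`(Γ(u, v) - r u - s v, a(u, v) - s r)`, where `Γ` is the tensor of `∇`; that is,
`ζ ↦ Ω(ζ) - ζ ⊗ dt/t - dt/t ⊗ ζ` and `dt/t ↦ A - dt/t ⊗ dt/t`. -/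
noncomputable def affineForm (P : RootPairing ι ℂ M N) (k : ι → ℂ) (b : N →ₗ[ℂ] N →ₗ[ℂ] N)
    (a : LinearMap.BilinForm ℂ N) (x : AdjointTorus P × ℂˣ) :
    (N × ℂ) →ₗ[ℂ] (N × ℂ) →ₗ[ℂ] (N × ℂ) :=
  LinearMap.mk₂ ℂ
    (fun p q => (specialForm P k b x.1 p.1 q.1 - q.2 • p.1 - p.2 • q.1, a p.1 q.1 - p.2 * q.2))
    (by
      intro p p' q
      ext
      · simp [add_smul]; abel
      · simp; ring)
    (by
      intro c p q
      ext
      · simp [smul_sub, mul_smul, smul_comm c q.2]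
      · simp; ring)
    (by
      intro p q q'
      ext
      · simp [add_smul]; abel
      · simp; ring)
    (by
      intro c p q
      ext
      · simp [smul_sub, mul_smul, smul_comm c p.2]
      · simp; ring)

end Connections

/-! ### Characters and the functions `(e^φ + 1) / (e^φ - 1)` -/

section Characters

variable {ι M N : Type*} [AddCommGroup M] [Module ℂ M] [NormedAddCommGroup N] [NormedSpace ℂ N]
  {P : RootPairing ι ℂ M N}

/-! Write Γ for the tensor of ∇, π_α = α ⊗ α^∨, and B for the coroot form. The connection ∇̃ is a
cone over (∇, A): the function t f(h) is affine-linear for ∇̃ exactly when ∇(df) + f A = 0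
(`hess_coneFun`). Torsion freeness is the symmetry of the tensor. For flatness, the derivative of Γ
at a point is a combination of the tensors α ⊗ α ⊗ α ⊗ α^∨, so Γ is closed and the curvature reduces
to commutators. Those of the cone vanish as soon as [Γ_u, Γ_v] w = a(v, w) u - a(u, w) v and a(u,
Γ_v w) is symmetric in u and v (`curvOp_coneForm`). The point is to find one a that serves all of
H°.

Constancy. In [Γ_u, Γ_v] the terms that mix b with some π_α cancel, because b(x, ·) commutes with
the reflection s_α when α(x) = 0 (`cross_commutator_eq_zero`). There remain the constant [b_u, b_v]
and a sum over pairs of roots of (α ∧ β)(u, v) [π_α, π_β], with coefficients coth(α/2) coth(β/2).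
The involutions (α, β) ↦ (α, -s_α β) and (α, β) ↦ (-s_β α, β) fix these tensors. After averaging
over them, the addition formula of coth removes the dependence on the point
(`exists_sum_charCoth_eq`).

Rigidity. Every Γ_u is self-adjoint for B, since each π_α is and so is b_u (`corootForm_mul_comm`);
hence the commutators are skew. Equivariance compares the points h and wh, so together with
constancy it makes the commutator a W-invariant tensor. On two coroots the reflections leave only a
multiple of the infinitesimal rotation of their plane, and irreducibility makes all these multiples
equal (`exists_curvOp_eq_smul_rotOp`). Thus a = cB.

Geometry. The equation for f is a first order linear system for the frame (df, f), integrable by the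
above. The Frobenius theorem (`exists_fundamental_solution`) gives dim + 1 independent solutions
near each point, and two such frames differ by a constant linear map. This yields the projective
charts f, the affine charts t f and the form of the transition maps. Weyl group invariance holds
because solutions pull back to solutions. -/

theorem AdjointTorus.char_add (φ ψ : P.rootSpan ℤ) (h : AdjointTorus P) :
    h.char (φ + ψ) = h.char φ * h.char ψ :=
  MonoidHom.map_mul (show Multiplicative (P.rootSpan ℤ) →* ℂˣ from h) _ _

theorem AdjointTorus.char_zero (h : AdjointTorus P) : h.char 0 = 1 :=
  MonoidHom.map_one (show Multiplicative (P.rootSpan ℤ) →* ℂˣ from h)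

theorem AdjointTorus.char_neg (φ : P.rootSpan ℤ) (h : AdjointTorus P) :
    h.char (-φ) = (h.char φ)⁻¹ :=
  eq_inv_of_mul_eq_one_left (by rw [← char_add, neg_add_cancel, char_zero])

theorem AdjointTorus.char_mul (φ : P.rootSpan ℤ) (g h : AdjointTorus P) :
    (g * h).char φ = g.char φ * h.char φ := rfl

/-- The function `(e^φ + 1) / (e^φ - 1)`. -/
noncomputable def charCoth (h : AdjointTorus P) (φ : P.rootSpan ℤ) : ℂ :=
  ((h.char φ : ℂˣ) + 1 : ℂ) / ((h.char φ : ℂˣ) - 1 : ℂ)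

theorem charCoth_neg (h : AdjointTorus P) (φ : P.rootSpan ℤ) :
    charCoth h (-φ) = -charCoth h φ := by
  unfold charCoth
  rw [AdjointTorus.char_neg, Units.val_inv_eq_inv_val]
  have hx := (h.char φ).ne_zero
  generalize ((h.char φ : ℂˣ) : ℂ) = x at hx
  by_cases h1 : x = 1
  · simp [h1]
  · have h2 : x - 1 ≠ 0 := sub_ne_zero.mpr h1
    have h3 : 1 - x ≠ 0 := sub_ne_zero.mpr (Ne.symm h1)
    have h4 : x⁻¹ - 1 ≠ 0 := by
      rw [sub_ne_zero]; exact fun h => h1 (inv_eq_one.mp h)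
    rw [div_eq_iff h4]
    field_simp
    ring

/-- This is coth(x + y)(coth x + coth y) = 1 + coth x coth y. Besides oddness it is all that the
rank two cancellations use. -/
theorem charCoth_add {h : AdjointTorus P} {φ ψ : P.rootSpan ℤ} (hφ : h.char φ ≠ 1)
    (hψ : h.char ψ ≠ 1) (hs : h.char (φ + ψ) ≠ 1) :
    charCoth h (φ + ψ) * (charCoth h φ + charCoth h ψ) = 1 + charCoth h φ * charCoth h ψ := by
  unfold charCoth
  rw [AdjointTorus.char_add] at *
  rw [ne_eq, ← Units.val_inj] at hφ hψ hs
  rw [Units.val_mul, Units.val_one] at *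
  generalize ((h.char φ : ℂˣ) : ℂ) = x at *
  generalize ((h.char ψ : ℂˣ) : ℂ) = y at *
  have h1 : x - 1 ≠ 0 := sub_ne_zero.mpr hφ
  have h2 : y - 1 ≠ 0 := sub_ne_zero.mpr hψ
  have h3 : x * y - 1 ≠ 0 := sub_ne_zero.mpr hs
  field_simp
  ring

end Characters

/-! ### Rank two identities -/

section RankTwo

variable {ι M N : Type*} [AddCommGroup M] [Module ℂ M] [NormedAddCommGroup N] [NormedSpace ℂ N]
  (P : RootPairing ι ℂ M N)

theorem root'_apply_coreflection (i j : ι) (u : N) :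
    P.root' j (P.coreflection i u) = P.root' (P.reflectionPerm i j) u := by
  simp only [RootPairing.root', RootPairing.root_reflectionPerm, RootPairing.coreflection_apply,
    RootPairing.reflection_apply, map_sub, map_smul, LinearMap.sub_apply, LinearMap.smul_apply,
    smul_eq_mul, LinearMap.flip_apply]
  ring

theorem root'_reflectionPerm_apply (i j : ι) (u : N) :
    P.root' (P.reflectionPerm i j) u = P.root' j u - P.pairing j i * P.root' i u := by
  rw [← root'_apply_coreflection, RootPairing.coreflection_apply, map_sub, map_smul,
    RootPairing.root'_coroot_eq_pairing, smul_eq_mul]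
  ring

/-- The value at `w` of `(α_i ∧ α_j)(u, v) [π_i, π_j]`, where `π_i = α_i ⊗ α_i^∨`. -/
noncomputable def wedgeComm (u v w : N) (i j : ι) : N :=
  (P.root' i u * P.root' j v - P.root' i v * P.root' j u) •
    ((P.root' j w * P.pairing i j) • P.coroot i - (P.root' i w * P.pairing j i) • P.coroot j)

variable (u v w : N) (i j : ι)

theorem wedgeComm_swap : wedgeComm P u v w j i = wedgeComm P u v w i j := by
  unfold wedgeComm; module

/-- For s = 1 - π_i, the relation π_i² = 2π_i gives s[π_i, π_j]s = -[π_i, π_j], and sπ_js belongs to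
the root s_i α_j. The two-form does not change, as s_i α_j - α_j is a multiple of α_i. -/
theorem wedgeComm_reflectionPerm_right :
    wedgeComm P u v w i (P.reflectionPerm i j) = -wedgeComm P u v w i j := by
  unfold wedgeComm
  have h1 : P.pairing i (P.reflectionPerm i j) = -P.pairing i j := by
    rw [P.pairing_reflectionPerm, P.pairing_reflectionPerm_self_left]
  have h2 : P.pairing (P.reflectionPerm i j) i = -P.pairing j i := by
    rw [← P.pairing_reflectionPerm, P.pairing_reflectionPerm_self_right]
  rw [h1, h2, root'_reflectionPerm_apply, root'_reflectionPerm_apply, root'_reflectionPerm_apply,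
    RootPairing.coroot_reflectionPerm, RootPairing.coreflection_apply_coroot]
  module

theorem root'_neg_apply : P.root' (P.reflectionPerm i i) u = -P.root' i u := by
  rw [root'_reflectionPerm_apply, RootPairing.pairing_same]; ring

theorem wedgeComm_neg_right :
    wedgeComm P u v w i (P.reflectionPerm j j) = -wedgeComm P u v w i j := by
  unfold wedgeComm
  rw [P.pairing_reflectionPerm_self_left, P.pairing_reflectionPerm_self_right, root'_neg_apply,
    root'_neg_apply, root'_neg_apply, RootPairing.coroot_reflectionPerm,
    RootPairing.coreflection_apply_self]
  module

theorem wedgeComm_neg_left :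
    wedgeComm P u v w (P.reflectionPerm i i) j = -wedgeComm P u v w i j := by
  rw [wedgeComm_swap, wedgeComm_neg_right, wedgeComm_swap]

theorem root_reflectionPerm_neg :
    P.root (P.reflectionPerm i (P.reflectionPerm j j)) = -P.reflection i (P.root j) := by
  simp

/-- The involution `(α, β) ↦ (α, -s_α β)` on pairs of roots. -/
noncomputable def pairFlip : Equiv.Perm (ι × ι) where
  toFun x := (x.1, P.reflectionPerm x.1 (P.reflectionPerm x.2 x.2))
  invFun x := (x.1, P.reflectionPerm x.1 (P.reflectionPerm x.2 x.2))
  left_inv x := Prod.ext rfl (P.root.injective (by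
    rw [root_reflectionPerm_neg, root_reflectionPerm_neg, map_neg, P.reflection_same, neg_neg]))
  right_inv x := Prod.ext rfl (P.root.injective (by
    rw [root_reflectionPerm_neg, root_reflectionPerm_neg, map_neg, P.reflection_same, neg_neg]))

theorem pairFlip_apply (x : ι × ι) :
    pairFlip P x = (x.1, P.reflectionPerm x.1 (P.reflectionPerm x.2 x.2)) := rfl

theorem wedgeComm_pairFlip (x : ι × ι) :
    wedgeComm P u v w (pairFlip P x).1 (pairFlip P x).2 = wedgeComm P u v w x.1 x.2 := by
  rw [pairFlip_apply]
  dsimp only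
  rw [wedgeComm_reflectionPerm_right, wedgeComm_neg_right, neg_neg]

variable [P.IsCrystallographic]

theorem pairingIn_pairFlip (x : ι × ι) :
    P.pairingIn ℤ (pairFlip P x).1 (pairFlip P x).2 = P.pairingIn ℤ x.1 x.2 ∧
      P.pairingIn ℤ (pairFlip P x).2 (pairFlip P x).1 = P.pairingIn ℤ x.2 x.1 := by
  rw [pairFlip_apply]
  dsimp only
  rw [P.pairingIn_reflectionPerm, ← P.pairingIn_reflectionPerm ℤ x.1 _ x.1]
  simp

theorem rootSpanMem_pairFlip (x : ι × ι) :
    P.rootSpanMem ℤ (pairFlip P x).2 =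
      P.pairingIn ℤ x.2 x.1 • P.rootSpanMem ℤ x.1 - P.rootSpanMem ℤ x.2 := by
  apply Subtype.ext
  rw [pairFlip_apply]
  have h : (P.pairingIn ℤ x.2 x.1) • P.root x.1 = P.pairing x.2 x.1 • P.root x.1 := by
    rw [← P.algebraMap_pairingIn ℤ, algebraMap_int_eq, eq_intCast, Int.cast_smul_eq_zsmul]
  simp only [AddSubgroupClass.coe_sub, RootPairing.root_reflectionPerm,
    RootPairing.reflection_apply_self, map_neg, Submodule.coe_smul, RootPairing.reflection_apply_root]
  rw [h]
  module

/-- The involution `(α, β) ↦ (-s_β α, β)` on pairs of roots. -/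
noncomputable def pairFlip' : Equiv.Perm (ι × ι) :=
  (Equiv.prodComm ι ι).trans ((pairFlip P).trans (Equiv.prodComm ι ι))

omit [P.IsCrystallographic] in
theorem pairFlip'_apply (x : ι × ι) : pairFlip' P x = (pairFlip P x.swap).swap := rfl

omit [P.IsCrystallographic] in
theorem wedgeComm_pairFlip' (x : ι × ι) :
    wedgeComm P u v w (pairFlip' P x).1 (pairFlip' P x).2 = wedgeComm P u v w x.1 x.2 := by
  rw [pairFlip'_apply, Prod.fst_swap, Prod.snd_swap, wedgeComm_swap, wedgeComm_pairFlip,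
    Prod.fst_swap, Prod.snd_swap, wedgeComm_swap]

theorem pairingIn_pairFlip' (x : ι × ι) :
    P.pairingIn ℤ (pairFlip' P x).1 (pairFlip' P x).2 = P.pairingIn ℤ x.1 x.2 ∧
      P.pairingIn ℤ (pairFlip' P x).2 (pairFlip' P x).1 = P.pairingIn ℤ x.2 x.1 := by
  obtain ⟨h1, h2⟩ := pairingIn_pairFlip P x.swap
  exact ⟨h2, h1⟩

theorem rootSpanMem_pairFlip' (x : ι × ι) :
    P.rootSpanMem ℤ (pairFlip' P x).1 =
      P.pairingIn ℤ x.1 x.2 • P.rootSpanMem ℤ x.2 - P.rootSpanMem ℤ x.1 :=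
  rootSpanMem_pairFlip P x.swap

variable [Fintype ι]

/-- The pairs of roots with given values of the two pairings. -/
noncomputable def pairsOfType (a b : ℤ) : Finset (ι × ι) :=
  Finset.univ.filter fun x => P.pairingIn ℤ x.1 x.2 = a ∧ P.pairingIn ℤ x.2 x.1 = b

theorem mem_pairsOfType {a b : ℤ} {x : ι × ι} :
    x ∈ pairsOfType P a b ↔ P.pairingIn ℤ x.1 x.2 = a ∧ P.pairingIn ℤ x.2 x.1 = b := by
  simp [pairsOfType]

variable {P} {V : Type*} [AddCommGroup V]

theorem sum_pairFlip (a b : ℤ) (f : ι × ι → V) :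
    ∑ x ∈ pairsOfType P a b, f (pairFlip P x) = ∑ x ∈ pairsOfType P a b, f x :=
  Finset.sum_equiv (pairFlip P)
    (fun x => by
      rw [mem_pairsOfType, mem_pairsOfType, (pairingIn_pairFlip P x).1, (pairingIn_pairFlip P x).2])
    (fun _ _ => rfl)

theorem sum_pairFlip' (a b : ℤ) (f : ι × ι → V) :
    ∑ x ∈ pairsOfType P a b, f (pairFlip' P x) = ∑ x ∈ pairsOfType P a b, f x :=
  Finset.sum_equiv (pairFlip' P)
    (fun x => by
      rw [mem_pairsOfType, mem_pairsOfType, (pairingIn_pairFlip' P x).1,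
        (pairingIn_pairFlip' P x).2])
    (fun _ _ => rfl)

theorem sum_swap (a b : ℤ) (f : ι × ι → V) :
    ∑ x ∈ pairsOfType P a b, f x.swap = ∑ x ∈ pairsOfType P b a, f x :=
  Finset.sum_equiv (Equiv.prodComm ι ι)
    (fun x => by
      rw [mem_pairsOfType, mem_pairsOfType]; exact and_comm)
    (fun _ _ => rfl)

theorem sum_neg_fst (a b : ℤ) (f : ι × ι → V) :
    ∑ x ∈ pairsOfType P a b, f (P.reflectionPerm x.1 x.1, x.2) =
      ∑ x ∈ pairsOfType P (-a) (-b), f x := by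
  let := P.indexNeg
  refine Finset.sum_equiv ((Equiv.neg ι).prodCongr (Equiv.refl ι)) (fun x => ?_) (fun _ _ => rfl)
  rw [mem_pairsOfType, mem_pairsOfType]
  simp

variable [Module ℂ V] {h : AdjointTorus P} {Z : ι × ι → V}

/-- Here α + β is, up to sign, the root that the two flips put in place of β, respectively of α. By
the addition formula the three products belonging to a pair and its flips add up to -1, and the
three sums are equal. -/
theorem sum_charCoth_of_neg_one (hh : h ∈ mirrorComplement P)
    (h1 : ∀ x, Z (pairFlip P x) = Z x) (h2 : ∀ x, Z (pairFlip' P x) = Z x) :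
    ∑ x ∈ pairsOfType P (-1) (-1),
      (charCoth h (P.rootSpanMem ℤ x.1) * charCoth h (P.rootSpanMem ℤ x.2)) • Z x =
    (-1 / 3 : ℂ) • ∑ x ∈ pairsOfType P (-1) (-1), Z x := by
  set F : ι × ι → V := fun x =>
    (charCoth h (P.rootSpanMem ℤ x.1) * charCoth h (P.rootSpanMem ℤ x.2)) • Z x with hF
  suffices H : ∑ x ∈ pairsOfType P (-1) (-1), (F x + F (pairFlip P x) + F (pairFlip' P x)) =
      -∑ x ∈ pairsOfType P (-1) (-1), Z x by
    rw [Finset.sum_add_distrib, Finset.sum_add_distrib, sum_pairFlip, sum_pairFlip'] at H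
    linear_combination (norm := module) (1 / 3 : ℂ) • H
  rw [← Finset.sum_neg_distrib]
  refine Finset.sum_congr rfl fun x hx => ?_
  rw [mem_pairsOfType] at hx
  have e1 := rootSpanMem_pairFlip P x
  have e2 := rootSpanMem_pairFlip' P x
  rw [hx.2] at e1
  rw [hx.1] at e2
  have e1' : P.rootSpanMem ℤ (pairFlip P x).2 = -(P.rootSpanMem ℤ x.1 + P.rootSpanMem ℤ x.2) := by
    rw [e1]; module
  have e2' : P.rootSpanMem ℤ (pairFlip' P x).1 = -(P.rootSpanMem ℤ x.1 + P.rootSpanMem ℤ x.2) := by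
    rw [e2]; module
  have hs : h.char (P.rootSpanMem ℤ x.1 + P.rootSpanMem ℤ x.2) ≠ 1 := by
    have := hh (pairFlip P x).2
    rwa [e1', AdjointTorus.char_neg, ne_eq, inv_eq_one] at this
  have key := charCoth_add (hh x.1) (hh x.2) hs
  have f1 : (pairFlip P x).1 = x.1 := rfl
  have f2 : (pairFlip' P x).2 = x.2 := rfl
  simp only [hF, h1, h2, e1', e2', f1, f2, charCoth_neg]
  rw [← add_smul, ← add_smul, ← neg_one_smul ℂ (Z x)]
  congr 1
  linear_combination -key

/-- As ⟨β, α^∨⟩ = 1, the flip replaces β by α - β, and α is the sum of the two. The addition formula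
trades the products that contain α for the product of the two summands. -/
theorem two_smul_sum_charCoth {a : ℤ} (hh : h ∈ mirrorComplement P)
    (h1 : ∀ x, Z (pairFlip P x) = Z x) :
    (2 : ℂ) • ∑ x ∈ pairsOfType P a 1,
      (charCoth h (P.rootSpanMem ℤ x.1) * charCoth h (P.rootSpanMem ℤ x.2)) • Z x =
    ∑ x ∈ pairsOfType P a 1, Z x + ∑ x ∈ pairsOfType P a 1,
      (charCoth h (P.rootSpanMem ℤ x.2) * charCoth h (P.rootSpanMem ℤ (pairFlip P x).2)) • Z x := by
  set F : ι × ι → V := fun x =>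
    (charCoth h (P.rootSpanMem ℤ x.1) * charCoth h (P.rootSpanMem ℤ x.2)) • Z x with hF
  have H : (2 : ℂ) • ∑ x ∈ pairsOfType P a 1, F x =
      ∑ x ∈ pairsOfType P a 1, (F x + F (pairFlip P x)) := by
    rw [Finset.sum_add_distrib, sum_pairFlip, two_smul]
  rw [H, ← Finset.sum_add_distrib]
  refine Finset.sum_congr rfl fun x hx => ?_
  rw [mem_pairsOfType] at hx
  have e1 := rootSpanMem_pairFlip P x
  rw [hx.2, one_smul] at e1
  have e : P.rootSpanMem ℤ x.2 + P.rootSpanMem ℤ (pairFlip P x).2 = P.rootSpanMem ℤ x.1 := by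
    rw [e1]; abel
  have key := charCoth_add (hh x.2) (hh (pairFlip P x).2) (by rw [e]; exact hh x.1)
  rw [e] at key
  have f1 : (pairFlip P x).1 = x.1 := rfl
  simp only [hF, h1, f1]
  nth_rw 3 [← one_smul ℂ (Z x)]
  rw [← add_smul, ← add_smul]
  congr 1
  linear_combination key

/-- The other flip leads to (2β - α, β), where the second summand is β - α instead of α - β. So the
sum left over by `two_smul_sum_charCoth` cancels by oddness. -/
theorem sum_charCoth_of_two (hh : h ∈ mirrorComplement P)
    (h1 : ∀ x, Z (pairFlip P x) = Z x) (h2 : ∀ x, Z (pairFlip' P x) = Z x) :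
    ∑ x ∈ pairsOfType P 2 1,
      (charCoth h (P.rootSpanMem ℤ x.1) * charCoth h (P.rootSpanMem ℤ x.2)) • Z x =
    (1 / 2 : ℂ) • ∑ x ∈ pairsOfType P 2 1, Z x := by
  have H := two_smul_sum_charCoth (a := 2) hh h1
  set G : ι × ι → V := fun x =>
    (charCoth h (P.rootSpanMem ℤ x.2) * charCoth h (P.rootSpanMem ℤ (pairFlip P x).2)) • Z x with hG
  have hG0 : ∑ x ∈ pairsOfType P 2 1, (G x + G (pairFlip' P x)) = 0 := by
    refine Finset.sum_eq_zero fun x hx => ?_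
    have hx' : pairFlip' P x ∈ pairsOfType P 2 1 := by
      rw [mem_pairsOfType] at *
      rwa [(pairingIn_pairFlip' P x).1, (pairingIn_pairFlip' P x).2]
    rw [mem_pairsOfType] at hx hx'
    have f2 : (pairFlip' P x).2 = x.2 := rfl
    have e : P.rootSpanMem ℤ (pairFlip P (pairFlip' P x)).2 =
        -P.rootSpanMem ℤ (pairFlip P x).2 := by
      rw [rootSpanMem_pairFlip, rootSpanMem_pairFlip, rootSpanMem_pairFlip', hx'.2, hx.1, hx.2, f2]
      module
    simp only [hG, h2, f2, e, charCoth_neg]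
    module
  rw [Finset.sum_add_distrib, sum_pairFlip'] at hG0
  linear_combination (norm := module) (1 / 2 : ℂ) • H + (1 / 4 : ℂ) • hG0

/-- In this G₂ case, the left-over products along three flipped pairs involve β, α - β and ±(2β -
α). Since β + (α - 2β) = α - β, they add up to 1; the left-over sum is a third of the sum of `Z`,
and (1 + 1/3)/2 = 2/3. -/
theorem sum_charCoth_of_three (hh : h ∈ mirrorComplement P)
    (h1 : ∀ x, Z (pairFlip P x) = Z x) (h2 : ∀ x, Z (pairFlip' P x) = Z x) :
    ∑ x ∈ pairsOfType P 3 1,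
      (charCoth h (P.rootSpanMem ℤ x.1) * charCoth h (P.rootSpanMem ℤ x.2)) • Z x =
    (2 / 3 : ℂ) • ∑ x ∈ pairsOfType P 3 1, Z x := by
  have H := two_smul_sum_charCoth (a := 3) hh h1
  set G : ι × ι → V := fun x =>
    (charCoth h (P.rootSpanMem ℤ x.2) * charCoth h (P.rootSpanMem ℤ (pairFlip P x).2)) • Z x with hG
  have hG0 : ∑ x ∈ pairsOfType P 3 1, (G x + G (pairFlip' P x) + G (pairFlip' P (pairFlip P x))) =
      ∑ x ∈ pairsOfType P 3 1, Z x := by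
    refine Finset.sum_congr rfl fun x hx => ?_
    have hx1 : pairFlip P x ∈ pairsOfType P 3 1 := by
      rw [mem_pairsOfType] at *
      rwa [(pairingIn_pairFlip P x).1, (pairingIn_pairFlip P x).2]
    have hx' : ∀ y ∈ pairsOfType P 3 1, pairFlip' P y ∈ pairsOfType P 3 1 := fun y hy => by
      rw [mem_pairsOfType] at *
      rwa [(pairingIn_pairFlip' P y).1, (pairingIn_pairFlip' P y).2]
    have e : ∀ y ∈ pairsOfType P 3 1, P.rootSpanMem ℤ (pairFlip P (pairFlip' P y)).2 =
        (2 : ℤ) • P.rootSpanMem ℤ y.2 - P.rootSpanMem ℤ y.1 := fun y hy => by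
      have hy' := hx' y hy
      rw [mem_pairsOfType] at hy hy'
      have f2 : (pairFlip' P y).2 = y.2 := rfl
      rw [rootSpanMem_pairFlip, rootSpanMem_pairFlip', hy'.2, hy.1, f2]
      module
    have f2 : (pairFlip' P x).2 = x.2 := rfl
    have f3 : (pairFlip' P (pairFlip P x)).2 = (pairFlip P x).2 := rfl
    have f1 : (pairFlip P x).1 = x.1 := rfl
    have e1 : P.rootSpanMem ℤ (pairFlip P x).2 = P.rootSpanMem ℤ x.1 - P.rootSpanMem ℤ x.2 := by
      rw [rootSpanMem_pairFlip, (mem_pairsOfType P).1 hx |>.2]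
      module
    have e2 := e _ hx
    have e3 : P.rootSpanMem ℤ (pairFlip P (pairFlip' P (pairFlip P x))).2 =
        -((2 : ℤ) • P.rootSpanMem ℤ x.2 - P.rootSpanMem ℤ x.1) := by
      rw [e _ hx1, f1, e1]
      module
    have n1 := hh (pairFlip P x).2
    have n3 := hh (pairFlip P (pairFlip' P (pairFlip P x))).2
    have e4 : P.rootSpanMem ℤ x.2 + P.rootSpanMem ℤ (pairFlip P (pairFlip' P (pairFlip P x))).2 =
        P.rootSpanMem ℤ (pairFlip P x).2 := by
      rw [e3, e1]; module
    have key := charCoth_add (hh x.2) n3 (by rw [e4]; exact n1)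
    rw [e4, e3] at key
    simp only [hG, h1, h2, f2, f3, e2, e3]
    rw [← add_smul, ← add_smul]
    nth_rw 2 [← one_smul ℂ (Z x)]
    congr 1
    rw [charCoth_neg] at *
    linear_combination key
  rw [Finset.sum_add_distrib, Finset.sum_add_distrib, sum_pairFlip',
    sum_pairFlip (f := fun x => G (pairFlip' P x)), sum_pairFlip'] at hG0
  linear_combination (norm := module) (1 / 2 : ℂ) • H + (1 / 6 : ℂ) • hG0

theorem exists_sum_charCoth_eq [P.IsReduced] (k : ι → ℂ)
    (hk : ∀ i j, k (P.reflectionPerm i j) = k j) (u v w : N) :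
    ∃ T : N, ∀ h ∈ mirrorComplement P, ∑ i, ∑ j,
      (k i * k j * charCoth h (P.rootSpanMem ℤ i) * charCoth h (P.rootSpanMem ℤ j)) •
        wedgeComm P u v w i j = T := by
  set Z : ι × ι → N := fun x => (k x.1 * k x.2) • wedgeComm P u v w x.1 x.2 with hZ
  have h1 : ∀ x, Z (pairFlip P x) = Z x := fun x => by
    simp only [hZ, wedgeComm_pairFlip]
    rw [pairFlip_apply]
    simp only [hk]
  have h2 : ∀ x, Z (pairFlip' P x) = Z x := fun x => by
    simp only [hZ, wedgeComm_pairFlip']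
    rw [pairFlip'_apply, pairFlip_apply]
    simp [hk]
  set F : AdjointTorus P → ι × ι → N := fun h x =>
    (charCoth h (P.rootSpanMem ℤ x.1) * charCoth h (P.rootSpanMem ℤ x.2)) • Z x with hF
  have hswap : ∀ h x, F h x.swap = F h x := fun h x => by
    simp only [hF, hZ, Prod.fst_swap, Prod.snd_swap, wedgeComm_swap P u v w x.1 x.2,
      mul_comm (k x.2), mul_comm (charCoth h (P.rootSpanMem ℤ x.2))]
  have hneg : ∀ h x, F h (P.reflectionPerm x.1 x.1, x.2) = F h x := fun h x => by
    simp only [hF, hZ, wedgeComm_neg_left, hk, P.rootSpanMem_reflectionPerm_self, charCoth_neg]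
    module
  -- `C a b` says that the pairs of type (a, b) contribute a constant. Exchanging the roots and
  -- changing the sign of the first reduce all types to (0, 0), (2, 2), (-1, -1), (2, 1) and (3, 1).
  let C : ℤ → ℤ → Prop := fun a b =>
    ∃ T : N, ∀ h ∈ mirrorComplement P, ∑ x ∈ pairsOfType P a b, F h x = T
  have cswap : ∀ a b, C a b → C b a := fun a b ⟨T, hT⟩ => ⟨T, fun h hh => by
    rw [← hT h hh, ← sum_swap]; simp only [hswap]⟩
  have cneg : ∀ a b, C a b → C (-a) (-b) := fun a b ⟨T, hT⟩ => ⟨T, fun h hh => by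
    rw [← hT h hh, ← sum_neg_fst]
    exact Finset.sum_congr rfl fun x _ => hneg h x⟩
  have c11 : C (-1) (-1) := ⟨_, fun h hh => sum_charCoth_of_neg_one hh h1 h2⟩
  have c21 : C 2 1 := ⟨_, fun h hh => sum_charCoth_of_two hh h1 h2⟩
  have c31 : C 3 1 := ⟨_, fun h hh => sum_charCoth_of_three hh h1 h2⟩
  have c00 : C 0 0 := ⟨0, fun h hh => Finset.sum_eq_zero fun x hx => by
    rw [mem_pairsOfType] at hx
    have e1 : P.pairing x.1 x.2 = 0 := by rw [← P.algebraMap_pairingIn ℤ, hx.1, map_zero]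
    have e2 : P.pairing x.2 x.1 = 0 := by rw [← P.algebraMap_pairingIn ℤ, hx.2, map_zero]
    simp [hF, hZ, wedgeComm, e1, e2]⟩
  -- In a reduced system only equal roots have this type, and their two-form vanishes.
  have c22 : C 2 2 := ⟨0, fun h hh => Finset.sum_eq_zero fun x hx => by
    rw [mem_pairsOfType] at hx
    have e : x.1 = x.2 := by
      by_contra hne
      by_cases hn : P.root x.1 = -P.root x.2
      · rw [P.root_eq_neg_iff] at hn
        rw [hn] at hx
        simp at hx
      · have := P.pairingIn_pairingIn_mem_set_of_isCrystal_of_isRed' x.1 x.2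
          (fun e => hne (P.root.injective e)) hn
        rw [hx.1, hx.2] at this
        simp at this
    simp [hF, hZ, wedgeComm, e, mul_comm]⟩
  have call : ∀ y ∈ ({(0, 0), (1, 1), (-1, -1), (1, 2), (2, 1), (-1, -2), (-2, -1), (1, 3), (3, 1),
      (-1, -3), (-3, -1), (2, 2), (-2, -2)} : Finset (ℤ × ℤ)), C y.1 y.2 := by
    intro y hy
    simp only [Finset.mem_insert, Finset.mem_singleton] at hy
    rcases hy with rfl | rfl | rfl | rfl | rfl | rfl | rfl | rfl | rfl | rfl | rfl | rfl | rfl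
    · exact c00
    · exact cneg _ _ c11
    · exact c11
    · exact cswap _ _ c21
    · exact c21
    · exact cneg _ _ (cswap _ _ c21)
    · exact cneg _ _ c21
    · exact cswap _ _ c31
    · exact c31
    · exact cneg _ _ (cswap _ _ c31)
    · exact cneg _ _ c31
    · exact c22
    · exact cneg _ _ c22
  choose! T hT using call
  refine ⟨∑ y ∈ ({(0, 0), (1, 1), (-1, -1), (1, 2), (2, 1), (-1, -2), (-2, -1), (1, 3), (3, 1),
      (-1, -3), (-3, -1), (2, 2), (-2, -2)} : Finset (ℤ × ℤ)), T y, fun h hh => ?_⟩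
  rw [← Fintype.sum_prod_type']
  calc ∑ x : ι × ι, (k x.1 * k x.2 * charCoth h (P.rootSpanMem ℤ x.1) *
        charCoth h (P.rootSpanMem ℤ x.2)) • wedgeComm P u v w x.1 x.2
      = ∑ x : ι × ι, F h x := Finset.sum_congr rfl fun x _ => by
        simp only [hF, hZ, smul_smul]; congr 1; ring
    _ = _ := by
        rw [← Finset.sum_fiberwise_of_maps_to
          (g := fun x : ι × ι => (P.pairingIn ℤ x.1 x.2, P.pairingIn ℤ x.2 x.1))
          (t := {(0, 0), (1, 1), (-1, -1), (1, 2), (2, 1), (-1, -2), (-2, -1), (1, 3), (3, 1),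
            (-1, -3), (-3, -1), (2, 2), (-2, -2)}) (fun x _ => ?_)]
        · refine Finset.sum_congr rfl fun y hy => ?_
          rw [← hT y hy h hh]
          refine Finset.sum_congr ?_ fun _ _ => rfl
          ext x
          simp [mem_pairsOfType, Prod.ext_iff]
        · have := P.pairingIn_pairingIn_mem_set_of_isCrystal_of_isRed x.1 x.2
          simpa using this

end RankTwo


/-! ### Curvature of a symmetric bilinear product -/

section Curvature

variable {N : Type*} [AddCommGroup N] [Module ℂ N]

/-- The commutator `[Γ_u, Γ_v]`, applied to `w`. -/
def curvOp (Γ : N →ₗ[ℂ] N →ₗ[ℂ] N) (u v w : N) : N := Γ u (Γ v w) - Γ v (Γ u w)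

theorem curvOp_self (Γ : N →ₗ[ℂ] N →ₗ[ℂ] N) (u w : N) : curvOp Γ u u w = 0 := sub_self _

theorem curvOp_swap (Γ : N →ₗ[ℂ] N →ₗ[ℂ] N) (u v w : N) :
    curvOp Γ v u w = -curvOp Γ u v w := (neg_sub _ _).symm

theorem curvOp_add_mid (Γ : N →ₗ[ℂ] N →ₗ[ℂ] N) (u v v' w : N) :
    curvOp Γ u (v + v') w = curvOp Γ u v w + curvOp Γ u v' w := by
  simp only [curvOp, map_add, LinearMap.add_apply]; abel

theorem curvOp_smul_mid (Γ : N →ₗ[ℂ] N →ₗ[ℂ] N) (c : ℂ) (u v w : N) :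
    curvOp Γ u (c • v) w = c • curvOp Γ u v w := by
  simp only [curvOp, map_smul, LinearMap.smul_apply, smul_sub]

theorem curvOp_sub_right (Γ : N →ₗ[ℂ] N →ₗ[ℂ] N) (u v w w' : N) :
    curvOp Γ u v (w - w') = curvOp Γ u v w - curvOp Γ u v w' := by
  simp only [curvOp, map_sub]; abel

theorem curvOp_smul_right (Γ : N →ₗ[ℂ] N →ₗ[ℂ] N) (c : ℂ) (u v w : N) :
    curvOp Γ u v (c • w) = c • curvOp Γ u v w := by
  simp only [curvOp, map_smul, smul_sub]

/-- The endomorphism `u ∧ v` of a space with a bilinear form, applied to `w`. -/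
def rotOp (B : LinearMap.BilinForm ℂ N) (u v w : N) : N := B v w • u - B u w • v

end Curvature

/-! ### Skew curvature tensors that are invariant under the Weyl group -/

section RootForms

variable {ι M N : Type*} [Fintype ι] [AddCommGroup M] [Module ℂ M] [NormedAddCommGroup N]
  [NormedSpace ℂ N] (P : RootPairing ι ℂ M N)

theorem corootForm_coreflection (i : ι) (u v : N) :
    P.CorootForm (P.coreflection i u) (P.coreflection i v) = P.CorootForm u v :=
  P.flip.rootForm_reflection_reflection_apply i u v

theorem corootForm_comm (u v : N) : P.CorootForm u v = P.CorootForm v u := by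
  simp [RootPairing.corootForm_apply_apply, mul_comm]

/-- The reflection is an isometry that negates α_i^∨, so u and its reflection u - α_i(u) α_i^∨ have
opposite products with α_i^∨. -/
theorem two_mul_corootForm_coroot (i : ι) (u : N) :
    2 * P.CorootForm (P.coroot i) u = P.root' i u * P.CorootForm (P.coroot i) (P.coroot i) := by
  have h := corootForm_coreflection P i (P.coroot i) u
  rw [RootPairing.coreflection_apply_self, RootPairing.coreflection_apply, map_neg, map_sub,
    LinearMap.neg_apply, LinearMap.neg_apply, map_smul, smul_eq_mul] at h
  linear_combination -h

variable [P.IsCrystallographic]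

theorem corootForm_coroot_ne_zero (i : ι) : P.CorootForm (P.coroot i) (P.coroot i) ≠ 0 :=
  RootPairing.IsAnisotropic.corootForm_coroot_ne_zero i

variable [P.IsReduced]

theorem pairing_mul_pairing_ne_four {i j : ι} (h1 : i ≠ j) (h2 : i ≠ P.reflectionPerm j j) :
    P.pairing i j * P.pairing j i ≠ 4 := by
  have h := P.pairingIn_pairingIn_mem_set_of_isCrystal_of_isRed' i j
    (fun e => h1 (P.root.injective e)) (fun e => h2 (P.root_eq_neg_iff.1 e))
  rw [← P.algebraMap_pairingIn ℤ, ← P.algebraMap_pairingIn ℤ]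
  simp only [Set.mem_insert_iff, Set.mem_singleton_iff, Prod.mk.injEq] at h
  rcases h with h | h | h | h | h | h | h | h | h | h | h <;> rw [h.1, h.2] <;> norm_num

/-- Four times this Gram determinant is the product of the two square lengths times 4 - ⟨α, β^∨⟩⟨β,
α^∨⟩, and the value 4 occurs only for proportional roots. -/
theorem corootForm_gram_ne_zero {i j : ι} (h1 : i ≠ j) (h2 : i ≠ P.reflectionPerm j j) :
    P.CorootForm (P.coroot i) (P.coroot i) * P.CorootForm (P.coroot j) (P.coroot j) -
      P.CorootForm (P.coroot i) (P.coroot j) ^ 2 ≠ 0 := by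
  have e1 := two_mul_corootForm_coroot P i (P.coroot j)
  have e2 := two_mul_corootForm_coroot P j (P.coroot i)
  rw [corootForm_comm, RootPairing.root'_coroot_eq_pairing] at e2
  rw [RootPairing.root'_coroot_eq_pairing] at e1
  intro h
  refine pairing_mul_pairing_ne_four P h1 h2 ?_
  have n1 := corootForm_coroot_ne_zero P i
  have n2 := corootForm_coroot_ne_zero P j
  refine mul_right_cancel₀ (mul_ne_zero n1 n2) ?_
  linear_combination (-4) * h - 2 * P.CorootForm (P.coroot i) (P.coroot j) * e1
    - P.pairing i j * P.CorootForm (P.coroot i) (P.coroot i) * e2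

variable {P} {Γ : N →ₗ[ℂ] N →ₗ[ℂ] N}

/-- A curvature tensor that is skew and invariant acts on the plane of two coroots only. -/
theorem exists_curvOp_coroot_eq
    (hskew : ∀ u v x y, P.CorootForm (curvOp Γ u v x) y = -P.CorootForm x (curvOp Γ u v y))
    (hinv : ∀ i u v w, curvOp Γ (P.coreflection i u) (P.coreflection i v) (P.coreflection i w) =
      P.coreflection i (curvOp Γ u v w))
    {i j : ι} (h1 : i ≠ j) (h2 : i ≠ P.reflectionPerm j j) :
    ∃ c : ℂ, ∀ x, curvOp Γ (P.coroot i) (P.coroot j) x =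
      c • rotOp P.CorootForm (P.coroot i) (P.coroot j) x := by
  -- Let D be the commutator of the two coroots. Since s_i negates the first and changes the second
  -- by a multiple of the first, invariance reads s_i D s_i = -D. So D maps the mirror of s_i to the
  -- line of α_i^∨, and skewness recovers D from its value at α_i^∨.
  have main : ∀ i j x, P.CorootForm (P.coroot i) (P.coroot i) • curvOp Γ (P.coroot i) (P.coroot j) x =
      P.CorootForm (P.coroot i) x • curvOp Γ (P.coroot i) (P.coroot j) (P.coroot i) -
      P.CorootForm (curvOp Γ (P.coroot i) (P.coroot j) (P.coroot i)) x • P.coroot i := by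
    intro i j x
    have hD := hinv i (P.coroot i) (P.coroot j) x
    have e : curvOp Γ (P.coreflection i (P.coroot i)) (P.coreflection i (P.coroot j))
        (P.coreflection i x) = -(curvOp Γ (P.coroot i) (P.coroot j) x -
          P.root' i x • curvOp Γ (P.coroot i) (P.coroot j) (P.coroot i)) := by
      rw [← curvOp_smul_right, ← curvOp_sub_right, ← P.coreflection_apply i x,
        P.coreflection_apply_self, P.coreflection_apply_coroot]
      simp only [curvOp, map_neg, map_sub, map_smul, LinearMap.neg_apply, LinearMap.sub_apply,
        LinearMap.smul_apply]
      module
    rw [e, P.coreflection_apply] at hD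
    have e1 := two_mul_corootForm_coroot P i x
    have e2 := two_mul_corootForm_coroot P i (curvOp Γ (P.coroot i) (P.coroot j) x)
    have e3 := hskew (P.coroot i) (P.coroot j) (P.coroot i) x
    have e4 : P.CorootForm (P.coroot i) x = P.root' i x *
      P.CorootForm (P.coroot i) (P.coroot i) / 2 := by rw [← e1]; ring
    have e5 : P.CorootForm (curvOp Γ (P.coroot i) (P.coroot j) (P.coroot i)) x =
      -(P.root' i (curvOp Γ (P.coroot i) (P.coroot j) x) *
        P.CorootForm (P.coroot i) (P.coroot i) / 2) := by rw [e3, ← e2]; ring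
    rw [e4, e5]
    linear_combination (norm := module)
      (-P.CorootForm (P.coroot i) (P.coroot i) / 2) • hD
  have hΔ := corootForm_gram_ne_zero P h1 h2
  have n1 := corootForm_coroot_ne_zero P i
  have m1 := main i j
  have m2 := main j i (P.coroot i)
  have m3 := m1 (P.coroot j)
  have e6 : P.CorootForm (curvOp Γ (P.coroot i) (P.coroot j) (P.coroot j)) (P.coroot i) =
      -P.CorootForm (curvOp Γ (P.coroot i) (P.coroot j) (P.coroot i)) (P.coroot j) := by
    rw [hskew, corootForm_comm]
  simp only [curvOp_swap Γ (P.coroot i) (P.coroot j), map_neg, LinearMap.neg_apply] at m2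
  rw [e6, corootForm_comm P (P.coroot j) (P.coroot i)] at m2
  set e := curvOp Γ (P.coroot i) (P.coroot j) (P.coroot i)
  set e' := curvOp Γ (P.coroot i) (P.coroot j) (P.coroot j)
  set μ := P.CorootForm e (P.coroot j) with hμ
  set β := P.CorootForm (P.coroot i) (P.coroot j)
  set ni := P.CorootForm (P.coroot i) (P.coroot i)
  set nj := P.CorootForm (P.coroot j) (P.coroot j)
  -- The formula for i at α_j^∨ and the formula for j at α_i^∨ are linear equations for the values
  -- `e`, `e'` of D at the two coroots; their determinant is the Gram determinant.
  have he : e = (μ / (ni * nj - β ^ 2)) • (ni • P.coroot j - β • P.coroot i) := by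
    rw [div_eq_inv_mul, mul_smul, eq_inv_smul_iff₀ hΔ]
    linear_combination (norm := module) (-ni) • m2 + β • m3
  refine ⟨-(μ / (ni * nj - β ^ 2)), fun x => ?_⟩
  have m1x := m1 x
  rw [he] at m1x
  have : P.CorootForm ((μ / (ni * nj - β ^ 2)) • (ni • P.coroot j - β • P.coroot i)) x =
    (μ / (ni * nj - β ^ 2)) * (ni * P.CorootForm (P.coroot j) x -
      β * P.CorootForm (P.coroot i) x) := by
    simp only [map_smul, map_sub, LinearMap.smul_apply, LinearMap.sub_apply, smul_eq_mul]
  rw [this] at m1x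
  refine smul_right_injective N n1 ?_
  change ni • _ = ni • _
  rw [m1x, rotOp]
  module

theorem rotOp_coroot_ne_zero {i j : ι} (h1 : i ≠ j) (h2 : i ≠ P.reflectionPerm j j) :
    rotOp P.CorootForm (P.coroot i) (P.coroot j) (P.coroot i) ≠ 0 := by
  intro h
  have := congrArg (P.CorootForm (P.coroot j)) h
  rw [rotOp] at this
  simp only [map_sub, map_smul, smul_eq_mul, map_zero] at this
  refine corootForm_gram_ne_zero P h1 h2 ?_
  rw [corootForm_comm P (P.coroot j) (P.coroot i)] at this
  linear_combination -this

variable (P) in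
/-- On the plane of the coroots `i` and `j`, the tensor `Γ` has curvature `c`. -/
def HasCurv (Γ : N →ₗ[ℂ] N →ₗ[ℂ] N) (c : ℂ) (i j : ι) : Prop :=
  ∀ x, curvOp Γ (P.coroot i) (P.coroot j) x = c • rotOp P.CorootForm (P.coroot i) (P.coroot j) x

omit [P.IsCrystallographic] [P.IsReduced] in
theorem hasCurv_of_coroot_eq {c : ℂ} {i j l : ι} (x y : ℂ)
    (h : P.coroot l = x • P.coroot i + y • P.coroot j) (hij : HasCurv P Γ c i j) :
    HasCurv P Γ c i l := by
  intro z
  rw [h, curvOp_add_mid, curvOp_smul_mid, curvOp_smul_mid, curvOp_self, hij z]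
  simp only [rotOp, map_add, map_smul, LinearMap.add_apply, LinearMap.smul_apply, smul_eq_mul]
  module

omit [P.IsCrystallographic] [P.IsReduced] in
theorem HasCurv.symm {c : ℂ} {i j : ι} (h : HasCurv P Γ c i j) : HasCurv P Γ c j i := by
  intro x
  rw [curvOp_swap, h x, rotOp, rotOp]
  module

omit [P.IsCrystallographic] [P.IsReduced] in
theorem hasCurv_self (c : ℂ) (i : ι) : HasCurv P Γ c i i := by
  intro x
  rw [curvOp_self, rotOp, sub_self, smul_zero]

omit [P.IsCrystallographic] [P.IsReduced] in
theorem hasCurv_neg (c : ℂ) (i : ι) : HasCurv P Γ c i (P.reflectionPerm i i) :=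
  hasCurv_of_coroot_eq (-1) 0 (by simp) (hasCurv_self c i)

theorem HasCurv.unique {c c' : ℂ} {i j : ι} (h : HasCurv P Γ c i j) (h' : HasCurv P Γ c' i j)
    (h1 : i ≠ j) (h2 : i ≠ P.reflectionPerm j j) : c = c' := by
  have e := (h (P.coroot i)).symm.trans (h' (P.coroot i))
  exact smul_left_injective ℂ (rotOp_coroot_ne_zero h1 h2) e

omit [Fintype ι] [P.IsCrystallographic] [P.IsReduced] in
theorem ne_neg_comm {i j : ι} (h : i ≠ P.reflectionPerm j j) : j ≠ P.reflectionPerm i i := by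
  rintro rfl
  exact h (P.indexNeg.neg_neg i).symm

/-! ### Irreducibility makes the curvature constant -/

section Irreducible

variable
    (hskew : ∀ u v x y, P.CorootForm (curvOp Γ u v x) y = -P.CorootForm x (curvOp Γ u v y))
    (hinv : ∀ i u v w, curvOp Γ (P.coreflection i u) (P.coreflection i v) (P.coreflection i w) =
      P.coreflection i (curvOp Γ u v w))
include hskew hinv

/-- The coroots of j, l and s_l α_j are linearly dependent. If c, c', c'' are the curvatures of
their planes with i and p is the pairing of l and j, then (c'' - c) i ∧ j = p (c'' - c') i ∧ l.
Either all three curvatures agree, or the coroot of l lies in the plane of i and j. -/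
theorem HasCurv.of_pairing_ne_zero {c : ℂ} {i j l : ι} (h : HasCurv P Γ c i j)
    (hj1 : i ≠ j) (hj2 : i ≠ P.reflectionPerm j j)
    (hl1 : i ≠ l) (hl2 : i ≠ P.reflectionPerm l l) (hp : P.pairing l j ≠ 0) :
    HasCurv P Γ c i l := by
  obtain ⟨c', hc'⟩ := exists_curvOp_coroot_eq hskew hinv hl1 hl2
  have hm : P.coroot (P.reflectionPerm l j) = P.coroot j - P.pairing l j • P.coroot l := by
    rw [P.coroot_reflectionPerm, P.coreflection_apply_coroot]
  have hspan : ∀ x y z : ℂ, z ≠ 0 → z • P.coroot l = x • P.coroot i + y • P.coroot j →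
      HasCurv P Γ c i l := fun x y z hz e =>
    hasCurv_of_coroot_eq (z⁻¹ * x) (z⁻¹ * y) (by
      rw [mul_smul, mul_smul, ← smul_add, ← e, smul_smul, inv_mul_cancel₀ hz, one_smul]) h
  by_cases hm1 : i = P.reflectionPerm l j
  · rw [← hm1] at hm
    exact hspan (-1) 1 _ hp (by rw [hm]; module)
  by_cases hm2 : i = P.reflectionPerm (P.reflectionPerm l j) (P.reflectionPerm l j)
  · have e : P.coroot i = -P.coroot (P.reflectionPerm l j) := P.coroot_eq_neg_iff.2 hm2
    rw [hm] at e
    exact hspan 1 1 _ hp (by rw [e]; module)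
  obtain ⟨c'', hc''⟩ := exists_curvOp_coroot_eq hskew hinv hm1 hm2
  have key : ∀ x, (c'' - c) • rotOp P.CorootForm (P.coroot i) (P.coroot j) x =
      (P.pairing l j * (c'' - c')) • rotOp P.CorootForm (P.coroot i) (P.coroot l) x := by
    intro x
    have e1 := hc'' x
    have e2 : curvOp Γ (P.coroot i) (P.coroot (P.reflectionPerm l j)) x =
        curvOp Γ (P.coroot i) (P.coroot j) x -
          P.pairing l j • curvOp Γ (P.coroot i) (P.coroot l) x := by
      rw [hm, sub_eq_add_neg, curvOp_add_mid, ← neg_smul, curvOp_smul_mid]; module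
    have e3 : rotOp P.CorootForm (P.coroot i) (P.coroot (P.reflectionPerm l j)) x =
        rotOp P.CorootForm (P.coroot i) (P.coroot j) x -
          P.pairing l j • rotOp P.CorootForm (P.coroot i) (P.coroot l) x := by
      rw [hm]
      simp only [rotOp, map_sub, map_smul, LinearMap.sub_apply, LinearMap.smul_apply, smul_eq_mul]
      module
    rw [e2, e3, h x, hc' x] at e1
    linear_combination (norm := module) -e1
  by_cases hcc : c'' = c'
  · subst hcc
    have e := key (P.coroot i)
    rw [sub_self, mul_zero, zero_smul, smul_eq_zero, sub_eq_zero] at e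
    rcases e with e | e
    · subst e; exact hc'
    · exact absurd e (rotOp_coroot_ne_zero hj1 hj2)
  · have e := key (P.coroot i)
    simp only [rotOp] at e
    have hz : P.pairing l j * (c'' - c') * P.CorootForm (P.coroot i) (P.coroot i) ≠ 0 :=
      mul_ne_zero (mul_ne_zero hp (sub_ne_zero.mpr hcc)) (corootForm_coroot_ne_zero P i)
    refine hspan
      (P.pairing l j * (c'' - c') * P.CorootForm (P.coroot l) (P.coroot i)
        - (c'' - c) * P.CorootForm (P.coroot j) (P.coroot i))
      ((c'' - c) * P.CorootForm (P.coroot i) (P.coroot i)) _ hz ?_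
    linear_combination (norm := module) e

variable [P.IsIrreducible]

/-- A root m that violates the claim is orthogonal, by `HasCurv.of_pairing_ne_zero`, to all roots
whose plane with i has curvature c. The coroots of these span a subspace stable under all
reflections, which is everything by irreducibility; then m would be orthogonal to itself. -/
theorem exists_hasCurv_of_fst (i : ι) : ∃ c : ℂ, ∀ l, HasCurv P Γ c i l := by
  by_cases hex : ∃ j, i ≠ j ∧ i ≠ P.reflectionPerm j j ∧ P.pairing i j ≠ 0
  · obtain ⟨j, hj1, hj2, hj⟩ := hex
    obtain ⟨c, hc⟩ := exists_curvOp_coroot_eq hskew hinv hj1 hj2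
    refine ⟨c, ?_⟩
    by_contra hcon
    push Not at hcon
    obtain ⟨m, hm⟩ := hcon
    have nonprop : ∀ m, ¬HasCurv P Γ c i m → i ≠ m ∧ i ≠ P.reflectionPerm m m := fun m hm =>
      ⟨fun e => hm (e ▸ hasCurv_self c i), fun e => by
        refine ne_neg_comm (P := P) (i := m) (j := i) ?_ e
        rintro rfl
        exact hm (hasCurv_neg c i)⟩
    have orth : ∀ m, ¬HasCurv P Γ c i m → ∀ l, HasCurv P Γ c i l → P.pairing m l = 0 := by
      intro m hm l hl
      obtain ⟨hm1, hm2⟩ := nonprop m hm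
      have orth' : ∀ l, i ≠ l → i ≠ P.reflectionPerm l l → HasCurv P Γ c i l →
          P.pairing m l = 0 := fun l h1 h2 hl => by
        by_contra hp
        exact hm (hl.of_pairing_ne_zero hskew hinv h1 h2 hm1 hm2 hp)
      -- The root i itself is not covered by `orth'`. But m is orthogonal to j and to s_j α_i, and
      -- the coroot of i is a combination of theirs.
      have horth_i : P.pairing m i = 0 := by
        have hq : P.coroot (P.reflectionPerm j i) = P.coroot i - P.pairing j i • P.coroot j := by
          rw [P.coroot_reflectionPerm, P.coreflection_apply_coroot]
        have hji : P.pairing j i ≠ 0 := fun e => hj (P.pairing_eq_zero_iff'.1 e)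
        have hcurv : HasCurv P Γ c i (P.reflectionPerm j i) :=
          hasCurv_of_coroot_eq 1 (-P.pairing j i) (by rw [hq]; module) hc
        have hspan : ∀ x : ℂ, P.pairing j i • P.coroot j ≠ x • P.coroot i := by
          intro x e
          have hr := rotOp_coroot_ne_zero hj1 hj2
          apply hr
          have e' : P.coroot j = ((P.pairing j i)⁻¹ * x) • P.coroot i := by
            rw [mul_smul, ← e, smul_smul, inv_mul_cancel₀ hji, one_smul]
          rw [rotOp, e']
          simp only [map_smul, LinearMap.smul_apply, smul_eq_mul]
          module
        have h1 : i ≠ P.reflectionPerm j i := by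
          intro e
          rw [← e] at hq
          exact hspan 0 (by linear_combination (norm := module) hq)
        have h2 : i ≠ P.reflectionPerm (P.reflectionPerm j i) (P.reflectionPerm j i) := by
          intro e
          have e' : P.coroot i = -P.coroot (P.reflectionPerm j i) := P.coroot_eq_neg_iff.2 e
          rw [hq] at e'
          exact hspan 2 (by linear_combination (norm := module) -e')
        have e := orth' _ h1 h2 hcurv
        have ej := orth' j hj1 hj2 hc
        rw [← P.root'_coroot_eq_pairing, hq, map_sub, map_smul, P.root'_coroot_eq_pairing,
          P.root'_coroot_eq_pairing, ej] at e
        simpa using e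
      by_cases hl1 : i = l
      · exact hl1 ▸ horth_i
      by_cases hl2 : i = P.reflectionPerm l l
      · have e : P.coroot i = -P.coroot l := P.coroot_eq_neg_iff.2 hl2
        rw [← P.root'_coroot_eq_pairing, ← neg_neg (P.coroot l), ← e, map_neg,
          P.root'_coroot_eq_pairing, horth_i, neg_zero]
      · exact orth' l hl1 hl2 hl
    have htop : Submodule.span ℂ (P.coroot '' {l | HasCurv P Γ c i l}) = ⊤ := by
      refine RootPairing.IsIrreducible.eq_top_of_invtSubmodule_coreflection (P := P) _
        (fun q => ?_) ?_
      · rw [Module.End.mem_invtSubmodule, Submodule.span_le]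
        rintro _ ⟨l, hl, rfl⟩
        simp only [Submodule.comap_coe, Set.mem_preimage, LinearEquiv.coe_coe,
          P.coreflection_apply_coroot, SetLike.mem_coe]
        by_cases hq : HasCurv P Γ c i q
        · exact Submodule.sub_mem _ (Submodule.subset_span ⟨l, hl, rfl⟩)
            (Submodule.smul_mem _ _ (Submodule.subset_span ⟨q, hq, rfl⟩))
        · rw [orth q hq l hl, zero_smul, sub_zero]
          exact Submodule.subset_span ⟨l, hl, rfl⟩
      · intro e
        have : P.coroot i ∈ Submodule.span ℂ (P.coroot '' {l | HasCurv P Γ c i l}) :=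
          Submodule.subset_span ⟨i, hasCurv_self c i, rfl⟩
        rw [e, Submodule.mem_bot] at this
        exact P.ne_zero' i this
    have hle : Submodule.span ℂ (P.coroot '' {l | HasCurv P Γ c i l}) ≤ LinearMap.ker (P.root' m) := by
      rw [Submodule.span_le]
      rintro _ ⟨l, hl, rfl⟩
      simp [orth m hm l hl]
    rw [htop] at hle
    have : P.root' m (P.coroot m) = 0 := LinearMap.mem_ker.1 (hle Submodule.mem_top)
    simp at this
  -- Every root is proportional or orthogonal to i. Irreducibility then forces rank one, where the
  -- commutators vanish.
  · push Not at hex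
    refine ⟨0, fun l => ?_⟩
    have htop : Submodule.span ℂ {P.coroot i} = ⊤ := by
      refine RootPairing.IsIrreducible.eq_top_of_invtSubmodule_coreflection (P := P) _
        (fun q => ?_) (by simp [P.ne_zero'])
      rw [Module.End.mem_invtSubmodule, Submodule.span_le, Set.singleton_subset_iff]
      simp only [Submodule.comap_coe, Set.mem_preimage, LinearEquiv.coe_coe,
        P.coreflection_apply_coroot, SetLike.mem_coe, Submodule.mem_span_singleton]
      by_cases h1 : i = q
      · exact ⟨-1, by subst h1; simp; module⟩
      by_cases h2 : i = P.reflectionPerm q q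
      · have e : P.coroot i = -P.coroot q := P.coroot_eq_neg_iff.2 h2
        exact ⟨1 + P.pairing q i, by rw [e]; module⟩
      · exact ⟨1, by rw [P.pairing_eq_zero_iff'.1 (hex q h1 h2)]; simp⟩
    have hl : P.coroot l ∈ Submodule.span ℂ {P.coroot i} := htop ▸ Submodule.mem_top
    obtain ⟨x, hx⟩ := Submodule.mem_span_singleton.1 hl
    exact hasCurv_of_coroot_eq x 0 (by rw [← hx]; module) (hasCurv_self 0 i)

/-- A skew tensor with Weyl group invariant curvature has constant sectional curvature. -/
theorem exists_curvOp_eq_smul_rotOp [P.IsRootSystem] :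
    ∃ c : ℂ, ∀ u v w, curvOp Γ u v w = c • rotOp P.CorootForm u v w := by
  obtain ⟨c, hc⟩ : ∃ c : ℂ, ∀ i l, HasCurv P Γ c i l := by
    by_cases hι : Nonempty ι
    · obtain ⟨i⟩ := hι
      obtain ⟨c, hc⟩ := exists_hasCurv_of_fst hskew hinv i
      refine ⟨c, fun j l => ?_⟩
      obtain ⟨c', hc'⟩ := exists_hasCurv_of_fst hskew hinv j
      by_cases h1 : i = j
      · subst h1; exact hc l
      by_cases h2 : i = P.reflectionPerm j j
      · have e : P.coroot i = -P.coroot j := P.coroot_eq_neg_iff.2 h2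
        exact (hasCurv_of_coroot_eq 0 (-1) (by rw [e]; module) (hc l).symm).symm
      -- The constants of i and j are compared on the plane of the two coroots.
      · rw [(hc j).unique (hc' i).symm h1 h2]; exact hc' l
    · exact ⟨0, fun i => (hι ⟨i⟩).elim⟩
  refine ⟨c, fun u v w => ?_⟩
  have step : ∀ (u : N), (∀ l, curvOp Γ u (P.coroot l) w = c • rotOp P.CorootForm u (P.coroot l) w) →
      ∀ v, curvOp Γ u v w = c • rotOp P.CorootForm u v w := by
    intro u hu v
    have hv : v ∈ Submodule.span ℂ (Set.range P.coroot) := by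
      rw [RootPairing.IsRootSystem.span_coroot_eq_top]; exact Submodule.mem_top
    induction hv using Submodule.span_induction with
    | mem x hx => obtain ⟨l, rfl⟩ := hx; exact hu l
    | zero => simp [curvOp, rotOp]
    | add x y _ _ hx hy =>
      rw [curvOp_add_mid, hx, hy]
      simp only [rotOp, map_add, LinearMap.add_apply]
      module
    | smul a x _ hx =>
      rw [curvOp_smul_mid, hx]
      simp only [rotOp, map_smul, LinearMap.smul_apply, smul_eq_mul]
      module
  refine step u (fun l => ?_) v
  have := step (P.coroot l) (fun m => hc l m w) u
  rw [curvOp_swap, this, rotOp, rotOp]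
  module

end Irreducible

end RootForms


/-! ### Equivariant symmetric products -/

section EquivariantProduct

variable {ι M N : Type*} [AddCommGroup M] [Module ℂ M] [NormedAddCommGroup N]
  [NormedSpace ℂ N] {P : RootPairing ι ℂ M N} {b : N →ₗ[ℂ] N →ₗ[ℂ] N}

theorem root'_eq_zero_of_coreflection_eq {i : ι} {u : N} (h : P.coreflection i u = u) :
    P.root' i u = 0 := by
  rw [P.coreflection_apply, sub_eq_self, smul_eq_zero] at h
  exact h.resolve_right (P.ne_zero' i)

section

variable (hbr : ∀ i u v, b (P.coreflection i u) (P.coreflection i v) = P.coreflection i (b u v))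
include hbr

/-- On the mirror α_i(u) = 0, equivariance says that b(u, ·) commutes with s_i, hence with π_i = 1 -
s_i. -/
theorem root'_smul_coroot_of_root'_eq_zero {i : ι} {u : N} (hu : P.root' i u = 0) (w : N) :
    P.root' i (b u w) • P.coroot i = P.root' i w • b u (P.coroot i) := by
  have h := hbr i u w
  rw [P.coreflection_apply i u, hu, zero_smul, sub_zero, P.coreflection_apply,
    P.coreflection_apply, map_sub, map_smul, sub_right_inj] at h
  exact h.symm

/-- The vector α_i(u) v - α_i(v) u lies on the mirror, so `root'_smul_coroot_of_root'_eq_zero`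
applies to it. This kills the terms of [Γ_u, Γ_v] that are linear in k. -/
theorem cross_commutator_eq_zero (i : ι) (u v w : N) :
    P.root' i u • (P.root' i (b v w) • P.coroot i - P.root' i w • b v (P.coroot i)) =
      P.root' i v • (P.root' i (b u w) • P.coroot i - P.root' i w • b u (P.coroot i)) := by
  have h := root'_smul_coroot_of_root'_eq_zero hbr (i := i)
    (u := P.root' i u • v - P.root' i v • u) (by simp [mul_comm]) w
  simp only [map_sub, map_smul, LinearMap.sub_apply, LinearMap.smul_apply, smul_eq_mul] at h
  linear_combination (norm := module) h

theorem root'_coroot_mul_coroot (i : ι) : P.root' i (b (P.coroot i) (P.coroot i)) = 0 := by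
  apply root'_eq_zero_of_coreflection_eq
  rw [← hbr, P.coreflection_apply_self]
  simp

/-- The vector 2u - α_i(u) α_i^∨ is on the mirror, so its product with α_i^∨ is a multiple of α_i^∨.
-/
theorem two_smul_mul_coroot (i : ι) (u : N) :
    (2 : ℂ) • b u (P.coroot i) = P.root' i (b u (P.coroot i)) • P.coroot i +
      P.root' i u • b (P.coroot i) (P.coroot i) := by
  have h := root'_smul_coroot_of_root'_eq_zero hbr (i := i)
    (u := (2 : ℂ) • u - P.root' i u • P.coroot i)
    (by rw [map_sub, map_smul, map_smul, P.root'_coroot_eq_pairing, P.pairing_same,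
      smul_eq_mul, smul_eq_mul]; ring) (P.coroot i)
  simp only [map_sub, map_smul, LinearMap.sub_apply, LinearMap.smul_apply, smul_eq_mul,
    root'_coroot_mul_coroot hbr, P.root'_coroot_eq_pairing, P.pairing_same] at h
  linear_combination (norm := module) (-1 / 2 : ℂ) • h

end

variable [Fintype ι] [P.IsCrystallographic] [P.IsReduced]

variable (P b) in
/-- The trilinear form of `b` has the same values at `(i, u; i)` and `(i, i; u)`. -/
def IsCoherentAt (i : ι) (u : N) : Prop :=
  P.CorootForm (P.coroot i) (b u (P.coroot i)) = P.CorootForm (b (P.coroot i) (P.coroot i)) u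

omit [P.IsCrystallographic] [P.IsReduced] in
theorem IsCoherentAt.lin {i : ι} {u v : N} (x y : ℂ) (hu : IsCoherentAt P b i u)
    (hv : IsCoherentAt P b i v) : IsCoherentAt P b i (x • u + y • v) := by
  unfold IsCoherentAt at *
  simp only [map_add, map_smul, LinearMap.add_apply, LinearMap.smul_apply, smul_eq_mul, hu, hv]

omit [P.IsCrystallographic] [P.IsReduced] in
theorem isCoherentAt_self (i : ι) : IsCoherentAt P b i (P.coroot i) := corootForm_comm P _ _

variable (hb : ∀ u v : N, b u v = b v u)
  (hbr : ∀ i u v, b (P.coreflection i u) (P.coreflection i v) = P.coreflection i (b u v))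
include hb hbr

omit [P.IsCrystallographic] [P.IsReduced] in
-- Both sides vanish: α_i(b(α_l^∨, α_i^∨)) = 0 by `two_smul_mul_coroot` for l, and b(α_i^∨, α_i^∨)
-- is fixed by s_l.
theorem isCoherentAt_of_orthogonal {i l : ι} (h : P.pairing i l = 0) :
    IsCoherentAt P b i (P.coroot l) := by
  have h' : P.pairing l i = 0 := P.pairing_eq_zero_iff'.1 h
  have e1 : P.root' i (b (P.coroot l) (P.coroot i)) = 0 := by
    have := congrArg (P.root' i) (two_smul_mul_coroot hbr l (P.coroot i))
    rw [map_smul, map_add, map_smul, map_smul, P.root'_coroot_eq_pairing,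
      P.root'_coroot_eq_pairing, h, h', hb] at this
    simpa using this
  have e2 : P.root' l (b (P.coroot i) (P.coroot i)) = 0 := by
    apply root'_eq_zero_of_coreflection_eq
    rw [← hbr, P.coreflection_apply_coroot, h', zero_smul, sub_zero]
  have f1 := two_mul_corootForm_coroot P i (b (P.coroot l) (P.coroot i))
  have f2 := two_mul_corootForm_coroot P l (b (P.coroot i) (P.coroot i))
  rw [e1, zero_mul, mul_eq_zero] at f1
  rw [e2, zero_mul, mul_eq_zero] at f2
  unfold IsCoherentAt
  rw [f1.resolve_left two_ne_zero, corootForm_comm, f2.resolve_left two_ne_zero]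

omit [P.IsCrystallographic] [P.IsReduced] in
-- The two roots generate an A₂, which has no orthogonal pair to reduce to. Equivariance under s_i
-- and under s_j gives two linear equations, and s_i s_j, which carries α_i^∨ to -ε α_j^∨, relates
-- b(α_i^∨, α_i^∨) to b(α_j^∨, α_j^∨).
theorem isCoherentAt_of_sq_eq_one {i j : ι} {ε : ℂ} (hε : ε * ε = 1) (h1 : P.pairing i j = ε)
    (h2 : P.pairing j i = ε) : IsCoherentAt P b i (P.coroot j) := by
  have hε0 : ε ≠ 0 := by rintro rfl; simp at hε
  have key : ∀ i j, P.pairing i j = ε → P.pairing j i = ε →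
      2 * P.root' j (b (P.coroot i) (P.coroot j)) - ε * P.root' i (b (P.coroot i) (P.coroot j)) =
        ε * P.root' j (b (P.coroot i) (P.coroot i)) := by
    intro i j h1 h2
    have e := hbr i (P.coroot i) (P.coroot j)
    rw [P.coreflection_apply_self, P.coreflection_apply_coroot, P.coreflection_apply, h1] at e
    have := congrArg (P.root' j) e
    simp only [map_sub, map_neg, map_smul, LinearMap.neg_apply, smul_eq_mul,
      P.root'_coroot_eq_pairing, h2] at this
    linear_combination -this
  have k1 := key i j h1 h2
  have k2 := key j i h2 h1
  rw [hb (P.coroot j)] at k2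
  have k3 : P.root' i (b (P.coroot j) (P.coroot j)) = ε * P.root' j (b (P.coroot i) (P.coroot i)) := by
    have e1 : P.coreflection i (P.coreflection j (P.coroot i)) = -(ε • P.coroot j) := by
      rw [P.coreflection_apply_coroot, h2, map_sub, map_smul, P.coreflection_apply_self,
        P.coreflection_apply_coroot, h1]
      linear_combination (norm := module) hε • P.coroot i
    have e2 : b (P.coreflection i (P.coreflection j (P.coroot i)))
        (P.coreflection i (P.coreflection j (P.coroot i))) =
        P.coreflection i (P.coreflection j (b (P.coroot i) (P.coroot i))) := by rw [hbr, hbr]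
    rw [e1] at e2
    simp only [map_neg, map_smul, LinearMap.neg_apply, LinearMap.smul_apply, smul_neg, neg_neg, smul_smul,
      hε, one_smul] at e2
    rw [e2, P.coreflection_apply, P.coreflection_apply]
    simp only [map_sub, map_smul, smul_eq_mul, P.root'_coroot_eq_pairing, h1, P.pairing_same,
      root'_coroot_mul_coroot hbr]
    ring
  rw [k3] at k2
  have k4 : P.root' i (b (P.coroot i) (P.coroot j)) = P.root' j (b (P.coroot i) (P.coroot i)) := by
    linear_combination (2 / 3 : ℂ) * k2 + ε / 3 * k1 +
      (1 / 3 * P.root' i (b (P.coroot i) (P.coroot j)) +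
        P.root' j (b (P.coroot i) (P.coroot i))) * hε
  have f1 := two_mul_corootForm_coroot P i (b (P.coroot j) (P.coroot i))
  have f2 := two_mul_corootForm_coroot P j (b (P.coroot i) (P.coroot i))
  have n1 := two_mul_corootForm_coroot P i (P.coroot j)
  have n2 := two_mul_corootForm_coroot P j (P.coroot i)
  rw [P.root'_coroot_eq_pairing, h1] at n1
  rw [P.root'_coroot_eq_pairing, h2, corootForm_comm] at n2
  have n3 := mul_left_cancel₀ hε0 (n1.symm.trans n2)
  rw [hb, k4] at f1
  unfold IsCoherentAt
  rw [hb (P.coroot j), corootForm_comm P (b _ _) (P.coroot j)]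
  rw [n3] at f1
  exact mul_left_cancel₀ two_ne_zero (f1.trans f2.symm)

theorem isCoherentAt_coroot (i j : ι) : IsCoherentAt P b i (P.coroot j) := by
  -- If the product of the pairings is 2, the root s_j α_i is orthogonal to α_i; if it is 3, the
  -- root s_j s_i α_j is. In both cases the coroot of j is a combination of that coroot and the
  -- coroot of i, and coherence is linear.
  have hW2 : P.pairing i j * P.pairing j i = 2 → IsCoherentAt P b i (P.coroot j) := by
    intro h
    have hji : P.pairing j i ≠ 0 := by intro e; simp [e] at h
    have hc : P.coroot (P.reflectionPerm j i) = P.coroot i - P.pairing j i • P.coroot j := by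
      rw [P.coroot_reflectionPerm, P.coreflection_apply_coroot]
    have ho : P.pairing i (P.reflectionPerm j i) = 0 := by
      rw [← P.root'_coroot_eq_pairing, hc, map_sub, map_smul, P.root'_coroot_eq_pairing,
        P.root'_coroot_eq_pairing, P.pairing_same, smul_eq_mul]
      linear_combination -h
    have e : P.coroot j = (P.pairing j i)⁻¹ • P.coroot i +
        (-(P.pairing j i)⁻¹) • P.coroot (P.reflectionPerm j i) := by
      rw [hc]
      linear_combination (norm := module) (-inv_mul_cancel₀ hji) • P.coroot j
    rw [e]
    exact (isCoherentAt_self i).lin _ _ (isCoherentAt_of_orthogonal hb hbr ho)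
  have hW3 : P.pairing i j * P.pairing j i = 3 → IsCoherentAt P b i (P.coroot j) := by
    intro h
    have hc : P.coroot (P.reflectionPerm j (P.reflectionPerm i j)) =
        (2 : ℂ) • P.coroot j - P.pairing i j • P.coroot i := by
      rw [P.coroot_reflectionPerm, P.coroot_reflectionPerm, P.coreflection_apply_coroot, map_sub,
        map_smul, P.coreflection_apply_self, P.coreflection_apply_coroot]
      linear_combination (norm := module) h • P.coroot j
    have ho : P.pairing i (P.reflectionPerm j (P.reflectionPerm i j)) = 0 := by
      rw [← P.root'_coroot_eq_pairing, hc, map_sub, map_smul, map_smul,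
        P.root'_coroot_eq_pairing, P.root'_coroot_eq_pairing, P.pairing_same, smul_eq_mul,
        smul_eq_mul]
      ring
    have e : P.coroot j = (P.pairing i j / 2) • P.coroot i +
        (1 / 2 : ℂ) • P.coroot (P.reflectionPerm j (P.reflectionPerm i j)) := by
      rw [hc]; module
    rw [e]
    exact (isCoherentAt_self i).lin _ _ (isCoherentAt_of_orthogonal hb hbr ho)
  by_cases h1 : i = j
  · subst h1; exact isCoherentAt_self i
  by_cases h2 : i = P.reflectionPerm j j
  · have e : P.coroot i = -P.coroot j := P.coroot_eq_neg_iff.2 h2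
    have e' : P.coroot j = (-1 : ℂ) • P.coroot i + (0 : ℂ) • P.coroot i := by rw [e]; module
    rw [e']
    exact (isCoherentAt_self i).lin _ _ (isCoherentAt_self i)
  have h := P.pairingIn_pairingIn_mem_set_of_isCrystal_of_isRed' i j
    (fun e => h1 (P.root.injective e)) (fun e => h2 (P.root_eq_neg_iff.1 e))
  have p1 := P.algebraMap_pairingIn ℤ i j
  have p2 := P.algebraMap_pairingIn ℤ j i
  simp only [Set.mem_insert_iff, Set.mem_singleton_iff, Prod.mk.injEq] at h
  rcases h with h | h | h | h | h | h | h | h | h | h | h <;> rw [h.1] at p1 <;> rw [h.2] at p2 <;>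
    simp only [algebraMap_int_eq, eq_intCast] at p1 p2
  · exact isCoherentAt_of_orthogonal hb hbr (by rw [← p1]; simp)
  · exact isCoherentAt_of_sq_eq_one hb hbr (ε := 1) (by norm_num) (by rw [← p1]; simp)
      (by rw [← p2]; simp)
  · exact isCoherentAt_of_sq_eq_one hb hbr (ε := -1) (by norm_num) (by rw [← p1]; simp)
      (by rw [← p2]; simp)
  all_goals first
    | (refine hW2 ?_; rw [← p1, ← p2]; norm_num; done)
    | (refine hW3 ?_; rw [← p1, ← p2]; norm_num)

/-- A Weyl group equivariant symmetric product is self-adjoint for the invariant form. -/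
theorem corootForm_mul_comm [P.IsRootSystem] (u v w : N) :
    P.CorootForm (b u v) w = P.CorootForm v (b u w) := by
  have hspan : ∀ v : N, v ∈ Submodule.span ℂ (Set.range P.coroot) := fun v => by
    rw [RootPairing.IsRootSystem.span_coroot_eq_top]; exact Submodule.mem_top
  have coh : ∀ i u, IsCoherentAt P b i u := by
    intro i u
    induction hspan u using Submodule.span_induction with
    | mem x hx => obtain ⟨j, rfl⟩ := hx; exact isCoherentAt_coroot hb hbr i j
    | zero => simp [IsCoherentAt]
    | add x y _ _ hx hy => simpa using hx.lin 1 1 hy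
    | smul a x _ hx => simpa using hx.lin a 0 hx
  -- By coherence, `two_smul_mul_coroot` becomes a formula for B(b(u, α_i^∨), w) that is symmetric
  -- in u and w. As the coroots span, B(b(u, v), w) is totally symmetric.
  have key : ∀ u v w, P.CorootForm (b u v) w = P.CorootForm (b w v) u := by
    intro u v w
    induction hspan v using Submodule.span_induction with
    | mem x hx =>
      obtain ⟨i, rfl⟩ := hx
      have expand : ∀ u w, P.CorootForm (P.coroot i) (P.coroot i) * P.CorootForm (b u (P.coroot i)) w =
          P.CorootForm (b (P.coroot i) (P.coroot i)) u * P.CorootForm (P.coroot i) w +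
          P.CorootForm (b (P.coroot i) (P.coroot i)) w * P.CorootForm (P.coroot i) u := by
        intro u w
        have e1 := congrArg (fun z => P.CorootForm z w) (two_smul_mul_coroot hbr i u)
        simp only [map_add, map_smul, LinearMap.add_apply, LinearMap.smul_apply,
          smul_eq_mul] at e1
        have e2 := two_mul_corootForm_coroot P i u
        have e3 := two_mul_corootForm_coroot P i (b u (P.coroot i))
        have e4 := coh i u
        unfold IsCoherentAt at e4
        rw [e4] at e3
        linear_combination (1 / 2 : ℂ) * P.CorootForm (P.coroot i) (P.coroot i) * e1 -
          1 / 2 * P.CorootForm (b (P.coroot i) (P.coroot i)) w * e2 -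
          1 / 2 * P.CorootForm (P.coroot i) w * e3
      refine mul_left_cancel₀ (corootForm_coroot_ne_zero P i) ?_
      rw [expand, expand]
      ring
    | zero => simp
    | add x y _ _ hx hy => simp only [map_add, LinearMap.add_apply, hx, hy]
    | smul a x _ hx => simp only [map_smul, LinearMap.smul_apply, hx]
  rw [hb, key, hb, corootForm_comm]

end EquivariantProduct

/-! ### Weyl group equivariance -/

section Weyl

variable {ι M N : Type*} [AddCommGroup M] [Module ℂ M] [NormedAddCommGroup N]
  [NormedSpace ℂ N] (P : RootPairing ι ℂ M N) (w : P.weylGroup)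

theorem toLinearMap_weylCartan (x : M) (u : N) :
    P.toLinearMap x (weylCartan P w u) = P.toLinearMap (w⁻¹ • x) u := by
  have h := RootPairing.Hom.weight_coweight_transpose_apply P P (weylCartan P w u)
    (w : P.Aut).toHom
  have h' := congrArg (fun f => f (w⁻¹ • x)) h
  have e : (w : P.Aut).toHom.coweightMap (weylCartan P w u) = u :=
    RootPairing.Equiv.coweightMap_coweightEquiv_symm P P _ _
  have e2 : (w : P.Aut).toHom.weightMap (w⁻¹ • x) = x := smul_inv_smul w x
  rw [e] at h'
  change P.toLinearMap ((w : P.Aut).toHom.weightMap (w⁻¹ • x)) (weylCartan P w u) = _ at h'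
  rw [e2] at h'
  exact h'

theorem root'_weylCartan (i : ι) (u : N) :
    P.root' i (weylCartan P w u) = P.root' (P.weylGroupToPerm w⁻¹ i) u := by
  rw [RootPairing.root', RootPairing.root', ← P.weylGroup_apply_root, toLinearMap_weylCartan]

theorem weylCartan_coroot (i : ι) :
    weylCartan P w (P.coroot i) = P.coroot (P.weylGroupToPerm w i) := by
  have h := RootPairing.Hom.coroot_coweightMap_apply P P (P.weylGroupToPerm w i) (w : P.Aut).toHom
  have e : (w : P.Aut).toHom.indexEquiv.symm (P.weylGroupToPerm w i) = i :=
    Equiv.symm_apply_apply _ _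
  rw [e] at h
  exact (LinearEquiv.symm_apply_eq _).2 h.symm

theorem weylCartan_ofIdx (i : ι) (u : N) :
    weylCartan P (RootPairing.weylGroup.ofIdx P i) u = P.coreflection i u := by
  refine (LinearEquiv.symm_apply_eq _).2 ?_
  exact (P.coreflection_same i u).symm

theorem char_weylTorus (h : AdjointTorus P) (i : ι) :
    (weylTorus P w h).char (P.rootSpanMem ℤ i) =
      h.char (P.rootSpanMem ℤ (P.weylGroupToPerm w⁻¹ i)) := by
  have e : (⟨w⁻¹ • P.root i, weyl_smul_mem_rootSpan P w⁻¹ (P.rootSpanMem ℤ i).2⟩ : P.rootSpan ℤ) =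
      P.rootSpanMem ℤ (P.weylGroupToPerm w⁻¹ i) := Subtype.ext (P.weylGroup_apply_root _ _)
  rw [← e]
  rfl

theorem weylTorus_mem_mirrorComplement {h : AdjointTorus P} (hh : h ∈ mirrorComplement P) :
    weylTorus P w h ∈ mirrorComplement P := fun i => by
  rw [char_weylTorus]; exact hh _

theorem weylGroupToPerm_ofIdx (i j : ι) :
    P.weylGroupToPerm (RootPairing.weylGroup.ofIdx P i) j = P.reflectionPerm i j := by
  have : (RootPairing.Equiv.reflection P i).toHom.indexEquiv = P.reflectionPerm i :=
    RootPairing.Equiv.reflection_indexEquiv P i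
  exact congrArg (fun e : ι ≃ ι => e j) this

variable [Fintype ι]

theorem corootForm_weylCartan (u v : N) :
    P.CorootForm (weylCartan P w u) (weylCartan P w v) = P.CorootForm u v := by
  simp only [RootPairing.corootForm_apply_apply, root'_weylCartan]
  exact Equiv.sum_comp (P.weylGroupToPerm w⁻¹) fun i => P.root' i u * P.root' i v

theorem specialForm_apply (k : ι → ℂ) (b : N →ₗ[ℂ] N →ₗ[ℂ] N) (h : AdjointTorus P) (u v : N) :
    specialForm P k b h u v = (1 / 4 : ℂ) • ∑ i, (k i * charCoth h (P.rootSpanMem ℤ i) *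
      P.root' i u * P.root' i v) • P.coroot i + b u v := by
  simp only [specialForm, charCoth, LinearMap.add_apply, LinearMap.smul_apply,
    LinearMap.sum_apply, LinearMap.smulRight_apply, smul_smul, mul_assoc, mul_div_assoc]

theorem specialForm_weylTorus {k : ι → ℂ}
    (hk : ∀ (w : P.weylGroup) (i : ι), k (P.weylGroupToPerm w i) = k i) {b : N →ₗ[ℂ] N →ₗ[ℂ] N}
    (hbW : ∀ (w : P.weylGroup) (u v : N),
      b (weylCartan P w u) (weylCartan P w v) = weylCartan P w (b u v))
    (h : AdjointTorus P) (u v : N) :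
    specialForm P k b (weylTorus P w h) (weylCartan P w u) (weylCartan P w v) =
      weylCartan P w (specialForm P k b h u v) := by
  rw [specialForm_apply, specialForm_apply, hbW, map_add, map_smul, map_sum]
  congr 2
  refine Fintype.sum_equiv (P.weylGroupToPerm w⁻¹) _ _ fun i => ?_
  rw [map_smul, weylCartan_coroot, root'_weylCartan, root'_weylCartan]
  have e : P.weylGroupToPerm w (P.weylGroupToPerm w⁻¹ i) = i := by
    rw [← Equiv.Perm.mul_apply, ← map_mul, mul_inv_cancel, map_one, Equiv.Perm.one_apply]
  rw [e, hk]
  unfold charCoth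
  rw [char_weylTorus]

end Weyl

/-! ### The invariant form of the flat connection -/

section InvariantForm

variable {ι M N : Type*} [Fintype ι] [AddCommGroup M] [Module ℂ M] [NormedAddCommGroup N]
  [NormedSpace ℂ N] {P : RootPairing ι ℂ M N} {k : ι → ℂ} {b : N →ₗ[ℂ] N →ₗ[ℂ] N}

theorem specialForm_comm (hb : ∀ u v : N, b u v = b v u) (h : AdjointTorus P) (u v : N) :
    specialForm P k b h u v = specialForm P k b h v u := by
  simp only [specialForm_apply, hb u v, mul_assoc, mul_comm (P.root' _ u)]

/-- The terms linear in k drop out by `cross_commutator_eq_zero`. The quadratic ones carry (1/4)²,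
and a further 1/2 comes from symmetrising the sum over ordered pairs of roots. -/
theorem curvOp_specialForm
    (hbr : ∀ i u v, b (P.coreflection i u) (P.coreflection i v) = P.coreflection i (b u v))
    (h : AdjointTorus P) (u v w : N) :
    curvOp (specialForm P k b h) u v w = (1 / 32 : ℂ) • ∑ i, ∑ j,
      (k i * k j * charCoth h (P.rootSpanMem ℤ i) * charCoth h (P.rootSpanMem ℤ j)) •
        wedgeComm P u v w i j + curvOp b u v w := by
  set q : ι → ℂ := fun i => k i * charCoth h (P.rootSpanMem ℤ i) with hq
  have hS : ∀ u v, specialForm P k b h u v =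
      (1 / 4 : ℂ) • ∑ i, (q i * P.root' i u * P.root' i v) • P.coroot i + b u v :=
    fun u v => specialForm_apply P k b h u v
  set t : N → N → ι → ι → N := fun u v i j =>
    (q i * q j * P.root' i u * P.root' j v * (P.root' j w * P.pairing i j)) • P.coroot i with ht
  have hroot : ∀ i v, P.root' i (specialForm P k b h v w) =
      1 / 4 * ∑ j, q j * P.root' j v * P.root' j w * P.pairing i j + P.root' i (b v w) := by
    intro i v
    rw [hS, map_add, map_smul, map_sum, smul_eq_mul]
    simp only [map_smul, smul_eq_mul, P.root'_coroot_eq_pairing]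
  have hcomp : ∀ u v, specialForm P k b h u (specialForm P k b h v w) =
      (1 / 16 : ℂ) • ∑ i, ∑ j, t u v i j +
      (1 / 4 : ℂ) • ∑ i, (q i • (P.root' i u • P.root' i (b v w) • P.coroot i +
        P.root' i v • P.root' i w • b u (P.coroot i))) + b u (b v w) := by
    intro u v
    rw [hS u]
    nth_rw 2 [hS v w]
    rw [map_add, map_smul, map_sum]
    simp only [map_smul, hroot]
    rw [← add_assoc]
    congr 1
    have e1 : ∀ i, (q i * P.root' i u * (1 / 4 * ∑ j, q j * P.root' j v * P.root' j w * P.pairing i j +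
        P.root' i (b v w))) • P.coroot i =
        (1 / 4 : ℂ) • ∑ j, t u v i j + q i • P.root' i u • P.root' i (b v w) • P.coroot i := by
      intro i
      have : ∑ j, t u v i j =
          (q i * P.root' i u * ∑ j, q j * P.root' j v * P.root' j w * P.pairing i j) •
            P.coroot i := by
        rw [Finset.mul_sum, Finset.sum_smul]
        refine Finset.sum_congr rfl fun j _ => ?_
        simp only [ht]
        congr 1
        ring
      rw [this]
      module
    simp only [e1, smul_add, Finset.sum_add_distrib, ← Finset.smul_sum, smul_smul]
    rw [show (1 / 4 * (1 / 4) : ℂ) = 1 / 16 by norm_num, add_assoc]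
    simp only [mul_assoc]
  have hcross : ∑ i, (q i • (P.root' i u • P.root' i (b v w) • P.coroot i +
        P.root' i v • P.root' i w • b u (P.coroot i))) =
      ∑ i, (q i • (P.root' i v • P.root' i (b u w) • P.coroot i +
        P.root' i u • P.root' i w • b v (P.coroot i))) := by
    refine Finset.sum_congr rfl fun i _ => ?_
    congr 1
    linear_combination (norm := module) cross_commutator_eq_zero hbr i u v w
  have hquad : ∑ i, ∑ j, (k i * k j * charCoth h (P.rootSpanMem ℤ i) *
      charCoth h (P.rootSpanMem ℤ j)) • wedgeComm P u v w i j =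
      (2 : ℂ) • (∑ i, ∑ j, t u v i j - ∑ i, ∑ j, t v u i j) := by
    have e : ∀ i j, (k i * k j * charCoth h (P.rootSpanMem ℤ i) *
      charCoth h (P.rootSpanMem ℤ j)) • wedgeComm P u v w i j =
      (t u v i j - t v u i j) + (t u v j i - t v u j i) := by
      intro i j
      simp only [ht, hq, wedgeComm]
      module
    simp only [e, Finset.sum_add_distrib]
    rw [Finset.sum_comm (f := fun i j => t u v j i - t v u j i), two_smul]
    simp only [Finset.sum_sub_distrib]
  rw [hquad, curvOp, hcomp, hcomp, hcross, curvOp]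
  module

variable [P.IsRootSystem] [P.IsCrystallographic] [P.IsReduced] [P.IsIrreducible]

omit [P.IsIrreducible] in
-- Each π_i is self-adjoint because B(α_i^∨, ·) is proportional to α_i; the product b is so by
-- `corootForm_mul_comm`.
theorem corootForm_specialForm (hb : ∀ u v : N, b u v = b v u)
    (hbr : ∀ i u v, b (P.coreflection i u) (P.coreflection i v) = P.coreflection i (b u v))
    (h : AdjointTorus P) (u v w : N) :
    P.CorootForm (specialForm P k b h u v) w = P.CorootForm v (specialForm P k b h u w) := by
  simp only [specialForm_apply, map_add, map_smul, map_sum, LinearMap.add_apply,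
    LinearMap.smul_apply, LinearMap.sum_apply, corootForm_mul_comm hb hbr u v w]
  congr 2
  refine Finset.sum_congr rfl fun i _ => ?_
  have e1 := two_mul_corootForm_coroot P i w
  have e2 := two_mul_corootForm_coroot P i v
  rw [corootForm_comm P v, smul_eq_mul, smul_eq_mul]
  linear_combination k i * charCoth h (P.rootSpanMem ℤ i) * P.root' i u *
    (P.root' i v * e1 - P.root' i w * e2) / 2

theorem exists_invariant_form
    (hk : ∀ (w : P.weylGroup) (i : ι), k (P.weylGroupToPerm w i) = k i)
    (hb : ∀ u v : N, b u v = b v u)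
    (hbW : ∀ (w : P.weylGroup) (u v : N),
      b (weylCartan P w u) (weylCartan P w v) = weylCartan P w (b u v)) :
    ∃ a : LinearMap.BilinForm ℂ N, (∀ u v : N, a u v = a v u) ∧
      (∀ (w : P.weylGroup) (u v : N), a (weylCartan P w u) (weylCartan P w v) = a u v) ∧
      ∀ h ∈ mirrorComplement P, ∀ u v w : N,
        curvOp (specialForm P k b h) u v w = rotOp a u v w ∧
        a u (specialForm P k b h v w) = a v (specialForm P k b h u w) := by
  have hbr : ∀ i u v, b (P.coreflection i u) (P.coreflection i v) = P.coreflection i (b u v) :=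
    fun i u v => by simpa only [weylCartan_ofIdx] using hbW (RootPairing.weylGroup.ofIdx P i) u v
  have hkr : ∀ i j, k (P.reflectionPerm i j) = k j := fun i j => by
    rw [← weylGroupToPerm_ofIdx, hk]
  have hconst : ∀ h ∈ mirrorComplement P, ∀ h' ∈ mirrorComplement P, ∀ u v w,
      curvOp (specialForm P k b h) u v w = curvOp (specialForm P k b h') u v w := by
    intro h hh h' hh' u v w
    obtain ⟨T, hT⟩ := exists_sum_charCoth_eq k hkr u v w
    rw [curvOp_specialForm hbr, curvOp_specialForm hbr, hT h hh, hT h' hh']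
  by_cases hne : (mirrorComplement P).Nonempty
  · obtain ⟨h₀, hh₀⟩ := hne
    obtain ⟨c, hc⟩ := exists_curvOp_eq_smul_rotOp (P := P) (Γ := specialForm P k b h₀)
      (fun u v x y => by
        simp only [curvOp, map_sub, LinearMap.sub_apply, corootForm_specialForm hb hbr]
        ring)
      (fun i u v w => by
        -- Equivariance carries the commutator at h₀ to the one at s_i h₀, and by `hconst` these are
        -- the same tensor.
        have hmem := weylTorus_mem_mirrorComplement P (RootPairing.weylGroup.ofIdx P i) hh₀
        rw [hconst h₀ hh₀ _ hmem]
        simp only [← weylCartan_ofIdx, curvOp, specialForm_weylTorus P _ hk hbW, map_sub])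
    refine ⟨c • P.CorootForm, fun u v => ?_, fun w u v => ?_, fun h hh u v w => ⟨?_, ?_⟩⟩
    · simp only [LinearMap.smul_apply, corootForm_comm P u v]
    · simp only [LinearMap.smul_apply, corootForm_weylCartan]
    · rw [hconst h hh h₀ hh₀, hc]
      simp only [rotOp, LinearMap.smul_apply, smul_eq_mul]
      module
    · simp only [LinearMap.smul_apply]
      rw [← corootForm_specialForm hb hbr, specialForm_comm hb, corootForm_specialForm hb hbr]
  · rw [Set.not_nonempty_iff_eq_empty] at hne
    exact ⟨0, fun u v => rfl, fun w u v => rfl, fun h hh => by rw [hne] at hh; exact hh.elim⟩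

end InvariantForm


/-! ### Holomorphic functions of several variables -/

section SeveralVariables

variable {E F : Type*} [NormedAddCommGroup E] [NormedSpace ℂ E] [FiniteDimensional ℂ E]
  [NormedAddCommGroup F] [NormedSpace ℂ F] [FiniteDimensional ℂ F]

/-- Cauchy's formula on a circle in the direction v expresses ∂_v f(y) by an integral of values of
f. It is differentiated under the integral sign, with Cauchy's estimate as the dominating bound. -/
theorem differentiableAt_fderiv_apply_of_eventually {f : E → F} {x : E}
    (hf : ∀ᶠ y in 𝓝 x, DifferentiableAt ℂ f y) (v : E) :
    DifferentiableAt ℂ (fun y => fderiv ℂ f y v) x := by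
  have : ProperSpace ℂ := inferInstance
  have : CompleteSpace F := FiniteDimensional.complete ℂ F
  have : CompleteSpace E := FiniteDimensional.complete ℂ E
  have hfx : ContinuousAt f x := (hf.self_of_nhds).continuousAt
  obtain ⟨R, hR, hball⟩ := Metric.eventually_nhds_iff_ball.1
    (hf.and (hfx.eventually (Metric.ball_mem_nhds (f x) one_pos)))
  -- The circles around points of the ball of radius r stay in the ball of radius 2r, and a ball of
  -- radius 2r around a point there stays within R = 4r. On it f varies by at most 2, whence the
  -- bound 2/(2r).
  set r := R / 4 with hr
  have hr0 : 0 < r := by positivity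
  set ε := r / (‖v‖ + 1) with hε
  have hε0 : 0 < ε := by positivity
  have hεv : ε * ‖v‖ < r := by
    rw [hε, div_mul_eq_mul_div, div_lt_iff₀ (by positivity)]
    nlinarith [norm_nonneg v]
  have hmem : ∀ y ∈ Metric.ball x r, ∀ ζ : ℂ, ‖ζ‖ ≤ ε → y + ζ • v ∈ Metric.ball x (2 * r) := by
    intro y hy ζ hζ
    rw [mem_ball_iff_norm] at *
    calc ‖y + ζ • v - x‖ ≤ ‖y - x‖ + ‖ζ • v‖ := by
          rw [add_sub_right_comm]; exact norm_add_le _ _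
      _ < r + r := by
          rw [norm_smul]
          have : ‖ζ‖ * ‖v‖ ≤ ε * ‖v‖ := by gcongr
          linarith
      _ = 2 * r := by ring
  have hdiff : ∀ p ∈ Metric.ball x (2 * r), DifferentiableAt ℂ f p := fun p hp =>
    (hball p (Metric.ball_subset_ball (by rw [hr]; linarith) hp)).1
  have hbound : ∀ p ∈ Metric.ball x (2 * r), ‖fderiv ℂ f p‖ ≤ 2 / (2 * r) := by
    intro p hp
    have hsub : Metric.ball p (2 * r) ⊆ Metric.ball x R := by
      apply Metric.ball_subset_ball'
      have := Metric.mem_ball.1 hp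
      rw [hr] at *
      linarith
    refine Complex.norm_fderiv_le_div_of_mapsTo_ball
      (fun q hq => (hball q (hsub hq)).1.differentiableWithinAt) (fun q hq => ?_) (by positivity)
    have h1 := (hball q (hsub hq)).2
    have h2 := (hball p (hsub (Metric.mem_ball_self (by positivity)))).2
    rw [Metric.mem_closedBall]
    have := dist_triangle_right (f q) (f p) (f x)
    linarith
  set φ : ℝ → E := fun θ => circleMap 0 ε θ • v with hφ
  have hφc : Continuous φ := (continuous_circleMap 0 ε).smul continuous_const
  set c : ℝ → ℂ := fun θ => deriv (circleMap 0 ε) θ * ((circleMap 0 ε θ - 0) ^ 2)⁻¹ with hc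
  have hcc : Continuous c := by
    simp only [hc, deriv_circleMap]
    refine ((continuous_circleMap 0 ε).mul continuous_const).mul (Continuous.inv₀ ?_ fun θ => ?_)
    · exact ((continuous_circleMap 0 ε).sub continuous_const).pow 2
    · rw [sub_zero]; exact pow_ne_zero 2 (circleMap_ne_center hε0.ne')
  have hφmem : ∀ y ∈ Metric.ball x r, ∀ θ, y + φ θ ∈ Metric.ball x (2 * r) := fun y hy θ =>
    hmem y hy _ (by rw [norm_circleMap_zero, abs_of_pos hε0])
  have hrep : ∀ y ∈ Metric.ball x r, fderiv ℂ f y v =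
      (2 * Real.pi * Complex.I : ℂ)⁻¹ • ∫ θ in (0 : ℝ)..2 * Real.pi, c θ • f (y + φ θ) := by
    intro y hy
    have h1 : ∀ ζ : ℂ, ‖ζ‖ ≤ ε → HasDerivAt (fun ζ : ℂ => f (y + ζ • v))
        (fderiv ℂ f (y + ζ • v) v) ζ := by
      intro ζ hζ
      have h2 : HasDerivAt (fun ζ : ℂ => y + ζ • v) v ζ := by
        simpa using ((hasDerivAt_id ζ).smul_const v).const_add y
      exact (hdiff _ (hmem y hy ζ hζ)).hasFDerivAt.comp_hasDerivAt ζ h2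
    have h3 := Complex.two_pi_I_inv_smul_circleIntegral_sub_sq_inv_smul_of_differentiable
      (U := {ζ : ℂ | y + ζ • v ∈ Metric.ball x (2 * r)}) (c := 0) (w₀ := 0) (R := ε)
      (f := fun ζ : ℂ => f (y + ζ • v))
      (Metric.isOpen_ball.preimage (by fun_prop))
      (fun ζ hζ => hmem y hy ζ (by simpa using hζ))
      (fun ζ hζ => by
        have h2 : HasDerivAt (fun ζ : ℂ => y + ζ • v) v ζ := by
          simpa using ((hasDerivAt_id ζ).smul_const v).const_add y
        exact ((hdiff _ hζ).hasFDerivAt.comp_hasDerivAt ζ h2).differentiableAt.differentiableWithinAt)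
      (Metric.mem_ball_self hε0)
    rw [(h1 0 (by simpa using hε0.le)).deriv, zero_smul, add_zero] at h3
    rw [← h3, circleIntegral]
    simp only [hc, hφ, smul_smul]
  have hev : (fun y => fderiv ℂ f y v) =ᶠ[𝓝 x] fun y =>
      (2 * Real.pi * Complex.I : ℂ)⁻¹ • ∫ θ in (0 : ℝ)..2 * Real.pi, c θ • f (y + φ θ) := by
    filter_upwards [Metric.ball_mem_nhds x hr0] with y hy using hrep y hy
  refine DifferentiableAt.congr_of_eventuallyEq ?_ hev
  refine DifferentiableAt.const_smul ?_ _
  have hcont : ∀ y ∈ Metric.ball x r, Continuous fun θ => c θ • f (y + φ θ) := by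
    intro y hy
    refine hcc.smul (continuous_iff_continuousAt.2 fun θ => ?_)
    exact ContinuousAt.comp (f := fun θ => y + φ θ) (hdiff _ (hφmem y hy θ)).continuousAt
      (continuous_const.add hφc).continuousAt
  borelize E
  borelize (E →L[ℂ] F)
  have : ProperSpace (E →L[ℂ] F) := FiniteDimensional.proper ℂ _
  refine (intervalIntegral.hasFDerivAt_integral_of_dominated_of_fderiv_le (𝕜 := ℂ)
    (F' := fun y θ => c θ • fderiv ℂ f (y + φ θ)) (bound := fun θ => ‖c θ‖ * (2 / (2 * r)))
    (Metric.ball_mem_nhds x hr0) ?_ ?_ ?_ ?_ ?_ ?_).differentiableAt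
  · filter_upwards [Metric.ball_mem_nhds x hr0] with y hy
    exact (hcont y hy).aestronglyMeasurable
  · exact (hcont x (Metric.mem_ball_self hr0)).intervalIntegrable _ _
  · refine hcc.aestronglyMeasurable.smul ?_
    exact ((measurable_fderiv ℂ f).comp
      (continuous_const.add hφc).measurable).aestronglyMeasurable
  · refine Filter.Eventually.of_forall fun θ _ y hy => ?_
    rw [norm_smul]
    gcongr
    exact hbound _ (hφmem y hy θ)
  · exact (hcc.norm.mul continuous_const).intervalIntegrable _ _
  · refine Filter.Eventually.of_forall fun θ _ y hy => ?_
    have h1 := (hdiff _ (hφmem y hy θ)).hasFDerivAt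
    have h2 : HasFDerivAt (fun y => y + φ θ) (ContinuousLinearMap.id ℂ E) y :=
      (hasFDerivAt_id y).add_const _
    exact (h1.comp y h2).const_smul (c θ)

/-- The derivative of a holomorphic function is holomorphic. -/
theorem differentiableAt_fderiv_of_eventually {f : E → F} {x : E}
    (hf : ∀ᶠ y in 𝓝 x, DifferentiableAt ℂ f y) : DifferentiableAt ℂ (fderiv ℂ f) x := by
  set bs := Module.finBasis ℂ E
  have e : fderiv ℂ f = fun y => ∑ i,
      (LinearMap.toContinuousLinearMap (bs.coord i)).smulRight (fderiv ℂ f y (bs i)) := by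
    funext y
    ext z
    simp only [sum_apply, ContinuousLinearMap.smulRight_apply,
      LinearMap.coe_toContinuousLinearMap', Module.Basis.coord_apply]
    conv_lhs => rw [← bs.sum_repr z]
    simp only [map_sum, map_smul]
  rw [e]
  refine DifferentiableAt.fun_sum fun i _ => ?_
  exact (ContinuousLinearMap.smulRightL ℂ E F
    (LinearMap.toContinuousLinearMap (bs.coord i))).differentiableAt.comp x
      (differentiableAt_fderiv_apply_of_eventually hf (bs i))

end SeveralVariables


/-! ### Flat linear systems -/

section FlatSystems

variable {E : Type*} [NormedAddCommGroup E] [NormedSpace ℂ E]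

/-- The restriction of `g` to the segment from `0` to `u` (if it is continuous there). -/
noncomputable def alongSegment {W : Type*} [TopologicalSpace W] [Zero W] (g : E → W) (u : E) :
    C(unitInterval, W) :=
  open Classical in
  if h : Continuous (fun s : unitInterval => g ((s : ℝ) • u)) then ⟨_, h⟩ else 0

theorem smul_mem_ball {u : E} {ρ : ℝ} (hu : u ∈ Metric.ball (0 : E) ρ) (s : unitInterval) :
    (s : ℝ) • u ∈ Metric.ball (0 : E) ρ := by
  rw [mem_ball_zero_iff] at *
  rw [norm_smul, Real.norm_eq_abs, abs_of_nonneg s.2.1]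
  exact (mul_le_of_le_one_left (norm_nonneg u) s.2.2).trans_lt hu

theorem continuous_alongSegment_aux {W : Type*} [TopologicalSpace W] {g : E → W} {ρ : ℝ}
    (hg : ContinuousOn g (Metric.ball 0 ρ)) {u : E} (hu : u ∈ Metric.ball (0 : E) ρ) :
    Continuous (fun s : unitInterval => g ((s : ℝ) • u)) :=
  hg.comp_continuous (by fun_prop) (smul_mem_ball hu)

theorem alongSegment_apply {W : Type*} [TopologicalSpace W] [Zero W] {g : E → W} {ρ : ℝ}
    (hg : ContinuousOn g (Metric.ball 0 ρ)) {u : E} (hu : u ∈ Metric.ball (0 : E) ρ)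
    (s : unitInterval) : alongSegment g u s = g ((s : ℝ) • u) := by
  rw [alongSegment, dif_pos (continuous_alongSegment_aux hg hu)]
  rfl

variable [FiniteDimensional ℂ E]

/-- The estimate must be uniform in s. The segment is compact, so the derivative of g is uniformly
close to its values there, and the mean value inequality gives the bound ε‖v - u‖ for all s at once.
-/
theorem differentiableAt_alongSegment {W : Type*} [NormedAddCommGroup W] [NormedSpace ℂ W]
    {g : E → W} {ρ : ℝ} (hg : ∀ u ∈ Metric.ball (0 : E) ρ, DifferentiableAt ℂ g u)
    (hg' : ContinuousOn (fderiv ℂ g) (Metric.ball 0 ρ)) {u : E} (hu : u ∈ Metric.ball (0 : E) ρ) :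
    DifferentiableAt ℂ (alongSegment g) u := by
  have hgc : ContinuousOn g (Metric.ball 0 ρ) := fun u hu =>
    (hg u hu).continuousAt.continuousWithinAt
  have hc := continuous_alongSegment_aux hg' hu
  let L : E →ₗ[ℂ] C(unitInterval, W) :=
    { toFun := fun x => ⟨fun s => (s : ℝ) • fderiv ℂ g ((s : ℝ) • u) x,
        (continuous_subtype_val).smul (hc.clm_apply continuous_const)⟩
      map_add' := fun x y => by ext s; simp
      map_smul' := fun c x => by
        ext s
        exact (congrArg _ (map_smul _ c x)).trans (smul_comm _ _ _) }
  have hL : ∀ x s, L x s = (s : ℝ) • fderiv ℂ g ((s : ℝ) • u) x := fun x s => rfl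
  refine HasFDerivAt.differentiableAt (f' := LinearMap.toContinuousLinearMap L) ?_
  rw [hasFDerivAt_iff_isLittleO, Asymptotics.isLittleO_iff]
  intro ε hε
  have hS : IsCompact (Set.range fun s : unitInterval => (s : ℝ) • u) :=
    isCompact_range (by fun_prop)
  have hunif := hS.uniformContinuousAt_of_continuousAt (fderiv ℂ g) (by
    rintro _ ⟨s, rfl⟩
    exact hg'.continuousAt (Metric.isOpen_ball.mem_nhds (smul_mem_ball hu s)))
    (Metric.dist_mem_uniformity hε)
  obtain ⟨δ, hδ, hδ'⟩ := Metric.mem_uniformity_dist.1 hunif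
  obtain ⟨δ', hδ'0, hδ'sub⟩ := Metric.isOpen_ball.mem_nhds hu |> Metric.mem_nhds_iff.1
  filter_upwards [Metric.ball_mem_nhds u (lt_min hδ hδ'0)] with v hv
  have hvball : v ∈ Metric.ball (0 : E) ρ :=
    hδ'sub (Metric.ball_subset_ball (min_le_right _ _) hv)
  rw [ContinuousMap.norm_le _ (by positivity)]
  intro s
  simp only [ContinuousMap.sub_apply, LinearMap.coe_toContinuousLinearMap', hL,
    alongSegment_apply hgc hvball, alongSegment_apply hgc hu]
  have hs0 := s.2.1
  have hs1 := s.2.2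
  have hsv : ‖(s : ℝ) • v - (s : ℝ) • u‖ ≤ ‖v - u‖ := by
    rw [← smul_sub, norm_smul, Real.norm_eq_abs, abs_of_nonneg hs0]
    exact mul_le_of_le_one_left (norm_nonneg _) hs1
  have hvu : ‖v - u‖ < min δ δ' := mem_ball_iff_norm.1 hv
  have hseg : ∀ p ∈ segment ℝ ((s : ℝ) • u) ((s : ℝ) • v),
      p ∈ Metric.ball (0 : E) ρ ∧ dist ((s : ℝ) • u) p < δ := by
    intro p hp
    refine ⟨(convex_ball (0 : E) ρ).segment_subset (smul_mem_ball hu s)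
      (smul_mem_ball hvball s) hp, ?_⟩
    have := (convex_ball ((s : ℝ) • u) (min δ δ')).segment_subset
      (Metric.mem_ball_self (lt_min hδ hδ'0)) (mem_ball_iff_norm.2 (hsv.trans_lt hvu)) hp
    rw [dist_comm]
    exact (Metric.mem_ball.1 this).trans_le (min_le_left _ _)
  have hmv := Convex.norm_image_sub_le_of_norm_hasFDerivWithin_le' (𝕜 := ℂ)
    (f := g) (f' := fderiv ℂ g) (φ := fderiv ℂ g ((s : ℝ) • u)) (C := ε)
    (s := segment ℝ ((s : ℝ) • u) ((s : ℝ) • v))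
    (x := (s : ℝ) • u) (y := (s : ℝ) • v)
    (fun p hp => (hg p (hseg p hp).1).hasFDerivAt.hasFDerivWithinAt)
    (fun p hp => by
      rw [← dist_eq_norm, dist_comm]
      exact (hδ' (hseg p hp).2 ⟨s, rfl⟩).le)
    (convex_segment _ _) (left_mem_segment _ _ _) (right_mem_segment _ _ _)
  have e : fderiv ℂ g ((s : ℝ) • u) ((s : ℝ) • v - (s : ℝ) • u) =
      (s : ℝ) • fderiv ℂ g ((s : ℝ) • u) (v - u) := by
    rw [← smul_sub, ContinuousLinearMap.map_smul_of_tower]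
  rw [e] at hmv
  exact hmv.trans (by gcongr)

variable {𝔸 : Type*} [NormedRing 𝔸] [NormedAlgebra ℂ 𝔸] [FiniteDimensional ℂ 𝔸]

omit [NormedAlgebra ℂ 𝔸] [FiniteDimensional ℂ 𝔸] in
theorem continuous_comp_projIcc (ψ : C(unitInterval, 𝔸)) :
    Continuous fun s : ℝ => ψ (Set.projIcc 0 1 zero_le_one s) :=
  ψ.continuous.comp continuous_projIcc

/-- The Volterra operator `ψ ↦ ∫₀ ψ`. -/
noncomputable def volterra (𝔸 : Type*) [NormedRing 𝔸] [NormedAlgebra ℂ 𝔸]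
    [FiniteDimensional ℂ 𝔸] : C(unitInterval, 𝔸) →L[ℂ] C(unitInterval, 𝔸) :=
  LinearMap.mkContinuous
    { toFun := fun ψ => ⟨fun s => ∫ σ in (0 : ℝ)..s, ψ (Set.projIcc 0 1 zero_le_one σ),
        (intervalIntegral.continuous_primitive
          (fun a b => (continuous_comp_projIcc ψ).intervalIntegrable a b) 0).comp
            continuous_subtype_val⟩
      map_add' := fun ψ χ => by
        ext s
        exact intervalIntegral.integral_add ((continuous_comp_projIcc ψ).intervalIntegrable _ _)
          ((continuous_comp_projIcc χ).intervalIntegrable _ _)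
      map_smul' := fun c ψ => by
        ext s
        exact intervalIntegral.integral_smul c _ }
    1 (fun ψ => by
      rw [one_mul, ContinuousMap.norm_le _ (norm_nonneg _)]
      intro s
      have := intervalIntegral.norm_integral_le_of_norm_le_const (a := (0 : ℝ)) (b := s)
        (C := ‖ψ‖) (f := fun σ => ψ (Set.projIcc 0 1 zero_le_one σ))
        (fun σ _ => ψ.norm_coe_le_norm _)
      refine this.trans ?_
      rw [sub_zero, abs_of_nonneg s.2.1]
      exact mul_le_of_le_one_right (norm_nonneg _) s.2.2)

theorem volterra_apply (ψ : C(unitInterval, 𝔸)) (s : unitInterval) :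
    volterra 𝔸 ψ s = ∫ σ in (0 : ℝ)..s, ψ (Set.projIcc 0 1 zero_le_one σ) := rfl

/-- The contraction of a path of linear maps with a vector. -/
noncomputable def contractPath (E 𝔸 : Type*) [NormedAddCommGroup E] [NormedSpace ℂ E]
    [FiniteDimensional ℂ E] [NormedRing 𝔸] [NormedAlgebra ℂ 𝔸] [FiniteDimensional ℂ 𝔸] :
    E →L[ℂ] (C(unitInterval, E →L[ℂ] 𝔸) →L[ℂ] C(unitInterval, 𝔸)) :=
  LinearMap.toContinuousLinearMap
    { toFun := fun u => ContinuousLinearMap.compLeftContinuous ℂ unitInterval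
        (ContinuousLinearMap.apply ℂ 𝔸 u)
      map_add' := fun u v => by ext ψ s; exact map_add (ψ s) u v
      map_smul' := fun c u => by ext ψ s; exact map_smul (ψ s) c u }

theorem contractPath_apply (u : E) (ψ : C(unitInterval, E →L[ℂ] 𝔸)) (s : unitInterval) :
    contractPath E 𝔸 u ψ s = ψ s u := rfl

/-- The coefficient `s ↦ A(su)u` of the ordinary differential equation along a segment. -/
noncomputable def radialPath (A : E → E →L[ℂ] 𝔸) (u : E) : C(unitInterval, 𝔸) :=
  contractPath E 𝔸 u (alongSegment A u)

theorem radialPath_apply {A : E → E →L[ℂ] 𝔸} {ρ : ℝ} (hA : ContinuousOn A (Metric.ball 0 ρ))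
    {u : E} (hu : u ∈ Metric.ball (0 : E) ρ) (s : unitInterval) :
    radialPath A u s = A ((s : ℝ) • u) u := by
  rw [radialPath, contractPath_apply, alongSegment_apply hA hu]

theorem differentiableAt_radialPath {A : E → E →L[ℂ] 𝔸} {ρ : ℝ}
    (hA : ∀ u ∈ Metric.ball (0 : E) ρ, DifferentiableAt ℂ A u)
    (hA' : ContinuousOn (fderiv ℂ A) (Metric.ball 0 ρ)) {u : E}
    (hu : u ∈ Metric.ball (0 : E) ρ) : DifferentiableAt ℂ (radialPath A) u :=
  ((contractPath E 𝔸).hasFDerivAt.clm_apply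
    (differentiableAt_alongSegment hA hA' hu).hasFDerivAt).differentiableAt

theorem fderiv_radialPath {A : E → E →L[ℂ] 𝔸} {ρ : ℝ}
    (hA : ∀ u ∈ Metric.ball (0 : E) ρ, DifferentiableAt ℂ A u)
    (hA' : ContinuousOn (fderiv ℂ A) (Metric.ball 0 ρ)) {u : E}
    (hu : u ∈ Metric.ball (0 : E) ρ) (x : E) (s : unitInterval) :
    fderiv ℂ (radialPath A) u x s =
      (s : ℝ) • fderiv ℂ A ((s : ℝ) • u) x u + A ((s : ℝ) • u) x := by
  have hAc : ContinuousOn A (Metric.ball 0 ρ) := fun u hu =>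
    (hA u hu).continuousAt.continuousWithinAt
  have h1 : HasFDerivAt (fun v => radialPath A v s)
      ((ContinuousMap.evalCLM ℂ s).comp (fderiv ℂ (radialPath A) u)) u :=
    (ContinuousMap.evalCLM ℂ s : C(unitInterval, 𝔸) →L[ℂ] 𝔸).hasFDerivAt.comp u
      (differentiableAt_radialPath hA hA' hu).hasFDerivAt
  have h2 : HasFDerivAt (fun v : E => A ((s : ℝ) • v))
      ((fderiv ℂ A ((s : ℝ) • u)).comp ((s : ℝ) • ContinuousLinearMap.id ℂ E)) u :=
    (hA _ (smul_mem_ball hu s)).hasFDerivAt.comp u ((hasFDerivAt_id u).const_smul (s : ℝ))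
  have h3 : HasFDerivAt (fun v : E => A ((s : ℝ) • v) v) _ u := h2.clm_apply (hasFDerivAt_id u)
  have h4 : (fun v => radialPath A v s) =ᶠ[𝓝 u] fun v => A ((s : ℝ) • v) v := by
    filter_upwards [Metric.isOpen_ball.mem_nhds hu] with v hv using radialPath_apply hAc hv s
  have h5 := (h1.congr_of_eventuallyEq h4.symm).unique h3
  have h6 : fderiv ℂ (radialPath A) u x s = A ((s : ℝ) • u) x +
      fderiv ℂ A ((s : ℝ) • u) ((s : ℝ) • x) u := congrArg (fun T => T x) h5
  rw [h6, ContinuousLinearMap.map_smul_of_tower, add_comm]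
  rfl

omit [FiniteDimensional ℂ E] in
-- As K 0 = 0, the operator 1 - K u is invertible near 0, and (1 - K u)⁻¹ x₀ is holomorphic in u
-- because inversion is. The final uniqueness clause serves to identify the derivative of Φ.
theorem exists_differentiable_fixedPoint {X : Type*} [NormedAddCommGroup X] [NormedSpace ℂ X]
    [CompleteSpace X] {K : E → X →L[ℂ] X} (hK : ∀ᶠ u in 𝓝 (0 : E), DifferentiableAt ℂ K u)
    (hK0 : K 0 = 0) (x₀ : X) :
    ∃ Φ : E → X, Φ 0 = x₀ ∧ ∀ᶠ u in 𝓝 (0 : E), (∀ᶠ v in 𝓝 u, Φ v = x₀ + K v (Φ v)) ∧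
      DifferentiableAt ℂ Φ u ∧ ∀ η, η = K u η → η = 0 := by
  have hunit : ∀ᶠ u in 𝓝 (0 : E), IsUnit (1 - K u) := by
    have hcont : ContinuousAt (fun u => 1 - K u) 0 :=
      continuousAt_const.sub hK.self_of_nhds.continuousAt
    have : IsOpen {T : X →L[ℂ] X | IsUnit T} := Units.isOpen
    refine hcont.eventually (this.mem_nhds ?_)
    simp [hK0]
  refine ⟨fun u => Ring.inverse (1 - K u) x₀, ?_, ?_⟩
  · simp [hK0]
  filter_upwards [hunit.eventually_nhds, hK] with u hun hKu
  refine ⟨?_, ?_, ?_⟩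
  · filter_upwards [hun] with v hv
    have := congrArg (fun T : X →L[ℂ] X => T x₀) (Ring.mul_inverse_cancel _ hv)
    exact sub_eq_iff_eq_add.1 this
  · obtain ⟨U, hU⟩ := hun.self_of_nhds
    have h1 : DifferentiableAt ℂ (fun v => Ring.inverse (1 - K v)) u := by
      refine DifferentiableAt.comp (g := Ring.inverse) u ?_
        ((differentiableAt_const (1 : X →L[ℂ] X)).sub hKu)
      rw [← hU]
      exact differentiableAt_inverse U.isUnit
    exact h1.clm_apply (differentiableAt_const _)
  · intro η hη
    have := congrArg (fun T : X →L[ℂ] X => T η) (Ring.inverse_mul_cancel _ hun.self_of_nhds)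
    simp only [mul_apply_eq_comp, sub_apply, one_apply_eq_self] at this
    rw [← hη, sub_self, map_zero] at this
    exact this.symm

/-- The Frobenius theorem for linear systems. -/
theorem exists_fundamental_solution {A : E → E →L[ℂ] 𝔸}
    (hA : ∀ᶠ u in 𝓝 (0 : E), DifferentiableAt ℂ A u)
    (hflat : ∀ᶠ u in 𝓝 (0 : E), ∀ X Y : E,
      fderiv ℂ A u X Y - fderiv ℂ A u Y X + A u X * A u Y - A u Y * A u X = 0) :
    ∃ Θ : E → 𝔸, Θ 0 = 1 ∧ ∀ᶠ u in 𝓝 (0 : E),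
      HasFDerivAt Θ ((ContinuousLinearMap.mul ℂ 𝔸 (Θ u)).comp (A u)) u := by
  have : CompleteSpace 𝔸 := FiniteDimensional.complete ℂ 𝔸
  have hA' : ∀ᶠ u in 𝓝 (0 : E), DifferentiableAt ℂ (fderiv ℂ A) u := by
    filter_upwards [hA.eventually_nhds] with u hu using differentiableAt_fderiv_of_eventually hu
  obtain ⟨ρ, hρ, hball⟩ := Metric.eventually_nhds_iff_ball.1 (hA.and (hA'.and hflat))
  have hAd : ∀ u ∈ Metric.ball (0 : E) ρ, DifferentiableAt ℂ A u := fun u hu => (hball u hu).1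
  have hAc : ContinuousOn A (Metric.ball 0 ρ) := fun u hu =>
    (hAd u hu).continuousAt.continuousWithinAt
  have hA'c : ContinuousOn (fderiv ℂ A) (Metric.ball 0 ρ) := fun u hu =>
    (hball u hu).2.1.continuousAt.continuousWithinAt
  set a : E → C(unitInterval, 𝔸) := radialPath A
  have ha : ∀ u ∈ Metric.ball (0 : E) ρ, ∀ s, a u s = A ((s : ℝ) • u) u :=
    fun u hu s => radialPath_apply hAc hu s
  have had : ∀ u ∈ Metric.ball (0 : E) ρ, DifferentiableAt ℂ a u := fun u hu =>
    differentiableAt_radialPath hAd hA'c hu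
  have ha' : ∀ u ∈ Metric.ball (0 : E) ρ, ∀ x s, fderiv ℂ a u x s =
      (s : ℝ) • fderiv ℂ A ((s : ℝ) • u) x u + A ((s : ℝ) • u) x :=
    fun u hu x s => fderiv_radialPath hAd hA'c hu x s
  clear_value a
  -- A solution of φ = 1 + K u φ satisfies φ' = φ A(su)u and φ(0) = 1 along the ray of u. Its value
  -- at s = 1 will be Θ(u).
  let K : E → C(unitInterval, 𝔸) →L[ℂ] C(unitInterval, 𝔸) := fun u =>
    (volterra 𝔸).comp ((ContinuousLinearMap.mul ℂ C(unitInterval, 𝔸)).flip (a u))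
  have hK : ∀ u ψ, K u ψ = volterra 𝔸 (ψ * a u) := fun u ψ => rfl
  have hKd : ∀ u ∈ Metric.ball (0 : E) ρ, DifferentiableAt ℂ K u := fun u hu =>
    (differentiableAt_const _).clm_comp
      ((ContinuousLinearMap.mul ℂ C(unitInterval, 𝔸)).flip.differentiableAt.comp u (had u hu))
  have h0 : (0 : E) ∈ Metric.ball (0 : E) ρ := Metric.mem_ball_self hρ
  have hK0 : K 0 = 0 := by
    have : a 0 = 0 := by ext s; rw [ha 0 h0]; simp
    ext ψ
    rw [hK, this, mul_zero, map_zero]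
    simp
  obtain ⟨Φ, hΦ0, hΦ⟩ := exists_differentiable_fixedPoint (K := K)
    (by filter_upwards [Metric.ball_mem_nhds (0 : E) hρ] with u hu using hKd u hu) hK0 1
  refine ⟨fun u => Φ u 1, congrArg (fun ψ => ψ 1) hΦ0, ?_⟩
  filter_upwards [hΦ, Metric.ball_mem_nhds (0 : E) hρ] with u ⟨hΦeq, hΦd, hinj⟩ hu
  have hΦ' : ∀ x, fderiv ℂ Φ u x =
      volterra 𝔸 (Φ u * fderiv ℂ a u x + fderiv ℂ Φ u x * a u) := by
    intro x
    have h1 : HasFDerivAt (fun v => 1 + K v (Φ v)) _ u :=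
      (((volterra 𝔸).hasFDerivAt.comp u
        (hΦd.hasFDerivAt.mul' (had u hu).hasFDerivAt)).const_add 1)
    have h2 := hΦd.hasFDerivAt.unique (h1.congr_of_eventuallyEq hΦeq)
    conv_lhs => rw [h2]
    rfl
  -- the explicit solution of the linearised equation
  have hφ0 : ∀ s, Φ u s = 1 + ∫ σ in (0 : ℝ)..s, (Φ u * a u) (Set.projIcc 0 1 zero_le_one σ) :=
    fun s => by
      conv_lhs => rw [hΦeq.self_of_nhds, hK]
      rfl
  let φ : ℝ → 𝔸 := fun s => 1 + ∫ σ in (0 : ℝ)..s, (Φ u * a u) (Set.projIcc 0 1 zero_le_one σ)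
  have hφ : ∀ s : unitInterval, φ s = Φ u s := fun s => (hφ0 s).symm
  have hφd : ∀ s : unitInterval, HasDerivAt φ (Φ u s * A ((s : ℝ) • u) u) s := by
    intro s
    have := ((continuous_comp_projIcc (Φ u * a u)).integral_hasStrictDerivAt 0 s).hasDerivAt
    have h2 := this.const_add 1
    rw [Set.projIcc_val, ContinuousMap.mul_apply, ha u hu] at h2
    exact h2
  -- If Θ is a solution, then Φ v s = Θ(sv), so the derivative of Φ in the direction x has to be s
  -- φ(s) A(su)x. Flatness is what makes this guess satisfy the linearised Volterra equation.
  have hζ : ∀ x, ∃ ζ : C(unitInterval, 𝔸), (∀ s, ζ s = (s : ℝ) • (Φ u s * A ((s : ℝ) • u) x)) ∧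
      ζ = volterra 𝔸 (Φ u * fderiv ℂ a u x + ζ * a u) := by
    intro x
    have hcA := continuous_alongSegment_aux hAc hu
    let ζ : C(unitInterval, 𝔸) := ⟨fun s => (s : ℝ) • (Φ u s * A ((s : ℝ) • u) x),
      continuous_subtype_val.smul ((Φ u).continuous.mul (hcA.clm_apply continuous_const))⟩
    have hζ : ∀ s, ζ s = (s : ℝ) • (Φ u s * A ((s : ℝ) • u) x) := fun s => rfl
    refine ⟨ζ, hζ, ?_⟩
    ext s
    rw [volterra_apply]
    have hder : ∀ σ ∈ Set.uIcc (0 : ℝ) s, HasDerivAt (fun t : ℝ => t • (φ t * A (t • u) x))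
        ((Φ u * fderiv ℂ a u x + ζ * a u) (Set.projIcc 0 1 zero_le_one σ)) σ := by
      intro σ hσ
      rw [Set.uIcc_of_le s.2.1] at hσ
      have hσI : σ ∈ Set.Icc (0 : ℝ) 1 := ⟨hσ.1, hσ.2.trans s.2.2⟩
      rw [Set.projIcc_of_mem zero_le_one hσI]
      set τ : unitInterval := ⟨σ, hσI⟩ with hτ
      have h1 : HasDerivAt (fun t : ℝ => A (t • u)) (fderiv ℂ A (σ • u) u) σ := by
        have h2 : HasDerivAt (fun t : ℝ => t • u) u σ := by
          simpa using (hasDerivAt_id σ).smul_const u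
        have h3 := (hAd _ (smul_mem_ball hu τ)).hasFDerivAt.restrictScalars ℝ
        exact h3.comp_hasDerivAt σ h2
      have h4 : HasDerivAt (fun t : ℝ => A (t • u) x) (fderiv ℂ A (σ • u) u x) σ :=
        ((ContinuousLinearMap.apply ℂ 𝔸 x).restrictScalars ℝ).hasFDerivAt.comp_hasDerivAt σ h1
      have h5 := (hasDerivAt_id σ).smul ((hφd τ).mul h4)
      refine h5.congr_deriv ?_
      have hf := (hball _ (smul_mem_ball hu τ)).2.2 u x
      simp only [ContinuousMap.add_apply, ContinuousMap.mul_apply, ha u hu, ha' u hu, hζ]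
      have hτσ : (τ : ℝ) = σ := rfl
      rw [← hτσ] at *
      simp only [id_eq, one_smul, Pi.mul_apply, hφ τ]
      have key : (τ : ℝ) • (Φ u τ * (fderiv ℂ A ((τ : ℝ) • u) u x - fderiv ℂ A ((τ : ℝ) • u) x u +
        A ((τ : ℝ) • u) u * A ((τ : ℝ) • u) x - A ((τ : ℝ) • u) x * A ((τ : ℝ) • u) u)) = 0 := by
        rw [hf, mul_zero, smul_zero]
      simp only [mul_add, mul_sub, smul_add, smul_sub, smul_mul_assoc, mul_smul_comm, mul_assoc] at key ⊢
      rw [← sub_eq_zero]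
      rw [← key]
      abel
    rw [intervalIntegral.integral_eq_sub_of_hasDerivAt hder
      ((continuous_comp_projIcc _).intervalIntegrable _ _), zero_smul, sub_zero, hφ, hζ]
  have hfinal : ∀ x, fderiv ℂ Φ u x 1 = Φ u 1 * A u x := by
    intro x
    obtain ⟨ζ, hζ1, hζ2⟩ := hζ x
    -- Both paths solve the same inhomogeneous equation, so the difference is fixed by K u.
    have : fderiv ℂ Φ u x - ζ = 0 := by
      apply hinj
      rw [hK, sub_mul]
      nth_rw 1 [hΦ' x, hζ2]
      rw [← map_sub, add_sub_add_left_eq_sub]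
    rw [sub_eq_zero.1 this, hζ1]
    simp
  have h1 := (ContinuousMap.evalCLM ℂ (1 : unitInterval) :
    C(unitInterval, 𝔸) →L[ℂ] 𝔸).hasFDerivAt.comp u hΦd.hasFDerivAt
  refine h1.congr_fderiv ?_
  ext x
  exact hfinal x

end FlatSystems


/-! ### Uniqueness of solutions up to constants -/

section Rigidity

variable {E : Type*} [NormedAddCommGroup E] [NormedSpace ℂ E]

theorem eventually_eq_of_eventually_hasFDerivAt_zero {W : Type*} [NormedAddCommGroup W]
    [NormedSpace ℂ W] {f : E → W} (h : ∀ᶠ u in 𝓝 (0 : E), HasFDerivAt f (0 : E →L[ℂ] W) u) :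
    ∀ᶠ u in 𝓝 (0 : E), f u = f 0 := by
  obtain ⟨ρ, hρ, hball⟩ := Metric.eventually_nhds_iff_ball.1 h
  filter_upwards [Metric.ball_mem_nhds (0 : E) hρ] with u hu
  exact Metric.isOpen_ball.is_const_of_fderiv_eq_zero (𝕜 := ℂ)
    (convex_ball (0 : E) ρ).isPreconnected
    (fun v hv => (hball v hv).differentiableAt.differentiableWithinAt)
    (fun v hv => (hball v hv).fderiv) hu (Metric.mem_ball_self hρ)

variable {𝔸 : Type*} [NormedRing 𝔸] [NormedAlgebra ℂ 𝔸] [CompleteSpace 𝔸]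

/-- Two solutions of a linear system differ by a constant, if one of them is invertible. -/
theorem eventually_eq_mul_fundamental_solution {A : E → E →L[ℂ] 𝔸} {Θ Ω : E → 𝔸}
    (hΘ : ∀ᶠ u in 𝓝 (0 : E),
      HasFDerivAt Θ ((ContinuousLinearMap.mul ℂ 𝔸 (Θ u)).comp (A u)) u)
    (hΩ : ∀ᶠ u in 𝓝 (0 : E),
      HasFDerivAt Ω ((ContinuousLinearMap.mul ℂ 𝔸 (Ω u)).comp (A u)) u)
    (h0 : IsUnit (Θ 0)) :
    ∀ᶠ u in 𝓝 (0 : E), Ω u = Ω 0 * Ring.inverse (Θ 0) * Θ u := by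
  have hunit : ∀ᶠ u in 𝓝 (0 : E), IsUnit (Θ u) :=
    hΘ.self_of_nhds.continuousAt.eventually (Units.isOpen.mem_nhds h0)
  -- d(ΩΘ⁻¹) = ΩAΘ⁻¹ - ΩΘ⁻¹(ΘA)Θ⁻¹ = 0.
  have hconst : ∀ᶠ u in 𝓝 (0 : E),
      HasFDerivAt (fun u => Ω u * Ring.inverse (Θ u)) (0 : E →L[ℂ] 𝔸) u := by
    filter_upwards [hunit, hΘ, hΩ] with u ⟨U, hU⟩ h1 h2
    have h3 := hasFDerivAt_ringInverse (𝕜 := ℂ) U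
    rw [hU] at h3
    have h4 := h2.mul' (h3.comp u h1)
    refine h4.congr_fderiv ?_
    ext X
    simp [← hU, mul_assoc]
  filter_upwards [eventually_eq_of_eventually_hasFDerivAt_zero hconst, hunit] with u h1 h2
  rw [← h1, mul_assoc, Ring.inverse_mul_cancel _ h2, mul_one]

end Rigidity

/-! ### Differentiability of families of linear maps, tested on vectors -/

section Pointwise

variable {E V W : Type*} [NormedAddCommGroup E] [NormedSpace ℂ E] [NormedAddCommGroup V]
  [NormedSpace ℂ V] [FiniteDimensional ℂ V] [NormedAddCommGroup W] [NormedSpace ℂ W]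

theorem differentiableAt_clm_of_apply {T : E → V →L[ℂ] W} {x : E}
    (h : ∀ v, DifferentiableAt ℂ (fun u => T u v) x) : DifferentiableAt ℂ T x := by
  let β := Module.finBasis ℂ V
  have : T = fun u => ∑ i, ContinuousLinearMap.smulRightL ℂ V W
      (LinearMap.toContinuousLinearMap (β.coord i)) (T u (β i)) := by
    funext u
    ext v
    conv_lhs => rw [← β.sum_repr v, map_sum]
    simp
  rw [this]
  exact DifferentiableAt.fun_sum fun i _ =>
    (ContinuousLinearMap.differentiableAt _).comp x (h (β i))

omit [FiniteDimensional ℂ V] in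
theorem fderiv_clm_apply_const {T : E → V →L[ℂ] W} {x : E} (h : DifferentiableAt ℂ T x) (v : V)
    (X : E) : fderiv ℂ (fun u => T u v) x X = fderiv ℂ T x X v := by
  rw [fderiv_clm_apply h (differentiableAt_const v)]
  simp

theorem hasFDerivAt_clm_of_apply {T : E → V →L[ℂ] W} {T' : E →L[ℂ] V →L[ℂ] W} {x : E}
    (h : ∀ v, DifferentiableAt ℂ (fun u => T u v) x)
    (h' : ∀ v X, fderiv ℂ (fun u => T u v) x X = T' X v) : HasFDerivAt T T' x := by
  have hT := differentiableAt_clm_of_apply h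
  convert hT.hasFDerivAt
  ext X v
  rw [← h', fderiv_clm_apply_const hT]

end Pointwise

/-! ### Exponential maps -/

section LieExp

variable {E G F : Type*} [NormedAddCommGroup E] [NormedSpace ℂ E] [CommGroup G]
  [NormedAddCommGroup F] [NormedSpace ℂ F] [TopologicalSpace G]

/-- `e` is a homomorphism, and `u ↦ x * e u` is a local homeomorphism at `0`. -/
structure IsLieExp (e : E → G) : Prop where
  map_add : ∀ u v, e (u + v) = e u * e v
  map_nhds : ∀ x, Filter.map (fun u => x * e u) (𝓝 0) = 𝓝 x
  injOn : ∃ U ∈ 𝓝 (0 : E), Set.InjOn e U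

namespace IsLieExp

variable {e : E → G} (he : IsLieExp e)
include he

omit [NormedSpace ℂ E] in
theorem map_zero : e 0 = 1 := by
  have := he.map_add 0 0
  rwa [add_zero, right_eq_mul] at this

omit [NormedSpace ℂ E] in
theorem mul_map_zero (x : G) : x * e 0 = x := by rw [he.map_zero, mul_one]

omit [NormedSpace ℂ E] in
theorem eventually_iff {x : G} {p : G → Prop} :
    (∀ᶠ y in 𝓝 x, p y) ↔ ∀ᶠ u in 𝓝 (0 : E), p (x * e u) := by
  rw [← he.map_nhds x, eventually_map]

omit [NormedSpace ℂ E] in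
theorem tendsto (x : G) : Tendsto (fun u => x * e u) (𝓝 0) (𝓝 x) :=
  (he.map_nhds x).le

omit [NormedSpace ℂ E] in
theorem mul_exp_add (x : G) (u v : E) : x * e u * e v = x * e (u + v) := by
  rw [he.map_add, mul_assoc]

/-- The coordinates centred at x and at x e(u) differ by the translation by u. So calculus near x on
the group is calculus near 0 on the Lie algebra. -/
theorem isHolAt_mul_iff {f : G → F} {x : G} {u : E} :
    IsHolAt e f (x * e u) ↔ DifferentiableAt ℂ (fun v => f (x * e v)) u := by
  have : (fun v => f (x * e u * e v)) = fun v => (fun v => f (x * e v)) (u + v) := by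
    funext v
    rw [he.mul_exp_add]
  rw [IsHolAt, this, differentiableAt_comp_add_left (f := fun v => f (x * e v)), add_zero]

theorem invDeriv_mul (f : G → F) (x : G) (u : E) :
    invDeriv e f (x * e u) = fderiv ℂ (fun v => f (x * e v)) u := by
  have : (fun v => f (x * e u * e v)) = fun v => (fun v => f (x * e v)) (u + v) := by
    funext v
    rw [he.mul_exp_add]
  rw [invDeriv, this, fderiv_comp_add_left (f := fun v => f (x * e v)), add_zero]

theorem invDeriv_congr {f g : G → F} {x : G} (h : f =ᶠ[𝓝 x] g) :
    invDeriv e f x = invDeriv e g x :=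
  Filter.EventuallyEq.fderiv_eq (he.eventually_iff.1 h)

theorem continuousAt {f : G → F} {x : G} (h : IsHolAt e f x) : ContinuousAt f x := by
  have := h.continuousAt
  rw [ContinuousAt, he.map_zero, mul_one] at this
  rw [ContinuousAt, ← he.map_nhds x, tendsto_map'_iff]
  exact this

theorem isHolAt_invDeriv [FiniteDimensional ℂ E] [FiniteDimensional ℂ F] {f : G → F} {x : G}
    (h : ∀ᶠ y in 𝓝 x, IsHolAt e f y) : IsHolAt e (invDeriv e f) x := by
  have h1 := he.eventually_iff.1 h
  simp only [he.isHolAt_mul_iff] at h1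
  have : (fun u => invDeriv e f (x * e u)) = fderiv ℂ (fun v => f (x * e v)) := by
    funext u
    exact he.invDeriv_mul f x u
  rw [IsHolAt, this]
  exact differentiableAt_fderiv_of_eventually h1

end IsLieExp

omit [TopologicalSpace G] in
theorem IsHolAt.invDeriv_clm_comp {F' : Type*} [NormedAddCommGroup F'] [NormedSpace ℂ F']
    {e : E → G} {f : G → F} {x : G} (h : IsHolAt e f x) (ℓ : F →L[ℂ] F') :
    invDeriv e (fun y => ℓ (f y)) x = ℓ.comp (invDeriv e f x) :=
  (ℓ.hasFDerivAt.comp (0 : E) h.hasFDerivAt).fderiv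

omit [TopologicalSpace G] in
theorem IsHolAt.clm_comp {F' : Type*} [NormedAddCommGroup F'] [NormedSpace ℂ F']
    {e : E → G} {f : G → F} {x : G} (h : IsHolAt e f x) (ℓ : F →L[ℂ] F') :
    IsHolAt e (fun y => ℓ (f y)) x :=
  ℓ.differentiableAt.comp (0 : E) h

end LieExp

/-! ### Torsion and curvature in terms of the tensor -/

section Flatness

variable {E G : Type*} [NormedAddCommGroup E] [NormedSpace ℂ E] [FiniteDimensional ℂ E]
  [CommGroup G] [TopologicalSpace G] {e : E → G}

omit [FiniteDimensional ℂ E] in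
theorem isTorsionFree_of_symm {Γ : G → E →ₗ[ℂ] E →ₗ[ℂ] E} {N : Set G}
    (h : ∀ x X Y, Γ x X Y = Γ x Y X) : IsTorsionFree e Γ N := by
  intro U _ _ ω _ x _ X Y
  rw [nabla, nabla, extDer, h x X Y]
  ring

theorem isHolAt_form_apply (he : IsLieExp e) {ω : G → Module.Dual ℂ E} {g : G → E} {x : G}
    (hω : ∀ Y, IsHolAt e (fun y => ω y Y) x) (hg : IsHolAt e g x) :
    IsHolAt e (fun y => ω y (g y)) x ∧ ∀ X, invDeriv e (fun y => ω y (g y)) x X =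
      invDeriv e (fun y => ω y (g x)) x X + ω x (invDeriv e g x X) := by
  have h1 : DifferentiableAt ℂ (fun u => LinearMap.toContinuousLinearMap (ω (x * e u))) 0 :=
    differentiableAt_clm_of_apply hω
  have h2 := h1.hasFDerivAt.clm_apply hg.hasFDerivAt
  refine ⟨h2.differentiableAt, fun X => ?_⟩
  have h3 : invDeriv e (fun y => ω y (g y)) x = _ := h2.fderiv
  have h4 := fderiv_clm_apply_const h1 (g x) X
  have h5 := congrArg (fun T => T X) h3
  rw [he.mul_map_zero] at h5
  have h6 : invDeriv e (fun y => ω y (g y)) x X =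
    fderiv ℂ (fun u => LinearMap.toContinuousLinearMap (ω (x * e u))) 0 X (g x) +
      ω x (invDeriv e g x X) := h5.trans (add_comm _ _)
  rw [h6, ← h4]
  rfl

theorem invDeriv_invDeriv_comm {F : Type*} [NormedAddCommGroup F] [NormedSpace ℂ F]
    [FiniteDimensional ℂ F] (he : IsLieExp e) {f : G → F} {x : G}
    (h : ∀ᶠ y in 𝓝 x, IsHolAt e f y) (X Y : E) :
    invDeriv e (fun y => invDeriv e f y Y) x X = invDeriv e (fun y => invDeriv e f y X) x Y := by
  have h1 := he.eventually_iff.1 h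
  simp only [he.isHolAt_mul_iff] at h1
  have h2 := differentiableAt_fderiv_of_eventually h1
  have h3 : ∀ X Y : E, invDeriv e (fun y => invDeriv e f y Y) x X =
      fderiv ℂ (fderiv ℂ (fun v => f (x * e v))) 0 X Y := by
    intro X Y
    rw [← fderiv_clm_apply_const h2]
    simp only [invDeriv, ← he.invDeriv_mul f x]
  rw [h3, h3]
  exact second_derivative_symmetric_of_eventually (𝕜 := ℂ) (f := fun v => f (x * e v))
    (f' := fderiv ℂ (fun v => f (x * e v))) (x := 0)
    (by filter_upwards [h1] with u hu using hu.hasFDerivAt) h2.hasFDerivAt X Y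

/-- In ∇²ω the second derivatives of ω cancel by symmetry and the first derivatives cancel in pairs.
What remains is ω applied to ∂_X Γ(Y, Z) - ∂_Y Γ(X, Z) - [Γ_X, Γ_Y] Z. -/
theorem isFlat_of_curvature (he : IsLieExp e) {Γ : G → E →ₗ[ℂ] E →ₗ[ℂ] E} {N : Set G}
    (hΓ : ∀ x ∈ N, ∀ X Y, IsHolAt e (fun y => Γ y X Y) x)
    (hcurv : ∀ x ∈ N, ∀ X Y Z, invDeriv e (fun y => Γ y Y Z) x X -
      invDeriv e (fun y => Γ y X Z) x Y = curvOp (Γ x) X Y Z) :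
    IsFlat e Γ N := by
  intro U hU hUN ω hω x hx X Y Z
  have hω' : ∀ Y, ∀ᶠ y in 𝓝 x, IsHolAt e (fun z => ω z Y) y := fun Y => by
    filter_upwards [hU.mem_nhds hx] with y hy using hω Y y hy
  have key : ∀ X Y, invDeriv e (fun y => nabla e Γ ω y Y Z) x X =
      invDeriv e (fun y => invDeriv e (fun z => ω z Z) y Y) x X +
        (invDeriv e (fun y => ω y (Γ x Y Z)) x X + ω x (invDeriv e (fun y => Γ y Y Z) x X)) := by
    intro X Y
    have h1 : IsHolAt e (fun y => invDeriv e (fun z => ω z Z) y Y) x :=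
      (he.isHolAt_invDeriv (hω' Z)).clm_comp (ContinuousLinearMap.apply ℂ ℂ Y)
    have h2 := isHolAt_form_apply he (fun Y => (hω' Y).self_of_nhds) (hΓ x (hUN hx) Y Z)
    rw [← h2.2]
    exact congrArg (fun T => T X) (fderiv_fun_add h1 h2.1)
  have hc := congrArg (ω x) (hcurv x (hUN hx) X Y Z)
  rw [curvOp, map_sub, map_sub] at hc
  rw [nablaExt, key, key, nabla, nabla, invDeriv_invDeriv_comm he (hω' Z) X Y]
  linear_combination hc

end Flatness


/-! ### The exponential maps of `ℂˣ`, of products and of the torus -/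

theorem isLieExp_units :
    IsLieExp fun s : ℂ => Units.mk0 (Complex.exp s) (Complex.exp_ne_zero s) where
  map_add u v := by
    ext
    exact Complex.exp_add u v
  map_nhds t := by
    refine Filter.map_injective (m := (Units.val : ℂˣ → ℂ)) Units.val_injective ?_
    rw [Units.isOpenEmbedding_val.map_nhds_eq, Filter.map_map]
    have h : HasStrictDerivAt (fun s => (t : ℂ) * Complex.exp s) ((t : ℂ) * Complex.exp 0) 0 :=
      (Complex.hasStrictDerivAt_exp 0).const_mul _
    have h' := h.map_nhds_eq (by simp)
    rw [Complex.exp_zero, mul_one] at h'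
    exact h'
  injOn := by
    -- On the unit disc the imaginary part stays below π in absolute value, so the principal
    -- logarithm inverts the exponential.
    refine ⟨Metric.ball 0 1, Metric.ball_mem_nhds _ one_pos, fun s hs r hr h => ?_⟩
    have him : ∀ s ∈ Metric.ball (0 : ℂ) 1, Complex.log (Complex.exp s) = s := by
      intro s hs
      have h1 := (Complex.abs_im_le_norm s).trans_lt (mem_ball_zero_iff.1 hs)
      have h2 := Real.pi_gt_three
      rw [abs_lt] at h1
      exact Complex.log_exp (by linarith) (by linarith)
    rw [← him s hs, ← him r hr]
    exact congrArg (fun z : ℂˣ => Complex.log z) h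

section Prod

variable {E G : Type*} [NormedAddCommGroup E] [NormedSpace ℂ E] [CommGroup G]
  [TopologicalSpace G] {e : E → G}

omit [NormedSpace ℂ E] in
theorem isLieExp_expProd (he : IsLieExp e) : IsLieExp (expProd e) where
  map_add u v := Prod.ext (he.map_add u.1 v.1) (isLieExp_units.map_add u.2 v.2)
  map_nhds x := by
    obtain ⟨x, t⟩ := x
    rw [nhds_prod_eq (x := x), ← he.map_nhds x, ← isLieExp_units.map_nhds t,
      Filter.prod_map_map_eq, ← nhds_prod_eq]
    rfl
  injOn := by
    obtain ⟨U, hU, hU'⟩ := he.injOn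
    obtain ⟨V, hV, hV'⟩ := isLieExp_units.injOn
    refine ⟨U ×ˢ V, prod_mem_nhds hU hV, fun p hp q hq h => ?_⟩
    exact Prod.ext (hU' hp.1 hq.1 (congrArg Prod.fst h)) (hV' hp.2 hq.2 (congrArg Prod.snd h))

end Prod

section TorusExp

variable {ι M N : Type*} [AddCommGroup M] [Module ℂ M] [NormedAddCommGroup N] [NormedSpace ℂ N]
  (P : RootPairing ι ℂ M N)

theorem char_torusExp (φ : P.rootSpan ℤ) (u : N) :
    ((torusExp P u).char φ : ℂ) = Complex.exp (P.toLinearMap (φ : M) u) := rfl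

theorem char_mul_torusExp (φ : P.rootSpan ℤ) (h : AdjointTorus P) (u : N) :
    ((h * torusExp P u).char φ : ℂ) = h.char φ * Complex.exp (P.toLinearMap (φ : M) u) := by
  rw [AdjointTorus.char_mul, Units.val_mul, char_torusExp]

variable {P}

theorem AdjointTorus.ext_char {g h : AdjointTorus P} (H : ∀ φ, g.char φ = h.char φ) : g = h :=
  MonoidHom.ext fun φ => H φ.toAdd

theorem AdjointTorus.continuous_char (φ : P.rootSpan ℤ) :
    Continuous fun h : AdjointTorus P => h.char φ :=
  (continuous_apply φ).comp continuous_induced_dom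

theorem AdjointTorus.char_sum_zsmul {J : Type*} [Fintype J] (β : J → P.rootSpan ℤ) (c : J → ℤ)
    (h : AdjointTorus P) : h.char (∑ j, c j • β j) = ∏ j, h.char (β j) ^ c j := by
  let f : Multiplicative (P.rootSpan ℤ) →* ℂˣ := h
  change f (Multiplicative.ofAdd (∑ j, c j • β j)) = ∏ j, f (Multiplicative.ofAdd (β j)) ^ c j
  rw [ofAdd_sum, map_prod]
  simp [ofAdd_zsmul]

section Base

variable (β : P.Base)

/-- The coordinates of the torus given by the simple roots. -/
noncomputable def simpleCharacters (h : AdjointTorus P) (j : β.support) : ℂˣ :=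
  h.char (β.toWeightBasisInt j)

theorem char_eq_prod_simpleCharacters (h : AdjointTorus P) (φ : P.rootSpan ℤ) :
    h.char φ = ∏ j, simpleCharacters β h j ^ (β.toWeightBasisInt.repr φ j) := by
  conv_lhs => rw [← β.toWeightBasisInt.sum_repr φ]
  exact AdjointTorus.char_sum_zsmul _ _ h

theorem simpleCharacters_injective : Function.Injective (simpleCharacters (P := P) β) := by
  intro g h hgh
  refine AdjointTorus.ext_char fun φ => ?_
  rw [char_eq_prod_simpleCharacters β, char_eq_prod_simpleCharacters β, hgh]

/-- The simple roots are a ℤ-basis of the root lattice, so every character is a Laurent monomial in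
the simple ones and is continuous for the topology that they induce. -/
theorem isInducing_simpleCharacters : IsInducing (simpleCharacters (P := P) β) := by
  refine ⟨le_antisymm ?_ ?_⟩
  · exact continuous_iff_le_induced.1
      (continuous_pi fun j => AdjointTorus.continuous_char (β.toWeightBasisInt j))
  · let Φ : (β.support → ℂˣ) → P.rootSpan ℤ → ℂˣ := fun t φ =>
      ∏ j, t j ^ (β.toWeightBasisInt.repr φ j)
    have hΦ : Continuous Φ := continuous_pi fun φ =>
      continuous_finsetProd _ fun j _ => (continuous_apply j).zpow _
    have : (fun (h : AdjointTorus P) (φ : P.rootSpan ℤ) => h.char φ) =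
        Φ ∘ simpleCharacters β := by
      funext h φ
      exact char_eq_prod_simpleCharacters β h φ
    change _ ≤ TopologicalSpace.induced (fun (h : AdjointTorus P) φ => h.char φ) _
    rw [this, ← induced_compose]
    exact induced_mono (continuous_iff_le_induced.1 hΦ)

variable [P.IsRootSystem]

/-- The coordinates of the Lie algebra given by the simple roots. -/
noncomputable def simpleCoordinates : N ≃ₗ[ℂ] (β.support → ℂ) :=
  P.toLinearMap.flip.toPerfPair.trans (β.toWeightBasis.constr ℂ).symm

theorem simpleCoordinates_apply (u : N) (j : β.support) :
    simpleCoordinates β u j = P.toLinearMap (P.root j) u := by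
  rw [← β.toWeightBasis_apply]
  rfl

include β in
theorem isLieExp_torusExp_of_base : IsLieExp (torusExp P) := by
  have : FiniteDimensional ℂ N := Module.Finite.equiv (simpleCoordinates β).symm
  let L : N ≃L[ℂ] (β.support → ℂ) := (simpleCoordinates β).toContinuousLinearEquiv
  let ex : ℂ → ℂˣ := fun s => Units.mk0 (Complex.exp s) (Complex.exp_ne_zero s)
  have hL : ∀ x u, simpleCharacters β (x * torusExp P u) =
      Pi.map (fun j s => simpleCharacters β x j * ex s) (L u) := by
    intro x u
    funext j
    ext
    refine (char_mul_torusExp P (β.toWeightBasisInt j) x u).trans ?_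
    rw [β.coe_toWeightBasisInt_apply]
    exact congrArg (fun z => _ * Complex.exp z) (simpleCoordinates_apply β u j).symm
  refine ⟨fun u v => AdjointTorus.ext_char fun φ => ?_, fun x => ?_, ?_⟩
  · ext
    rw [AdjointTorus.char_mul, Units.val_mul]
    simp only [char_torusExp, map_add, Complex.exp_add]
  · have h1 : Filter.map (simpleCharacters β) (Filter.map (fun u => x * torusExp P u) (𝓝 0)) =
        𝓝 (simpleCharacters β x) := by
      rw [Filter.map_map]
      have : simpleCharacters β ∘ (fun u => x * torusExp P u) =
          Pi.map (fun j s => simpleCharacters β x j * ex s) ∘ L := funext (hL x)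
      rw [this, ← Filter.map_map]
      have h2 : Filter.map L (𝓝 0) = 𝓝 0 := by
        have := L.toHomeomorph.map_nhds_eq 0
        simpa using this
      rw [h2, nhds_pi, nhds_pi, map_piMap_pi_finite]
      congr 1
      funext j
      exact isLieExp_units.map_nhds _
    -- The coordinates are injective and inducing, so the neighbourhoods of x are recovered from
    -- those of its image.
    rw [(isInducing_simpleCharacters β).nhds_eq_comap, ← h1,
      Filter.comap_map (simpleCharacters_injective β)]
  · obtain ⟨V, hV, hV'⟩ := isLieExp_units.injOn
    refine ⟨L ⁻¹' (Set.univ.pi fun _ => V), ?_, fun u hu v hv huv => ?_⟩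
    · refine L.continuous.continuousAt.preimage_mem_nhds (set_pi_mem_nhds Set.finite_univ ?_)
      intro j _
      simpa using hV
    · refine L.injective (funext fun j => hV' (hu j trivial) (hv j trivial) ?_)
      have h1 := congrFun (hL 1 u) j
      rw [huv, hL] at h1
      exact (mul_left_cancel h1).symm

end Base

variable [Finite ι] [P.IsRootSystem] [P.IsCrystallographic] [P.IsReduced]

theorem isLieExp_torusExp : IsLieExp (torusExp P) :=
  isLieExp_torusExp_of_base P.nonempty_base.some

omit [P.IsRootSystem] [P.IsCrystallographic] [P.IsReduced] in
theorem isOpen_mirrorComplement : IsOpen (mirrorComplement P) := by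
  have : mirrorComplement P = ⋂ i, {h : AdjointTorus P | h.char (P.rootSpanMem ℤ i) ≠ 1} := by
    ext
    simp [mirrorComplement]
  rw [this]
  exact isOpen_iInter_of_finite fun i =>
    isOpen_ne.preimage (AdjointTorus.continuous_char (P.rootSpanMem ℤ i))

end TorusExp

/-! ### The derivative of the tensor on the torus -/

section SpecialFormDeriv

variable {ι M N : Type*} [AddCommGroup M] [Module ℂ M] [NormedAddCommGroup N]
  [NormedSpace ℂ N] [FiniteDimensional ℂ N] {P : RootPairing ι ℂ M N} {k : ι → ℂ}
  {b : N →ₗ[ℂ] N →ₗ[ℂ] N}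

theorem hasFDerivAt_charCoth {h : AdjointTorus P} {i : ι}
    (hi : h.char (P.rootSpanMem ℤ i) ≠ 1) :
    ∃ c : ℂ, HasFDerivAt (fun u => charCoth (h * torusExp P u) (P.rootSpanMem ℤ i))
      (c • LinearMap.toContinuousLinearMap (P.root' i)) 0 := by
  let z : ℂ := ((h.char (P.rootSpanMem ℤ i) : ℂˣ) : ℂ)
  have hz1 : z ≠ 1 := fun h => hi (Units.ext h)
  have h1 : HasDerivAt (fun s => (z * Complex.exp s + 1) / (z * Complex.exp s - 1))
      (deriv (fun s => (z * Complex.exp s + 1) / (z * Complex.exp s - 1)) 0) (P.root' i 0) := by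
    rw [map_zero]
    refine DifferentiableAt.hasDerivAt ?_
    refine DifferentiableAt.div (by fun_prop) (by fun_prop) ?_
    rw [Complex.exp_zero, mul_one]
    exact sub_ne_zero.2 hz1
  refine ⟨_, (h1.comp_hasFDerivAt (0 : N)
    (LinearMap.toContinuousLinearMap (P.root' i)).hasFDerivAt).congr_of_eventuallyEq ?_⟩
  refine Eventually.of_forall fun u => ?_
  simp only [charCoth, char_mul_torusExp]
  rfl

/-- The i-th coefficient depends on u only through α_i(u). The numbers `c i` do not depend on Y and
Z, so the derivative is symmetric in X, Y and Z, which makes Γ closed. -/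
theorem hasFDerivAt_specialForm [Fintype ι] {h : AdjointTorus P} (hh : h ∈ mirrorComplement P) :
    ∃ c : ι → ℂ, ∀ Y Z : N, HasFDerivAt (fun u => specialForm P k b (h * torusExp P u) Y Z)
      (∑ i, (c i * P.root' i Y * P.root' i Z) •
        (LinearMap.toContinuousLinearMap (P.root' i)).smulRight (P.coroot i)) 0 := by
  choose c hc using fun i => hasFDerivAt_charCoth (hh i)
  refine ⟨fun i => 1 / 4 * k i * c i, fun Y Z => ?_⟩
  simp only [specialForm_apply]
  have h1 := ((HasFDerivAt.fun_sum (u := Finset.univ) fun i _ =>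
    (((hc i).const_mul (k i)).mul_const (P.root' i Y * P.root' i Z)).smul_const
      (P.coroot i)).const_smul (1 / 4 : ℂ)).add_const (b Y Z)
  refine (h1.congr_of_eventuallyEq (Eventually.of_forall fun u => ?_)).congr_fderiv ?_
  · simp only [mul_assoc]
    rfl
  · ext X
    simp only [smul_apply, sum_apply, Finset.smul_sum,
      ContinuousLinearMap.smulRight_apply, smul_smul, smul_eq_mul]
    refine Finset.sum_congr rfl fun i _ => ?_
    congr 1
    ring

theorem isHolAt_specialForm [Fintype ι] {h : AdjointTorus P} (hh : h ∈ mirrorComplement P)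
    (Y Z : N) : IsHolAt (torusExp P) (fun g => specialForm P k b g Y Z) h :=
  ((hasFDerivAt_specialForm hh).choose_spec Y Z).differentiableAt

theorem invDeriv_specialForm_comm [Fintype ι] {h : AdjointTorus P} (hh : h ∈ mirrorComplement P)
    (X Y Z : N) : invDeriv (torusExp P) (fun g => specialForm P k b g Y Z) h X =
      invDeriv (torusExp P) (fun g => specialForm P k b g X Z) h Y := by
  obtain ⟨c, hc⟩ := hasFDerivAt_specialForm (k := k) (b := b) hh
  rw [invDeriv, (hc Y Z).fderiv, invDeriv, (hc X Z).fderiv]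
  simp only [sum_apply, smul_apply, ContinuousLinearMap.smulRight_apply,
    smul_smul, LinearMap.coe_toContinuousLinearMap']
  refine Finset.sum_congr rfl fun i _ => ?_
  congr 1
  ring

end SpecialFormDeriv


/-! ### The cone of a projective connection -/

section Cone

variable {E : Type*} [NormedAddCommGroup E] [NormedSpace ℂ E]

/-- The tensor on `E × ℂ` associated with a tensor `γ` and a bilinear form `a` on `E`. -/
noncomputable def coneForm (γ : E →ₗ[ℂ] E →ₗ[ℂ] E) (a : LinearMap.BilinForm ℂ E) :
    (E × ℂ) →ₗ[ℂ] (E × ℂ) →ₗ[ℂ] (E × ℂ) :=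
  LinearMap.mk₂ ℂ
    (fun p q => (γ p.1 q.1 - q.2 • p.1 - p.2 • q.1, a p.1 q.1 - p.2 * q.2))
    (by
      intro p p' q
      ext
      · simp [add_smul]; abel
      · simp; ring)
    (by
      intro c p q
      ext
      · simp [smul_sub, mul_smul, smul_comm c q.2]
      · simp; ring)
    (by
      intro p q q'
      ext
      · simp [add_smul]; abel
      · simp; ring)
    (by
      intro c p q
      ext
      · simp [smul_sub, mul_smul, smul_comm c p.2]
      · simp; ring)

theorem coneForm_apply (γ : E →ₗ[ℂ] E →ₗ[ℂ] E) (a : LinearMap.BilinForm ℂ E) (p q : E × ℂ) :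
    coneForm γ a p q = (γ p.1 q.1 - q.2 • p.1 - p.2 • q.1, a p.1 q.1 - p.2 * q.2) := rfl

theorem coneForm_comm {γ : E →ₗ[ℂ] E →ₗ[ℂ] E} {a : LinearMap.BilinForm ℂ E}
    (hγ : ∀ u v, γ u v = γ v u) (ha : ∀ u v, a u v = a v u) (p q : E × ℂ) :
    coneForm γ a p q = coneForm γ a q p := by
  rw [coneForm_apply, coneForm_apply, hγ, ha, mul_comm]
  ext
  · simp; abel
  · simp

/-- The component in E is [γ_u, γ_v] w minus the rotation defined by a, and the component in ℂ is
a(u, γ_v w) - a(v, γ_u w); all terms that contain ℂ-coordinates cancel by symmetry. -/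
theorem curvOp_coneForm {γ : E →ₗ[ℂ] E →ₗ[ℂ] E} {a : LinearMap.BilinForm ℂ E}
    (hγ : ∀ u v, γ u v = γ v u) (ha : ∀ u v, a u v = a v u)
    (hcurv : ∀ u v w, curvOp γ u v w = rotOp a u v w)
    (hcompat : ∀ u v w, a u (γ v w) = a v (γ u w)) (p q r : E × ℂ) :
    curvOp (coneForm γ a) p q r = 0 := by
  have h1 := hcurv p.1 q.1 r.1
  have h2 := hcompat p.1 q.1 r.1
  rw [curvOp, rotOp] at h1
  rw [curvOp]
  simp only [coneForm_apply, map_sub, map_smul]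
  ext
  · simp only [Prod.mk_sub_mk, Prod.fst_zero, hγ q.1 p.1]
    have h3 : γ p.1 (γ q.1 r.1) = a q.1 r.1 • p.1 - a p.1 r.1 • q.1 + γ q.1 (γ p.1 r.1) := by
      rw [← h1]; abel
    rw [h3]
    module
  · simp only [Prod.mk_sub_mk, Prod.snd_zero, smul_eq_mul, h2, ha q.1 p.1]
    ring

end Cone

/-! ### Linear systems for frames -/

section Frames

variable {E V : Type*} [NormedAddCommGroup E] [NormedSpace ℂ E]
  [NormedAddCommGroup V] [NormedSpace ℂ V] [FiniteDimensional ℂ V]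

/-- The map `X ↦ T ∘ A X`. -/
noncomputable def gaugeDeriv (A : E →L[ℂ] V →L[ℂ] V) (T : V →L[ℂ] V) : E →L[ℂ] V →L[ℂ] V :=
  (ContinuousLinearMap.mul ℂ (V →L[ℂ] V) T).comp A

theorem exists_fundamental_frame [FiniteDimensional ℂ E] {A : E → E →L[ℂ] V →L[ℂ] V}
    (hA : ∀ᶠ u in 𝓝 (0 : E), DifferentiableAt ℂ A u)
    (hflat : ∀ᶠ u in 𝓝 (0 : E), ∀ X Y v,
      fderiv ℂ A u X Y v - fderiv ℂ A u Y X v + A u X (A u Y v) - A u Y (A u X v) = 0) :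
    ∃ Θ : E → V →L[ℂ] V, (∀ v, Θ 0 v = v) ∧ ∀ᶠ u in 𝓝 (0 : E),
      HasFDerivAt Θ (gaugeDeriv (A u) (Θ u)) u := by
  obtain ⟨Θ, hΘ0, hΘ⟩ := exists_fundamental_solution hA (by
    filter_upwards [hflat] with u hu X Y
    exact ContinuousLinearMap.ext fun v => hu X Y v)
  exact ⟨Θ, fun v => by rw [hΘ0]; rfl, hΘ⟩

theorem exists_linearEquiv_frame {A : E → E →L[ℂ] V →L[ℂ] V} {Θ Ω : E → V →L[ℂ] V}
    (hΘ : ∀ᶠ u in 𝓝 (0 : E), HasFDerivAt Θ (gaugeDeriv (A u) (Θ u)) u)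
    (hΩ : ∀ᶠ u in 𝓝 (0 : E), HasFDerivAt Ω (gaugeDeriv (A u) (Ω u)) u)
    (hΘ0 : Function.Bijective (Θ 0)) (hΩ0 : Function.Bijective (Ω 0)) :
    ∃ L : V ≃L[ℂ] V, ∀ᶠ u in 𝓝 (0 : E), ∀ v, Ω u v = L (Θ u v) := by
  have : CompleteSpace V := FiniteDimensional.complete ℂ V
  have h1 : IsUnit (Θ 0) := ContinuousLinearMap.isUnit_iff_bijective.2 hΘ0
  have h2 : IsUnit (Ω 0) := ContinuousLinearMap.isUnit_iff_bijective.2 hΩ0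
  have hT : IsUnit (Ω 0 * Ring.inverse (Θ 0)) := h2.mul h1.ringInverse
  refine ⟨(LinearEquiv.ofBijective ((Ω 0 * Ring.inverse (Θ 0) : V →L[ℂ] V) : V →ₗ[ℂ] V)
    (ContinuousLinearMap.isUnit_iff_bijective.1 hT)).toContinuousLinearEquiv, ?_⟩
  filter_upwards [eventually_eq_mul_fundamental_solution hΘ hΩ h1] with u hu v
  exact congrArg (fun S : V →L[ℂ] V => S v) hu

end Frames

/-! ### Local solutions -/

section LocalSolutions

variable {E V W : Type*} [NormedAddCommGroup E] [NormedSpace ℂ E] [FiniteDimensional ℂ E]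
  [NormedAddCommGroup V] [NormedSpace ℂ V] [FiniteDimensional ℂ V]
  [NormedAddCommGroup W] [NormedSpace ℂ W] [FiniteDimensional ℂ W]

/-- A bilinear map on finite dimensional spaces as a continuous one. -/
noncomputable def toCLM₂ (γ : E →ₗ[ℂ] V →ₗ[ℂ] W) : E →L[ℂ] V →L[ℂ] W :=
  LinearMap.toContinuousLinearMap
    ((LinearMap.toContinuousLinearMap : (V →ₗ[ℂ] W) ≃ₗ[ℂ] (V →L[ℂ] W)).toLinearMap ∘ₗ γ)

/-- The frame `(X, c) ↦ T X + c v`. -/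
noncomputable def coneFrame (T : E →L[ℂ] V) (v : V) : (E × ℂ) →L[ℂ] V :=
  T.comp (ContinuousLinearMap.fst ℂ E ℂ) + (ContinuousLinearMap.snd ℂ E ℂ).smulRight v

omit [FiniteDimensional ℂ E] [FiniteDimensional ℂ V] in
theorem coneFrame_apply (T : E →L[ℂ] V) (v : V) (p : E × ℂ) :
    coneFrame T v p = T p.1 + p.2 • v := rfl

/-- Near `0`, the function `f` solves `∇(df) + f a = 0`. -/
def IsLocalSol (γ : E → E →ₗ[ℂ] E →ₗ[ℂ] E) (a : LinearMap.BilinForm ℂ E) (f : E → V) : Prop :=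
  ∀ᶠ u in 𝓝 (0 : E), DifferentiableAt ℂ f u ∧ ∀ X Y,
    fderiv ℂ (fun v => fderiv ℂ f v Y) u X + fderiv ℂ f u (γ u X Y) + a X Y • f u = 0

/-- The coefficient of the linear system satisfied by the frame of a solution. -/
noncomputable def coneGauge (γ : E →ₗ[ℂ] E →ₗ[ℂ] E) (a : LinearMap.BilinForm ℂ E) :
    E →L[ℂ] (E × ℂ) →L[ℂ] (E × ℂ) :=
  toCLM₂ (-(coneForm γ a ∘ₗ LinearMap.inl ℂ E ℂ))

theorem coneGauge_apply (γ : E →ₗ[ℂ] E →ₗ[ℂ] E) (a : LinearMap.BilinForm ℂ E) (X : E)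
    (q : E × ℂ) : coneGauge γ a X q = -coneForm γ a (X, 0) q := rfl

theorem coneGauge_apply' (γ : E →ₗ[ℂ] E →ₗ[ℂ] E) (a : LinearMap.BilinForm ℂ E) (X : E)
    (q : E × ℂ) : coneGauge γ a X q = (q.2 • X - γ X q.1, -a X q.1) := by
  rw [coneGauge_apply, coneForm_apply]
  ext <;> simp

/-- This turns the second order equation for f into a first order linear system for the frame (df,
f), to which the uniqueness of solutions applies. -/
theorem IsLocalSol.hasFDerivAt_coneFrame {γ : E → E →ₗ[ℂ] E →ₗ[ℂ] E}
    {a : LinearMap.BilinForm ℂ E} {f : E → E × ℂ} (hf : IsLocalSol γ a f) :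
    ∀ᶠ u in 𝓝 (0 : E), HasFDerivAt (fun u => coneFrame (fderiv ℂ f u) (f u))
      (gaugeDeriv (coneGauge (γ u) a) (coneFrame (fderiv ℂ f u) (f u))) u := by
  filter_upwards [hf.eventually_nhds] with u hu
  have h1 : DifferentiableAt ℂ (fderiv ℂ f) u :=
    differentiableAt_fderiv_of_eventually (hu.mono fun _ h => h.1)
  have h2 := hu.self_of_nhds
  have h3 : ∀ q : E × ℂ, HasFDerivAt (fun u => coneFrame (fderiv ℂ f u) (f u) q)
      ((fderiv ℂ (fun v => fderiv ℂ f v q.1) u) + q.2 • fderiv ℂ f u) u := fun q =>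
    (h1.clm_apply (differentiableAt_const q.1)).hasFDerivAt.add
      (h2.1.hasFDerivAt.const_smul q.2)
  refine hasFDerivAt_clm_of_apply (fun q => (h3 q).differentiableAt) fun q X => ?_
  rw [(h3 q).fderiv]
  change _ = coneFrame (fderiv ℂ f u) (f u) (coneGauge (γ u) a X q)
  rw [coneGauge_apply', coneFrame_apply]
  have h4 := h2.2 X q.1
  simp only [add_apply, smul_apply, map_sub, map_smul, neg_smul]
  have h5 := eq_neg_of_add_eq_zero_left ((add_assoc _ _ _).symm.trans h4)
  rw [h5]
  abel

theorem IsLocalSol.exists_linearEquiv {γ : E → E →ₗ[ℂ] E →ₗ[ℂ] E} {a : LinearMap.BilinForm ℂ E}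
    {f g : E → E × ℂ} (hf : IsLocalSol γ a f) (hg : IsLocalSol γ a g)
    (hf0 : Function.Bijective fun p : E × ℂ => fderiv ℂ f 0 p.1 + p.2 • f 0)
    (hg0 : Function.Bijective fun p : E × ℂ => fderiv ℂ g 0 p.1 + p.2 • g 0) :
    ∃ L : (E × ℂ) ≃ₗ[ℂ] (E × ℂ), ∀ᶠ u in 𝓝 (0 : E), g u = L (f u) := by
  obtain ⟨L, hL⟩ := exists_linearEquiv_frame hf.hasFDerivAt_coneFrame hg.hasFDerivAt_coneFrame
    hf0 hg0
  refine ⟨L.toLinearEquiv, ?_⟩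
  filter_upwards [hL] with u hu
  -- The vector (0, 1) extracts the function from its frame.
  have h4 := hu (0, 1)
  simp only [coneFrame_apply, map_zero, one_smul, zero_add] at h4
  exact h4

omit [FiniteDimensional ℂ E] in
theorem differentiableAt_coneForm {γ : E → E →ₗ[ℂ] E →ₗ[ℂ] E} {a : LinearMap.BilinForm ℂ E}
    {u : E} {p q : E × ℂ} (h : DifferentiableAt ℂ (fun v => γ v p.1 q.1) u) :
    DifferentiableAt ℂ (fun v => coneForm (γ v) a p q) u ∧
      ∀ X, fderiv ℂ (fun v => coneForm (γ v) a p q) u X =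
        (fderiv ℂ (fun v => γ v p.1 q.1) u X, 0) := by
  simp only [coneForm_apply]
  have h1 := (((h.hasFDerivAt.sub_const (q.2 • p.1)).sub_const (p.2 • q.1)).prodMk
    (hasFDerivAt_const (a p.1 q.1 - p.2 * q.2) u))
  refine ⟨h1.differentiableAt, fun X => ?_⟩
  rw [h1.fderiv]
  rfl

/-- Flatness of the cone is the integrability of the system of frames. For a fundamental solution Θ
let f = Θ(0, 1). In the direction X the coefficient maps (0, 1) to (X, 0), so df(X) = Θ(X, 0): Θ is
the frame of f, and its system is the equation for f. -/
theorem exists_isLocalSol {γ : E → E →ₗ[ℂ] E →ₗ[ℂ] E} {a : LinearMap.BilinForm ℂ E}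
    (ha : ∀ u v, a u v = a v u)
    (hγ : ∀ᶠ u in 𝓝 (0 : E), (∀ Y Z, DifferentiableAt ℂ (fun v => γ v Y Z) u) ∧
      (∀ Y Z, γ u Y Z = γ u Z Y) ∧
      (∀ X Y Z, fderiv ℂ (fun v => γ v Y Z) u X = fderiv ℂ (fun v => γ v X Z) u Y) ∧
      (∀ X Y Z, curvOp (γ u) X Y Z = rotOp a X Y Z) ∧
      ∀ X Y Z, a X (γ u Y Z) = a Y (γ u X Z)) :
    ∃ f : E → E × ℂ, IsLocalSol γ a f ∧ ∀ p : E × ℂ, fderiv ℂ f 0 p.1 + p.2 • f 0 = p := by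
  have hA : ∀ᶠ u in 𝓝 (0 : E), DifferentiableAt ℂ (fun v => coneGauge (γ v) a) u := by
    filter_upwards [hγ] with u hu
    refine differentiableAt_clm_of_apply fun Y => differentiableAt_clm_of_apply fun q => ?_
    exact (differentiableAt_coneForm (p := (Y, 0)) (q := q) (hu.1 Y q.1)).1.neg
  have hA' : ∀ᶠ u in 𝓝 (0 : E), ∀ X Y q, fderiv ℂ (fun v => coneGauge (γ v) a) u X Y q =
      -(fderiv ℂ (fun v => γ v Y q.1) u X, 0) := by
    filter_upwards [hγ, hA] with u hu hAu X Y q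
    have h1 := differentiableAt_coneForm (a := a) (p := (Y, 0)) (q := q) (hu.1 Y q.1)
    rw [← fderiv_clm_apply_const hAu, ← fderiv_clm_apply_const
      (hAu.clm_apply (differentiableAt_const Y)), ← h1.2]
    simp only [coneGauge_apply]
    rw [fderiv_fun_neg]
    rfl
  obtain ⟨Θ, hΘ0, hΘ⟩ := exists_fundamental_frame hA (by
    filter_upwards [hγ, hA'] with u hu hAu X Y q
    have h1 := curvOp_coneForm hu.2.1 ha hu.2.2.2.1 hu.2.2.2.2 (X, 0) (Y, 0) q
    rw [curvOp] at h1
    simp only [hAu, hu.2.2.1 X Y, coneGauge_apply, map_neg, neg_neg, sub_self, zero_add]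
    exact h1)
  have hd : ∀ᶠ u in 𝓝 (0 : E), ∀ q, HasFDerivAt (fun v => Θ v q)
      ((ContinuousLinearMap.apply ℂ (E × ℂ) q).comp
        (gaugeDeriv (coneGauge (γ u) a) (Θ u))) u := by
    filter_upwards [hΘ] with u hu q
    exact (ContinuousLinearMap.apply ℂ (E × ℂ) q).hasFDerivAt.comp u hu
  have hd1 : ∀ᶠ u in 𝓝 (0 : E), DifferentiableAt ℂ (fun v => Θ v (0, 1)) u ∧
      ∀ X, fderiv ℂ (fun v => Θ v (0, 1)) u X = Θ u (X, 0) := by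
    filter_upwards [hd] with u hu
    refine ⟨(hu _).differentiableAt, fun X => ?_⟩
    rw [(hu _).fderiv]
    change Θ u (coneGauge (γ u) a X (0, 1)) = _
    simp [coneGauge_apply']
  refine ⟨fun u => Θ u (0, 1), ?_, fun p => ?_⟩
  · filter_upwards [hd, hd1.eventually_nhds] with u hu hu1
    refine ⟨hu1.self_of_nhds.1, fun X Y => ?_⟩
    have h1 : (fun v => fderiv ℂ (fun w => Θ w (0, 1)) v Y) =ᶠ[𝓝 u] fun v => Θ v (Y, 0) :=
      hu1.mono fun v hv => hv.2 Y
    rw [h1.fderiv_eq, (hu _).fderiv, hu1.self_of_nhds.2]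
    change Θ u (coneGauge (γ u) a X (Y, 0)) + _ + _ = 0
    rw [coneGauge_apply', ← map_smul, ← map_add, ← map_add]
    simp [← Prod.zero_eq_mk]
  · rw [hd1.self_of_nhds.2, hΘ0]
    beta_reduce
    rw [hΘ0]
    simp

/-- Near `0`, the function `f` solves `∇(df) = 0`. -/
def IsLocalAffine (γ : E → E →ₗ[ℂ] E →ₗ[ℂ] E) (f : E → V) : Prop :=
  ∀ᶠ u in 𝓝 (0 : E), DifferentiableAt ℂ f u ∧ ∀ X Y,
    fderiv ℂ (fun v => fderiv ℂ f v Y) u X + fderiv ℂ f u (γ u X Y) = 0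

theorem IsLocalAffine.hasFDerivAt_fderiv {γ : E → E →ₗ[ℂ] E →ₗ[ℂ] E} {f : E → E}
    (hf : IsLocalAffine γ f) :
    ∀ᶠ u in 𝓝 (0 : E), HasFDerivAt (fderiv ℂ f)
      (gaugeDeriv (toCLM₂ (-γ u)) (fderiv ℂ f u)) u := by
  filter_upwards [hf.eventually_nhds] with u hu
  have h1 : DifferentiableAt ℂ (fderiv ℂ f) u :=
    differentiableAt_fderiv_of_eventually (hu.mono fun _ h => h.1)
  refine hasFDerivAt_clm_of_apply (fun q => h1.clm_apply (differentiableAt_const q)) fun q X => ?_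
  change _ = fderiv ℂ f u (-γ u X q)
  rw [map_neg]
  exact eq_neg_of_add_eq_zero_left (hu.self_of_nhds.2 X q)

/-- The differentials solve the same linear system and give the linear part L; then g - L f has
derivative zero and is the translation. -/
theorem IsLocalAffine.exists_affineEquiv {γ : E → E →ₗ[ℂ] E →ₗ[ℂ] E} {f g : E → E}
    (hf : IsLocalAffine γ f) (hg : IsLocalAffine γ g)
    (hf0 : Function.Bijective (fderiv ℂ f 0)) (hg0 : Function.Bijective (fderiv ℂ g 0)) :
    ∃ A : E ≃ᵃ[ℂ] E, ∀ᶠ u in 𝓝 (0 : E), g u = A (f u) := by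
  obtain ⟨L, hL⟩ := exists_linearEquiv_frame hf.hasFDerivAt_fderiv hg.hasFDerivAt_fderiv hf0 hg0
  have h4 : ∀ᶠ u in 𝓝 (0 : E), HasFDerivAt (fun u => g u - L (f u)) (0 : E →L[ℂ] E) u := by
    filter_upwards [hf, hg, hL] with u hfu hgu hu
    refine (hgu.1.hasFDerivAt.sub (L.toContinuousLinearMap.hasFDerivAt.comp u
      hfu.1.hasFDerivAt)).congr_fderiv ?_
    ext v
    exact sub_eq_zero.2 (hu v)
  refine ⟨L.toLinearEquiv.toAffineEquiv.trans (AffineEquiv.constVAdd ℂ E (g 0 - L (f 0))), ?_⟩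
  filter_upwards [eventually_eq_of_eventually_hasFDerivAt_zero h4] with u hu
  change g u = (g 0 - L (f 0)) + L (f u)
  rw [← hu, sub_add_cancel]

end LocalSolutions


/-! ### Second derivatives of vector valued functions -/

section Hess

variable {E G V W : Type*} [NormedAddCommGroup E] [NormedSpace ℂ E] [CommGroup G]
  [TopologicalSpace G] [NormedAddCommGroup V] [NormedSpace ℂ V]
  [NormedAddCommGroup W] [NormedSpace ℂ W]

/-- The bilinear map `∇(dF)` for a vector valued function `F`. -/
noncomputable def hess (e : E → G) (Γ : G → E →ₗ[ℂ] E →ₗ[ℂ] E) (F : G → V) (x : G) (X Y : E) : V :=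
  invDeriv e (fun z => invDeriv e F z Y) x X + invDeriv e F x (Γ x X Y)

/-- Near `x`, the function `F` solves `∇(dF) + F a = 0`. -/
def IsSolNear (e : E → G) (Γ : G → E →ₗ[ℂ] E →ₗ[ℂ] E) (a : LinearMap.BilinForm ℂ E) (F : G → V)
    (x : G) : Prop :=
  ∀ᶠ y in 𝓝 x, IsHolAt e F y ∧ ∀ X Y, hess e Γ F y X Y + a X Y • F y = 0

/-- The function `(x, t) ↦ t F(x)`. -/
def coneFun (F : G → V) (z : G × ℂˣ) : V := (z.2 : ℂ) • F z.1

variable {e : E → G} (he : IsLieExp e) {Γ : G → E →ₗ[ℂ] E →ₗ[ℂ] E} {a : LinearMap.BilinForm ℂ E}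
include he

omit [NormedSpace ℂ E] [NormedAddCommGroup W] [NormedSpace ℂ W] in
-- This transports the local solutions from the Lie algebra to the group, by a local inverse of the
-- exponential map.
theorem IsLieExp.exists_comp (x : G) (f : E → W) :
    ∃ F : G → W, ∀ᶠ u in 𝓝 (0 : E), F (x * e u) = f u := by
  obtain ⟨U, hU, hinj⟩ := he.injOn
  refine ⟨fun y => f (Function.invFunOn (fun u => x * e u) U y), ?_⟩
  filter_upwards [hU] with u hu
  have hinj' : Set.InjOn (fun u => x * e u) U := fun u hu v hv h => hinj hu hv (mul_left_cancel h)
  exact congrArg f (hinj'.leftInvOn_invFunOn hu)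

theorem isSolNear_iff {F : G → V} {x : G} :
    IsSolNear e Γ a F x ↔ IsLocalSol (fun u => Γ (x * e u)) a (fun u => F (x * e u)) := by
  simp only [IsSolNear, IsLocalSol, he.eventually_iff (x := x), he.isHolAt_mul_iff, hess,
    he.invDeriv_mul]

theorem hess_congr {F F' : G → V} {x : G} (h : F =ᶠ[𝓝 x] F') (X Y : E) :
    hess e Γ F x X Y = hess e Γ F' x X Y := by
  have h1 : (fun z => invDeriv e F z Y) =ᶠ[𝓝 x] fun z => invDeriv e F' z Y := by
    filter_upwards [h.eventuallyEq_nhds] with z hz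
    rw [he.invDeriv_congr hz]
  rw [hess, hess, he.invDeriv_congr h1, he.invDeriv_congr h]

theorem isHolAt_invDeriv_apply [FiniteDimensional ℂ E] [FiniteDimensional ℂ V] {F : G → V} {x : G}
    (h : ∀ᶠ y in 𝓝 x, IsHolAt e F y) (Y : E) : IsHolAt e (fun z => invDeriv e F z Y) x :=
  (he.isHolAt_invDeriv h).clm_comp (ContinuousLinearMap.apply ℂ V Y)

theorem hess_clm_comp [FiniteDimensional ℂ E] [FiniteDimensional ℂ V] {F : G → V} {x : G}
    (h : ∀ᶠ y in 𝓝 x, IsHolAt e F y) (ℓ : V →L[ℂ] W) (X Y : E) :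
    hess e Γ (fun y => ℓ (F y)) x X Y = ℓ (hess e Γ F x X Y) := by
  have h1 : (fun z => invDeriv e (fun y => ℓ (F y)) z Y) =ᶠ[𝓝 x]
      fun z => ℓ (invDeriv e F z Y) := by
    filter_upwards [h] with z hz
    rw [hz.invDeriv_clm_comp]
    rfl
  rw [hess, hess, he.invDeriv_congr h1, (isHolAt_invDeriv_apply he h Y).invDeriv_clm_comp,
    h.self_of_nhds.invDeriv_clm_comp, map_add]
  rfl

theorem nabla_dForm_comp [FiniteDimensional ℂ E] [FiniteDimensional ℂ V] {F : G → V} {x : G}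
    (h : ∀ᶠ y in 𝓝 x, IsHolAt e F y) (ℓ : Module.Dual ℂ V) (X Y : E) :
    nabla e Γ (dForm e (fun y => ℓ (F y))) x X Y = ℓ (hess e Γ F x X Y) :=
  hess_clm_comp he h (LinearMap.toContinuousLinearMap ℓ) X Y

theorem isSolNear_of_forall_dual [FiniteDimensional ℂ E] [FiniteDimensional ℂ V] {F : G → V}
    {x : G} (h : ∀ᶠ y in 𝓝 x, IsHolAt e F y)
    (hF : ∀ ℓ : Module.Dual ℂ V, ∀ᶠ y in 𝓝 x, ∀ X Y : E,
      nabla e Γ (dForm e (fun z => ℓ (F z))) y X Y + ℓ (F y) * a X Y = 0) :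
    IsSolNear e Γ a F x := by
  let β := Module.finBasis ℂ V
  have h1 := eventually_all.2 fun i => hF (β.coord i)
  filter_upwards [h1, h.eventually_nhds] with y hy hy'
  refine ⟨hy'.self_of_nhds, fun X Y => β.ext_elem fun i => ?_⟩
  have h2 := hy i X Y
  rw [nabla_dForm_comp he hy'] at h2
  rw [map_add, map_smul, map_zero]
  simpa [mul_comm] using h2

theorem IsSolNear.forall_dual [FiniteDimensional ℂ E] [FiniteDimensional ℂ V] {F : G → V} {x : G}
    (h : IsSolNear e Γ a F x) (ℓ : Module.Dual ℂ V) : ∀ᶠ y in 𝓝 x, ∀ X Y : E,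
      nabla e Γ (dForm e (fun z => ℓ (F z))) y X Y + ℓ (F y) * a X Y = 0 := by
  filter_upwards [h.eventually_nhds] with y hy X Y
  rw [nabla_dForm_comp he (hy.mono fun _ h => h.1), mul_comm, ← smul_eq_mul, ← map_smul, ← map_add,
    hy.self_of_nhds.2, map_zero]

theorem IsSolNear.clm_comp [FiniteDimensional ℂ E] [FiniteDimensional ℂ V] {F : G → V} {x : G}
    (h : IsSolNear e Γ a F x) (ℓ : V →L[ℂ] W) : IsSolNear e Γ a (fun y => ℓ (F y)) x := by
  filter_upwards [h.eventually_nhds] with y hy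
  refine ⟨hy.self_of_nhds.1.clm_comp ℓ, fun X Y => ?_⟩
  rw [hess_clm_comp he (hy.mono fun _ h => h.1), ← map_smul, ← map_add, hy.self_of_nhds.2, map_zero]

omit he in
omit [TopologicalSpace G] in
theorem isHolAt_add {F F' : G → V} {x : G} (h : IsHolAt e F x) (h' : IsHolAt e F' x) :
    IsHolAt e (fun y => F y + F' y) x ∧
      invDeriv e (fun y => F y + F' y) x = invDeriv e F x + invDeriv e F' x :=
  ⟨DifferentiableAt.fun_add h h', fderiv_fun_add h h'⟩

omit he in
omit [TopologicalSpace G] in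
theorem isHolAt_const_smul {F : G → V} {x : G} (h : IsHolAt e F x) (c : ℂ) :
    IsHolAt e (fun y => c • F y) x ∧ invDeriv e (fun y => c • F y) x = c • invDeriv e F x :=
  ⟨DifferentiableAt.fun_const_smul h c, fderiv_fun_const_smul h c⟩

theorem isHolAt_coneFun {F : G → V} {z : G × ℂˣ} (h : IsHolAt e F z.1) :
    IsHolAt (expProd e) (coneFun F) z ∧ ∀ p, invDeriv (expProd e) (coneFun F) z p =
      (z.2 : ℂ) • (invDeriv e F z.1 p.1 + p.2 • F z.1) := by
  have h1 : HasFDerivAt (fun p : E × ℂ => (z.2 : ℂ) * Complex.exp p.2)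
      ((z.2 : ℂ) • (Complex.exp 0 • ContinuousLinearMap.snd ℂ E ℂ)) 0 :=
    (HasFDerivAt.cexp (f := fun p : E × ℂ => p.2) (x := 0) hasFDerivAt_snd).const_mul _
  have h2 : HasFDerivAt (fun p : E × ℂ => F (z.1 * e p.1))
      ((invDeriv e F z.1).comp (ContinuousLinearMap.fst ℂ E ℂ)) 0 :=
    HasFDerivAt.comp (g := fun u => F (z.1 * e u)) (0 : E × ℂ) h.hasFDerivAt hasFDerivAt_fst
  have h3 : HasFDerivAt (fun p : E × ℂ => coneFun F (z * expProd e p)) _ 0 := h1.smul h2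
  refine ⟨h3.differentiableAt, fun p => ?_⟩
  have h0 : z.1 * (expProd e 0).1 = z.1 := he.mul_map_zero z.1
  rw [invDeriv, h3.fderiv]
  simp [h0, smul_smul]

/-- Homogeneity of degree one in t takes care of the fibre direction, so only the equation for F
remains. Hence solutions on the base correspond to homogeneous affine-linear functions on the cone.
-/
theorem hess_coneFun [FiniteDimensional ℂ E] [FiniteDimensional ℂ V] {F : G → V} {z : G × ℂˣ}
    (h : ∀ᶠ y in 𝓝 z.1, IsHolAt e F y) (p q : E × ℂ) :
    hess (expProd e) (fun z => coneForm (Γ z.1) a) (coneFun F) z p q =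
      (z.2 : ℂ) • (hess e Γ F z.1 p.1 q.1 + a p.1 q.1 • F z.1) := by
  have hF := h.self_of_nhds
  have h1 := isHolAt_invDeriv_apply he h q.1
  have h2 := isHolAt_const_smul hF q.2
  have h3 := isHolAt_add h1 h2.1
  have h4 : (fun w => invDeriv (expProd e) (coneFun F) w q) =ᶠ[𝓝 z]
      coneFun fun y => invDeriv e F y q.1 + q.2 • F y := by
    have : ∀ᶠ w in 𝓝 z, IsHolAt e F w.1 := continuous_fst.continuousAt.eventually h
    filter_upwards [this] with w hw
    exact (isHolAt_coneFun he hw).2 q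
  rw [hess, (isLieExp_expProd he).invDeriv_congr h4, (isHolAt_coneFun he h3.1).2,
    (isHolAt_coneFun he hF).2, h3.2, h2.2, coneForm_apply, hess]
  simp only [add_apply, smul_apply, map_sub, map_smul]
  module

end Hess


/-! ### Local injectivity -/

section LocalInjectivity

theorem exists_injOn_of_bijective_fderiv {V W : Type*} [NormedAddCommGroup V] [NormedSpace ℂ V]
    [FiniteDimensional ℂ V] [NormedAddCommGroup W] [NormedSpace ℂ W] [FiniteDimensional ℂ W]
    {f : V → W} {x : V} (hf : ∀ᶠ u in 𝓝 x, DifferentiableAt ℂ f u)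
    (h : Function.Bijective (fderiv ℂ f x)) : ∃ U ∈ 𝓝 x, Set.InjOn f U := by
  have : CompleteSpace V := FiniteDimensional.complete ℂ V
  have hs : HasStrictFDerivAt f (fderiv ℂ f x) x :=
    hasStrictFDerivAt_of_hasFDerivAt_of_continuousAt
      (hf.mono fun u hu => hu.hasFDerivAt) (differentiableAt_fderiv_of_eventually hf).continuousAt
  let L : V ≃L[ℂ] W := (LinearEquiv.ofBijective (fderiv ℂ f x : V →ₗ[ℂ] W) h).toContinuousLinearEquiv
  have hL : (L : V →L[ℂ] W) = fderiv ℂ f x := by ext; rfl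
  rw [← hL] at hs
  exact ⟨_, (hs.toOpenPartialHomeomorph f).open_source.mem_nhds hs.mem_toOpenPartialHomeomorph_source,
    (hs.toOpenPartialHomeomorph f).injOn⟩

theorem eventually_bijective_of_continuousAt {X V : Type*} [TopologicalSpace X]
    [NormedAddCommGroup V] [NormedSpace ℂ V] [FiniteDimensional ℂ V] {T : X → V →L[ℂ] V} {x : X}
    (hT : ContinuousAt T x) (h : Function.Bijective (T x)) :
    ∀ᶠ y in 𝓝 x, Function.Bijective (T y) := by
  have : CompleteSpace V := FiniteDimensional.complete ℂ V
  have h5 : IsOpen {T : V →L[ℂ] V | IsUnit T} := Units.isOpen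
  filter_upwards [hT.eventually (h5.mem_nhds (ContinuousLinearMap.isUnit_iff_bijective.2 h))]
    with y hy
  exact ContinuousLinearMap.isUnit_iff_bijective.1 hy

theorem continuousAt_coneFrame {X E V : Type*} [NormedAddCommGroup E] [NormedSpace ℂ E]
    [NormedAddCommGroup V] [NormedSpace ℂ V] [TopologicalSpace X] {A : X → E →L[ℂ] V} {v : X → V}
    {x : X} (hA : ContinuousAt A x) (hv : ContinuousAt v x) :
    ContinuousAt (fun y => coneFrame (A y) (v y)) x :=
  (hA.clm_comp continuousAt_const).add
    ((ContinuousLinearMap.smulRightL ℂ (E × ℂ) V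
      (ContinuousLinearMap.snd ℂ E ℂ)).continuous.continuousAt.comp hv)

variable {E G V : Type*} [NormedAddCommGroup E] [NormedSpace ℂ E] [CommGroup G]
  [TopologicalSpace G] [NormedAddCommGroup V] [NormedSpace ℂ V] [FiniteDimensional ℂ E]
  [FiniteDimensional ℂ V] {e : E → G} (he : IsLieExp e)
include he

theorem IsLieExp.exists_injOn {F : G → V} {x : G} (hF : ∀ᶠ y in 𝓝 x, IsHolAt e F y)
    (h : Function.Bijective (invDeriv e F x)) : ∃ U ∈ 𝓝 x, Set.InjOn F U := by
  have h1 := he.eventually_iff.1 hF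
  simp only [he.isHolAt_mul_iff] at h1
  obtain ⟨U, hU, hinj⟩ := exists_injOn_of_bijective_fderiv h1 h
  refine ⟨(fun u => x * e u) '' U, ?_, ?_⟩
  · rw [← he.map_nhds x]
    exact image_mem_map hU
  · rintro _ ⟨u, hu, rfl⟩ _ ⟨v, hv, rfl⟩ huv
    rw [hinj hu hv huv]

theorem exists_injOn_coneFun {F : G → E × ℂ} {x : G} (hF : ∀ᶠ y in 𝓝 x, IsHolAt e F y)
    (h : Function.Bijective fun p : E × ℂ => invDeriv e F x p.1 + p.2 • F x) (t : ℂˣ) :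
    ∃ U ∈ 𝓝 (x, t), Set.InjOn (coneFun F) U := by
  refine (isLieExp_expProd he).exists_injOn ?_ ?_
  · have : ∀ᶠ w in 𝓝 (x, t), IsHolAt e F w.1 := continuous_fst.continuousAt.eventually hF
    exact this.mono fun w hw => (isHolAt_coneFun he hw).1
  · have h1 : (invDeriv (expProd e) (coneFun F) (x, t) : E × ℂ → E × ℂ) =
        (fun v => t • v) ∘ fun p : E × ℂ => invDeriv e F x p.1 + p.2 • F x := by
      funext p
      exact (isHolAt_coneFun he (z := (x, t)) hF.self_of_nhds).2 p
    rw [h1]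
    exact (MulAction.bijective t).comp h

theorem eventually_bijective_frame {F : G → E × ℂ} {x : G} (hF : ∀ᶠ y in 𝓝 x, IsHolAt e F y)
    (h : Function.Bijective fun p : E × ℂ => invDeriv e F x p.1 + p.2 • F x) :
    ∀ᶠ y in 𝓝 x, Function.Bijective fun p : E × ℂ => invDeriv e F y p.1 + p.2 • F y := by
  have h1 : ContinuousAt (fun y => coneFrame (invDeriv e F y) (F y)) x :=
    continuousAt_coneFrame (he.continuousAt (he.isHolAt_invDeriv hF))
      (he.continuousAt hF.self_of_nhds)
  exact eventually_bijective_of_continuousAt h1 h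

omit [FiniteDimensional ℂ E] [FiniteDimensional ℂ V] in
/-- Two homogeneous coordinate systems of the same map differ by a nonzero holomorphic function. -/
theorem IsLiftNear.bijective_frame {c : G → ℙ ℂ (E × ℂ)} {F F' : G → E × ℂ} {x : G}
    (hF : IsLiftNear e c F x) (hF' : IsLiftNear e c F' x)
    (h : Function.Bijective fun p : E × ℂ => invDeriv e F x p.1 + p.2 • F x) :
    Function.Bijective fun p : E × ℂ => invDeriv e F' x p.1 + p.2 • F' x := by
  obtain ⟨hol, hx, -⟩ := hF.self_of_nhds
  obtain ⟨hol', hx', -⟩ := hF'.self_of_nhds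
  obtain ⟨ℓ, hℓ⟩ := SeparatingDual.exists_ne_zero (R := ℂ) hx
  -- The factor between the two lifts is a quotient of values of a linear functional, hence
  -- holomorphic.
  let g : G → ℂ := fun y => ℓ (F' y) / ℓ (F y)
  have hg : ∀ᶠ y in 𝓝 x, g y ≠ 0 ∧ F' y = g y • F y := by
    have h1 : ∀ᶠ y in 𝓝 x, ℓ (F y) ≠ 0 :=
      (he.continuousAt (hol.clm_comp ℓ)).eventually_ne hℓ
    filter_upwards [h1, hF, hF'] with y hy ⟨_, hy1, hy2⟩ ⟨_, hy3, hy4⟩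
    obtain ⟨s, hs⟩ := (Projectivization.mk_eq_mk_iff' ℂ _ _ hy3 hy1).1 (hy4.symm.trans hy2)
    have : g y = s := by simp only [g, ← hs, map_smul, smul_eq_mul, mul_div_cancel_right₀ _ hy]
    rw [this]
    refine ⟨?_, hs.symm⟩
    rintro rfl
    rw [zero_smul] at hs
    exact hy3 hs.symm
  have hgd : DifferentiableAt ℂ (fun u => g (x * e u)) 0 := by
    have h1 : DifferentiableAt ℂ (fun u => ℓ (F (x * e u))) 0 := hol.clm_comp ℓ
    have h2 : DifferentiableAt ℂ (fun u => ℓ (F' (x * e u))) 0 := hol'.clm_comp ℓ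
    simp only [g, div_eq_mul_inv]
    refine h2.mul (h1.fun_inv ?_)
    rwa [he.mul_map_zero]
  have h2 : HasFDerivAt (fun u => g (x * e u) • F (x * e u)) _ 0 :=
    hgd.hasFDerivAt.smul hol.hasFDerivAt
  have h3 : ∀ X, invDeriv e F' x X = g x • invDeriv e F x X + (invDeriv e g x X) • F x := by
    intro X
    rw [he.invDeriv_congr (hg.mono fun y hy => hy.2), invDeriv, h2.fderiv]
    simp only [he.mul_map_zero, add_apply, smul_apply, ContinuousLinearMap.smulRight_apply]
    rfl
  have hgx := hg.self_of_nhds.1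
  -- Passing from F to gF composes the frame with a triangular automorphism of E × ℂ with diagonal
  -- entries g(x).
  have h4 : (fun p : E × ℂ => invDeriv e F' x p.1 + p.2 • F' x) =
      (fun p : E × ℂ => invDeriv e F x p.1 + p.2 • F x) ∘
        fun p : E × ℂ => (g x • p.1, invDeriv e g x p.1 + p.2 * g x) := by
    funext p
    simp only [Function.comp_apply, h3, hg.self_of_nhds.2, map_smul, add_smul, smul_smul]
    abel
  rw [h4]
  refine h.comp ⟨fun p q hpq => ?_, fun q => ⟨((g x)⁻¹ • q.1,
    (q.2 - invDeriv e g x ((g x)⁻¹ • q.1)) * (g x)⁻¹), ?_⟩⟩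
  · have h5 : p.1 = q.1 := smul_right_injective _ hgx (congrArg Prod.fst hpq)
    have h6 := congrArg Prod.snd hpq
    simp only [h5, add_right_inj] at h6
    exact Prod.ext h5 (mul_right_cancel₀ hgx h6)
  · ext
    · simp [smul_smul, hgx]
    · simp [hgx]

end LocalInjectivity


/-! ### The affine structure of a flat connection -/

section AffineAtlas

variable {E G : Type*} [NormedAddCommGroup E] [NormedSpace ℂ E] [FiniteDimensional ℂ E]
  [CommGroup G] [TopologicalSpace G]

/-- The charts in `N` with affine-linear coordinates. -/
def affineAtlas (e : E → G) (Γ : G → E →ₗ[ℂ] E →ₗ[ℂ] E) (N : Set G) : Set (LocalChart G E) :=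
  {c | c.source ⊆ N ∧ IsHolChart e c ∧
    ∀ ℓ : Module.Dual ℂ E, IsAffineFun e Γ (fun x => ℓ (c.toFun x)) c.source}

variable {e : E → G} (he : IsLieExp e) {Γ : G → E →ₗ[ℂ] E →ₗ[ℂ] E} {N : Set G}
include he

theorem forall_isAffineFun_iff {V : Type*} [NormedAddCommGroup V] [NormedSpace ℂ V]
    [FiniteDimensional ℂ V] {F : G → V} {U : Set G} (hU : IsOpen U) (hF : IsHolOn e F U) :
    (∀ ℓ : Module.Dual ℂ V, IsAffineFun e Γ (fun x => ℓ (F x)) U) ↔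
      ∀ x ∈ U, ∀ X Y, hess e Γ F x X Y = 0 := by
  have hF' : ∀ x ∈ U, ∀ᶠ y in 𝓝 x, IsHolAt e F y := fun x hx => by
    filter_upwards [hU.mem_nhds hx] with y hy using hF y hy
  refine ⟨fun h x hx X Y => ?_, fun h ℓ => ⟨fun x hx => ?_, fun x hx X Y => ?_⟩⟩
  · refine (Module.forall_dual_apply_eq_zero_iff ℂ _).1 fun ℓ => ?_
    rw [← nabla_dForm_comp he (hF' x hx)]
    exact (h ℓ).2 x hx X Y
  · exact (hF x hx).clm_comp (LinearMap.toContinuousLinearMap ℓ)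
  · rw [nabla_dForm_comp he (hF' x hx), h x hx, map_zero]

theorem mem_affineAtlas_iff {c : LocalChart G E} :
    c ∈ affineAtlas e Γ N ↔ c.source ⊆ N ∧ IsHolChart e c ∧
      ∀ x ∈ c.source, ∀ X Y, hess e Γ c.toFun x X Y = 0 :=
  and_congr_right fun _ => and_congr_right fun h =>
    forall_isAffineFun_iff he c.open_source fun x hx => (h x hx).1

theorem isLocalAffine_of_mem_affineAtlas {c : LocalChart G E} (hc : c ∈ affineAtlas e Γ N) {x : G}
    (hx : x ∈ c.source) :
    IsLocalAffine (fun u => Γ (x * e u)) (fun u => c.toFun (x * e u)) := by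
  obtain ⟨-, h1, h2⟩ := (mem_affineAtlas_iff he).1 hc
  have : ∀ᶠ y in 𝓝 x, IsHolAt e c.toFun y ∧ ∀ X Y, hess e Γ c.toFun y X Y = 0 := by
    filter_upwards [c.open_source.mem_nhds hx] with y hy using ⟨(h1 y hy).1, h2 y hy⟩
  simpa only [IsLocalAffine, he.eventually_iff (x := x), he.isHolAt_mul_iff, hess,
    he.invDeriv_mul] using this

theorem affineAtlas_compatible {c c' : LocalChart G E} (hc : c ∈ affineAtlas e Γ N)
    (hc' : c' ∈ affineAtlas e Γ N) : c.Compatible (affineMaps E) c' := by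
  rintro x ⟨hx, hx'⟩
  obtain ⟨A, hA⟩ := (isLocalAffine_of_mem_affineAtlas he hc hx).exists_affineEquiv
    (isLocalAffine_of_mem_affineAtlas he hc' hx') (hc.2.1 x hx).2 (hc'.2.1 x hx').2
  exact ⟨A, ⟨A, rfl⟩, he.eventually_iff.2 hA⟩

/-- Locally c is an affine map after a chart of the atlas, and affine maps preserve the vanishing of
∇(df). -/
theorem mem_affineAtlas_of_compatible (hcover : ∀ x ∈ N, ∃ c ∈ affineAtlas e Γ N, x ∈ c.source)
    {c : LocalChart G E} (hcN : c.source ⊆ N) (hc : IsHolChart e c)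
    (hcomp : ∀ c' ∈ affineAtlas e Γ N, c.Compatible (affineMaps E) c') :
    c ∈ affineAtlas e Γ N := by
  refine (mem_affineAtlas_iff he).2 ⟨hcN, hc, fun x hx X Y => ?_⟩
  obtain ⟨c', hc', hx'⟩ := hcover x (hcN hx)
  obtain ⟨g, ⟨A, rfl⟩, hA⟩ := hcomp c' hc' x ⟨hx, hx'⟩
  obtain ⟨-, h1, h2⟩ := (mem_affineAtlas_iff he).1 hc'
  have hol : ∀ᶠ y in 𝓝 x, IsHolAt e c'.toFun y := by
    filter_upwards [c'.open_source.mem_nhds hx'] with y hy using (h1 y hy).1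
  let L : E →L[ℂ] E := LinearMap.toContinuousLinearMap (A.symm.linear : E →ₗ[ℂ] E)
  have h3 : c.toFun =ᶠ[𝓝 x] fun y => L (c'.toFun y) + A.symm 0 := by
    filter_upwards [hA] with y hy
    have h4 := A.symm.map_vadd 0 (c'.toFun y)
    rw [vadd_eq_add, add_zero] at h4
    rw [← A.symm_apply_apply (c.toFun y), ← hy, h4]
    rfl
  have h5 : ∀ z : G, invDeriv e (fun y => L (c'.toFun y) + A.symm 0) z =
      invDeriv e (fun y => L (c'.toFun y)) z := fun z => fderiv_add_const _
  rw [hess_congr he h3, hess]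
  simp only [h5]
  change hess e Γ (fun y => L (c'.toFun y)) x X Y = 0
  rw [hess_clm_comp he hol, h2 x hx', map_zero]

/-- The affine structure of a connection with enough affine-linear functions. -/
def affineStructureOf (hcover : ∀ x ∈ N, ∃ c ∈ affineAtlas e Γ N, x ∈ c.source) :
    AffineStructure e N where
  atlas := affineAtlas e Γ N
  source_subset _ hc := hc.1
  holomorphic _ hc := hc.2.1
  cover := hcover
  compatible _ hc _ hc' := affineAtlas_compatible he hc hc'
  maximal _ hcN hc hcomp := mem_affineAtlas_of_compatible he hcover hcN hc hcomp

end AffineAtlas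

/-! ### The projective structure of a projective connection -/

section ProjAtlas

variable {E G : Type*} [NormedAddCommGroup E] [NormedSpace ℂ E] [FiniteDimensional ℂ E]
  [CommGroup G] [TopologicalSpace G]

/-- The charts in `N` with homogeneous coordinates that solve `∇(df) + f A = 0`. -/
def projAtlas (e : E → G) (Γ : G → E →ₗ[ℂ] E →ₗ[ℂ] E) (a : LinearMap.BilinForm ℂ E) (N : Set G) :
    Set (LocalChart G (ℙ ℂ (E × ℂ))) :=
  {c | c.source ⊆ N ∧ IsHolProjChart e c ∧
    ∀ x ∈ c.source, ∃ F : G → E × ℂ, IsLiftNear e c.toFun F x ∧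
      ∀ ℓ : Module.Dual ℂ (E × ℂ), ∀ᶠ y in 𝓝 x, ∀ X Y : E,
        nabla e Γ (dForm e (fun z => ℓ (F z))) y X Y + ℓ (F y) * a X Y = 0}

variable {e : E → G} (he : IsLieExp e) {Γ : G → E →ₗ[ℂ] E →ₗ[ℂ] E} {a : LinearMap.BilinForm ℂ E}
  {N : Set G}
include he

theorem mem_projAtlas_iff {c : LocalChart G (ℙ ℂ (E × ℂ))} :
    c ∈ projAtlas e Γ a N ↔ c.source ⊆ N ∧ IsHolProjChart e c ∧
      ∀ x ∈ c.source, ∃ F : G → E × ℂ, IsLiftNear e c.toFun F x ∧ IsSolNear e Γ a F x := by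
  refine and_congr_right fun _ => and_congr_right fun h => forall₂_congr fun x hx =>
    exists_congr fun F => and_congr_right fun hF => ⟨fun h => ?_, fun h => h.forall_dual he⟩
  exact isSolNear_of_forall_dual he (hF.mono fun _ h => h.1) h

omit [FiniteDimensional ℂ E] in
theorem IsHolProjChart.bijective_frame {c : LocalChart G (ℙ ℂ (E × ℂ))} (hc : IsHolProjChart e c)
    {x : G} (hx : x ∈ c.source) {F : G → E × ℂ} (hF : IsLiftNear e c.toFun F x) :
    Function.Bijective fun p : E × ℂ => invDeriv e F x p.1 + p.2 • F x := by
  obtain ⟨F', hF', h⟩ := hc x hx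
  exact hF'.bijective_frame he hF h

omit [FiniteDimensional ℂ E] he in
theorem IsLiftNear.map {c c' : G → ℙ ℂ (E × ℂ)} {F : G → E × ℂ} {x : G}
    (hF : IsLiftNear e c F x) (L : (E × ℂ) →L[ℂ] (E × ℂ)) (hL : Function.Injective L)
    (h : ∀ᶠ y in 𝓝 x, c' y = Projectivization.map (L : (E × ℂ) →ₗ[ℂ] (E × ℂ)) hL (c y)) :
    IsLiftNear e c' (fun y => L (F y)) x := by
  filter_upwards [hF, h] with y ⟨h1, h2, h3⟩ h4
  refine ⟨h1.clm_comp L, (map_ne_zero_iff L hL).2 h2, ?_⟩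
  rw [h4, h3]
  rfl

theorem projAtlas_compatible {c c' : LocalChart G (ℙ ℂ (E × ℂ))} (hc : c ∈ projAtlas e Γ a N)
    (hc' : c' ∈ projAtlas e Γ a N) : c.Compatible (projectiveMaps (E × ℂ)) c' := by
  rintro x ⟨hx, hx'⟩
  obtain ⟨-, h1, h2⟩ := (mem_projAtlas_iff he).1 hc
  obtain ⟨-, h1', h2'⟩ := (mem_projAtlas_iff he).1 hc'
  obtain ⟨F, hF, hsol⟩ := h2 x hx
  obtain ⟨F', hF', hsol'⟩ := h2' x hx'
  have hb := h1.bijective_frame he hx hF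
  have hb' := h1'.bijective_frame he hx' hF'
  rw [isSolNear_iff he] at hsol hsol'
  obtain ⟨L, hL⟩ := hsol.exists_linearEquiv hsol'
    (by rwa [he.mul_map_zero]) (by rwa [he.mul_map_zero])
  refine ⟨_, ⟨L, rfl⟩, ?_⟩
  have hL' : ∀ᶠ y in 𝓝 x, F' y = L (F y) := he.eventually_iff.2 hL
  filter_upwards [hL', hF, hF'] with y hy ⟨_, h3, h4⟩ ⟨_, h5, h6⟩
  rw [h6, h4, Projectivization.map_mk]
  congr 1

/-- If L relates c to a chart with homogeneous coordinates F, then L⁻¹F are homogeneous coordinates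
of c, and they solve the same linear equation. -/
theorem mem_projAtlas_of_compatible (hcover : ∀ x ∈ N, ∃ c ∈ projAtlas e Γ a N, x ∈ c.source)
    {c : LocalChart G (ℙ ℂ (E × ℂ))} (hcN : c.source ⊆ N) (hc : IsHolProjChart e c)
    (hcomp : ∀ c' ∈ projAtlas e Γ a N, c.Compatible (projectiveMaps (E × ℂ)) c') :
    c ∈ projAtlas e Γ a N := by
  refine (mem_projAtlas_iff he).2 ⟨hcN, hc, fun x hx => ?_⟩
  obtain ⟨c', hc', hx'⟩ := hcover x (hcN hx)
  obtain ⟨g, ⟨L, rfl⟩, hL⟩ := hcomp c' hc' x ⟨hx, hx'⟩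
  obtain ⟨F, hF, hsol⟩ := ((mem_projAtlas_iff he).1 hc').2.2 x hx'
  let L' : (E × ℂ) ≃L[ℂ] (E × ℂ) := L.symm.toContinuousLinearEquiv
  refine ⟨fun y => L' (F y), ?_, hsol.clm_comp he (L' : (E × ℂ) →L[ℂ] (E × ℂ))⟩
  refine hF.map (L' : (E × ℂ) →L[ℂ] (E × ℂ)) L'.injective (hL.mono fun y hy => ?_)
  rw [hy]
  induction c.toFun y using Projectivization.ind with
  | h v hv =>
    have h1 : L.symm (L v) ≠ 0 := by rwa [L.symm_apply_apply]
    change Projectivization.mk ℂ v hv = Projectivization.mk ℂ (L.symm (L v)) h1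
    congr 1
    exact (L.symm_apply_apply v).symm

/-- The projective structure of a connection with enough solutions of `∇(df) + f A = 0`. -/
def projStructureOf (hcover : ∀ x ∈ N, ∃ c ∈ projAtlas e Γ a N, x ∈ c.source) :
    ProjectiveStructure e N where
  atlas := projAtlas e Γ a N
  source_subset _ hc := hc.1
  holomorphic _ hc := hc.2.1
  cover := hcover
  compatible _ hc _ hc' := projAtlas_compatible he hc hc'
  maximal _ hcN hc hcomp := mem_projAtlas_of_compatible he hcover hcN hc hcomp

end ProjAtlas


/-! ### Charts of a projectively flat connection and of its cone -/

section ProjConnection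

variable {E G : Type*} [NormedAddCommGroup E] [NormedSpace ℂ E] [FiniteDimensional ℂ E]
  [CommGroup G] [TopologicalSpace G]

/-- A torsion free connection on `N`, given by the closed tensor `Γ`, that is projectively flat:
with `a` it satisfies the equations which make the connection of the cone flat. -/
structure IsProjConnection (e : E → G) (Γ : G → E →ₗ[ℂ] E →ₗ[ℂ] E) (a : LinearMap.BilinForm ℂ E)
    (N : Set G) : Prop where
  exp : IsLieExp e
  isOpen : IsOpen N
  hol : ∀ x ∈ N, ∀ Y Z, IsHolAt e (fun y => Γ y Y Z) x
  symm : ∀ x Y Z, Γ x Y Z = Γ x Z Y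
  form_symm : ∀ Y Z, a Y Z = a Z Y
  closed : ∀ x ∈ N, ∀ X Y Z,
    invDeriv e (fun y => Γ y Y Z) x X = invDeriv e (fun y => Γ y X Z) x Y
  curv : ∀ x ∈ N, ∀ X Y Z, curvOp (Γ x) X Y Z = rotOp a X Y Z
  compat : ∀ x ∈ N, ∀ X Y Z, a X (Γ x Y Z) = a Y (Γ x X Z)

omit [FiniteDimensional ℂ E] in
theorem IsLocalSol.congr {V : Type*} [NormedAddCommGroup V] [NormedSpace ℂ V]
    {γ : E → E →ₗ[ℂ] E →ₗ[ℂ] E} {a : LinearMap.BilinForm ℂ E} {f g : E → V}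
    (hf : IsLocalSol γ a f) (h : g =ᶠ[𝓝 0] f) : IsLocalSol γ a g := by
  filter_upwards [hf, h.eventuallyEq_nhds] with u hu hfg
  refine ⟨hfg.differentiableAt_iff.2 hu.1, fun X Y => ?_⟩
  have h1 : (fun v => fderiv ℂ g v Y) =ᶠ[𝓝 u] fun v => fderiv ℂ f v Y := by
    filter_upwards [hfg.eventuallyEq_nhds] with v hv
    rw [hv.fderiv_eq]
  rw [h1.fderiv_eq, hfg.fderiv_eq, hfg.self_of_nhds]
  exact hu.2 X Y

variable {e : E → G} {Γ : G → E →ₗ[ℂ] E →ₗ[ℂ] E} {a : LinearMap.BilinForm ℂ E} {N : Set G}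

theorem IsProjConnection.exists_isSolNear (h : IsProjConnection e Γ a N) {x : G} (hx : x ∈ N) :
    ∃ F : G → E × ℂ, IsSolNear e Γ a F x ∧
      Function.Bijective fun p : E × ℂ => invDeriv e F x p.1 + p.2 • F x := by
  have hN : ∀ᶠ u in 𝓝 (0 : E), x * e u ∈ N :=
    h.exp.eventually_iff.1 (h.isOpen.mem_nhds hx)
  obtain ⟨f, hf, hf'⟩ := exists_isLocalSol (γ := fun u => Γ (x * e u)) h.form_symm (by
    filter_upwards [hN] with u hu
    refine ⟨fun Y Z => h.exp.isHolAt_mul_iff.1 (h.hol _ hu Y Z), h.symm _, fun X Y Z => ?_,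
      h.curv _ hu, h.compat _ hu⟩
    have h1 := h.closed _ hu X Y Z
    rwa [h.exp.invDeriv_mul, h.exp.invDeriv_mul] at h1)
  obtain ⟨F, hF⟩ := h.exp.exists_comp x f
  refine ⟨F, (isSolNear_iff h.exp).2 (hf.congr hF), ?_⟩
  have h1 : (fun p : E × ℂ => invDeriv e F x p.1 + p.2 • F x) = id := by
    funext p
    have h2 := hF.self_of_nhds
    rw [h.exp.mul_map_zero] at h2
    have h3 : invDeriv e F x = fderiv ℂ f 0 := Filter.EventuallyEq.fderiv_eq hF
    rw [h2, h3, hf' p]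
    rfl
  rw [h1]
  exact Function.bijective_id

omit [FiniteDimensional ℂ E] in
theorem IsProjConnection.isTorsionFree_cone (h : IsProjConnection e Γ a N) :
    IsTorsionFree (expProd e) (fun z => coneForm (Γ z.1) a) (N ×ˢ (univ : Set ℂˣ)) :=
  isTorsionFree_of_symm fun x => coneForm_comm (h.symm x.1) h.form_symm

omit [FiniteDimensional ℂ E] [TopologicalSpace G] in
theorem isHolAt_coneForm {z : G × ℂˣ} {p q : E × ℂ}
    (h : IsHolAt e (fun y => Γ y p.1 q.1) z.1) :
    IsHolAt (expProd e) (fun z => coneForm (Γ z.1) a p q) z ∧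
      ∀ r, invDeriv (expProd e) (fun z => coneForm (Γ z.1) a p q) z r =
        (invDeriv e (fun y => Γ y p.1 q.1) z.1 r.1, 0) := by
  have h1 : HasFDerivAt (fun r : E × ℂ => Γ (z.1 * e r.1) p.1 q.1)
      ((invDeriv e (fun y => Γ y p.1 q.1) z.1).comp (ContinuousLinearMap.fst ℂ E ℂ)) 0 :=
    HasFDerivAt.comp (g := fun u => Γ (z.1 * e u) p.1 q.1) (0 : E × ℂ) h.hasFDerivAt hasFDerivAt_fst
  have h2 : HasFDerivAt (fun r : E × ℂ => coneForm (Γ (z * expProd e r).1) a p q) _ 0 :=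
    ((h1.sub_const (q.2 • p.1)).sub_const (p.2 • q.1)).prodMk
      (hasFDerivAt_const (a p.1 q.1 - p.2 * q.2) (0 : E × ℂ))
  refine ⟨h2.differentiableAt, fun r => ?_⟩
  rw [invDeriv, h2.fderiv]
  rfl

theorem IsProjConnection.isFlat_cone (h : IsProjConnection e Γ a N) :
    IsFlat (expProd e) (fun z => coneForm (Γ z.1) a) (N ×ˢ (univ : Set ℂˣ)) := by
  refine isFlat_of_curvature (isLieExp_expProd h.exp)
    (fun z hz p q => (isHolAt_coneForm (h.hol z.1 hz.1 p.1 q.1)).1) fun z hz p q r => ?_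
  rw [(isHolAt_coneForm (h.hol z.1 hz.1 q.1 r.1)).2, (isHolAt_coneForm (h.hol z.1 hz.1 p.1 r.1)).2,
    h.closed z.1 hz.1, sub_self,
    curvOp_coneForm (h.symm z.1) h.form_symm (h.curv z.1 hz.1) (h.compat z.1 hz.1)]

/-- The cone of a system of homogeneous coordinates is an affine chart. -/
theorem IsSolNear.exists_affine_chart (he : IsLieExp e) (hN : IsOpen N) {F : G → E × ℂ} {x : G}
    (hx : x ∈ N) (hF : IsSolNear e Γ a F x)
    (hb : Function.Bijective fun p : E × ℂ => invDeriv e F x p.1 + p.2 • F x) (t : ℂˣ) :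
    ∃ d ∈ affineAtlas (expProd e) (fun z => coneForm (Γ z.1) a) (N ×ˢ (univ : Set ℂˣ)),
      (x, t) ∈ d.source ∧ d.toFun = coneFun F := by
  have hol : ∀ᶠ y in 𝓝 x, IsHolAt e F y := hF.mono fun _ h => h.1
  obtain ⟨U, hU, hinj⟩ := exists_injOn_coneFun he hol hb t
  have hgood := (hN.eventually_mem hx).and
    (hol.eventually_nhds.and (hF.and (eventually_bijective_frame he hol hb)))
  have hgood' : ∀ᶠ z in 𝓝 (x, t), z ∈ U ∧ _ :=
    Filter.Eventually.and hU ((continuous_fst (X := G) (Y := ℂˣ)).continuousAt.eventually hgood)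
  obtain ⟨O, hO, hOo, hxO⟩ := eventually_nhds_iff.1 hgood'
  refine ⟨⟨O, coneFun F, hOo, hinj.mono fun z hz => (hO z hz).1⟩, ?_, hxO, rfl⟩
  refine (mem_affineAtlas_iff (isLieExp_expProd he)).2 ⟨fun z hz => ⟨(hO z hz).2.1, trivial⟩,
    fun z hz => ?_, fun z hz p q => ?_⟩
  · obtain ⟨-, -, h1, h2, h3⟩ := hO z hz
    refine ⟨(isHolAt_coneFun he h2.1).1, ?_⟩
    have h4 : (invDeriv (expProd e) (coneFun F) z : E × ℂ → E × ℂ) =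
        (fun v => z.2 • v) ∘ fun p : E × ℂ => invDeriv e F z.1 p.1 + p.2 • F z.1 :=
      funext fun p => (isHolAt_coneFun he h2.1).2 p
    rw [h4]
    exact (MulAction.bijective z.2).comp h3
  · obtain ⟨-, -, h1, h2, h3⟩ := hO z hz
    change hess _ _ (coneFun F) _ _ _ = 0
    rw [hess_coneFun he h1, h2.2, smul_zero]

/-- The homogeneous coordinates of an affine chart of the cone solve `∇(df) + f A = 0`. -/
theorem isSolNear_of_affine_chart (he : IsLieExp e) {F : G → E × ℂ} {x : G}
    (hF : ∀ᶠ y in 𝓝 x, IsHolAt e F y) {d : LocalChart (G × ℂˣ) (E × ℂ)}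
    (hd : d ∈ affineAtlas (expProd e) (fun z => coneForm (Γ z.1) a) (N ×ˢ (univ : Set ℂˣ)))
    (hx : (x, 1) ∈ d.source) (h : ∀ᶠ z in 𝓝 (x, (1 : ℂˣ)), d.toFun z = coneFun F z) :
    IsSolNear e Γ a F x := by
  have h1 : ∀ᶠ z in 𝓝 (x, (1 : ℂˣ)), ∀ p q,
      hess (expProd e) (fun z => coneForm (Γ z.1) a) (coneFun F) z p q = 0 := by
    filter_upwards [d.open_source.mem_nhds hx, h.eventually_nhds] with z hz hz' p q
    rw [← hess_congr (isLieExp_expProd he) hz']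
    exact ((mem_affineAtlas_iff (isLieExp_expProd he)).1 hd).2.2 z hz p q
  have h2 : ∀ᶠ y in 𝓝 x, ∀ p q,
      hess (expProd e) (fun z => coneForm (Γ z.1) a) (coneFun F) (y, 1) p q = 0 :=
    (Continuous.prodMk_left (1 : ℂˣ)).continuousAt.eventually h1
  filter_upwards [h2, hF.eventually_nhds] with y hy hy'
  refine ⟨hy'.self_of_nhds, fun X Y => ?_⟩
  -- At t = 1 and on horizontal vectors the Hessian of the cone is the left side of the equation for
  -- F.
  have h3 := hy (X, 0) (Y, 0)
  rw [hess_coneFun he hy'] at h3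
  simpa using h3

/-- If F y = s F z with y and z near x, then s is a quotient of values of a linear functional and so
is close to 1. The points (y, 1) and (z, s) then have the same image under t F, which is injective
near (x, 1). -/
theorem exists_injOn_mk (he : IsLieExp e) {F : G → E × ℂ} {x : G}
    (hF : ∀ᶠ y in 𝓝 x, IsHolAt e F y)
    (hb : Function.Bijective fun p : E × ℂ => invDeriv e F x p.1 + p.2 • F x) :
    ∃ U ∈ 𝓝 x, ∀ y ∈ U, ∀ z ∈ U, F y ≠ 0 ∧ (∀ s : ℂ, s • F z = F y → y = z) := by
  have hx : F x ≠ 0 := by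
    intro h0
    have h1 := hb.1 (a₁ := (0, 1)) (a₂ := 0) (by simp [h0])
    exact one_ne_zero (congrArg Prod.snd h1)
  obtain ⟨ℓ, hℓ⟩ := SeparatingDual.exists_ne_zero (R := ℂ) hx
  have hFc := he.continuousAt hF.self_of_nhds
  have hℓc : ContinuousAt (fun y => ℓ (F y)) x := ℓ.continuous.continuousAt.comp hFc
  obtain ⟨U, hU, hinj⟩ := exists_injOn_coneFun he hF hb 1
  obtain ⟨U₁, hU₁, V, hV, hUV⟩ := mem_nhds_prod_iff.1 hU
  have hV' : ∃ V' ∈ 𝓝 (1 : ℂ), Units.val ⁻¹' V' ⊆ V := by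
    rw [Units.isOpenEmbedding_val.isInducing.nhds_eq_comap] at hV
    exact hV
  obtain ⟨V', hV'1, hV'2⟩ := hV'
  have hr : ContinuousAt (fun w : G × G => ℓ (F w.1) / ℓ (F w.2)) (x, x) :=
    ContinuousAt.div (ContinuousAt.comp (f := Prod.fst) (x := (x, x)) hℓc continuousAt_fst)
      (ContinuousAt.comp (f := Prod.snd) (x := (x, x)) hℓc continuousAt_snd) hℓ
  have hr' : ∀ᶠ w in 𝓝 (x, x), ℓ (F w.1) / ℓ (F w.2) ∈ V' := by
    refine hr.eventually ?_
    beta_reduce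
    rw [div_self hℓ]
    exact hV'1
  obtain ⟨O₁, hO₁, O₂, hO₂, hO⟩ := mem_nhds_prod_iff.1 hr'
  refine ⟨U₁ ∩ (O₁ ∩ O₂) ∩ {y | ℓ (F y) ≠ 0}, inter_mem (inter_mem hU₁ (inter_mem hO₁ hO₂))
    (hℓc.eventually_ne hℓ), ?_⟩
  rintro y ⟨⟨hy1, hy2⟩, hy3⟩ z ⟨⟨hz1, hz2⟩, hz3⟩
  refine ⟨fun h0 => hy3 (by simp [h0]), fun s hs => ?_⟩
  have hs' : ℓ (F y) / ℓ (F z) = s := by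
    rw [← hs, map_smul, smul_eq_mul, mul_div_cancel_right₀ _ hz3]
  have hs0 : s ≠ 0 := by
    rintro rfl
    exact hy3 (by rw [← hs, zero_smul, map_zero])
  have h1 : (y, (1 : ℂˣ)) ∈ U := hUV ⟨hy1, mem_of_mem_nhds hV⟩
  have h2 : (z, Units.mk0 s hs0) ∈ U := by
    refine hUV ⟨hz1, hV'2 ?_⟩
    change s ∈ V'
    rw [← hs']
    exact hO (show (y, z) ∈ O₁ ×ˢ O₂ from ⟨hy2.1, hz2.2⟩)
  have h3 := hinj h1 h2 (by simp [coneFun, hs])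
  exact congrArg Prod.fst h3

theorem IsSolNear.exists_proj_chart (he : IsLieExp e) (hN : IsOpen N) {F : G → E × ℂ} {x : G}
    (hx : x ∈ N) (hF : IsSolNear e Γ a F x)
    (hb : Function.Bijective fun p : E × ℂ => invDeriv e F x p.1 + p.2 • F x) :
    ∃ c ∈ projAtlas e Γ a N, x ∈ c.source := by
  classical
  have hol : ∀ᶠ y in 𝓝 x, IsHolAt e F y := hF.mono fun _ h => h.1
  obtain ⟨U, hU, hinj⟩ := exists_injOn_mk he hol hb
  have hgood : ∀ᶠ y in 𝓝 x, y ∈ U ∧ _ := Filter.Eventually.and hU ((hN.eventually_mem hx).and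
    (hF.eventually_nhds.and (eventually_bijective_frame he hol hb)))
  obtain ⟨O, hO, hOo, hxO⟩ := eventually_nhds_iff.1 hgood
  have h01 : ((0, 1) : E × ℂ) ≠ 0 := fun h => one_ne_zero (congrArg Prod.snd h)
  -- The value where F vanishes is arbitrary, because F has no zero on `O`.
  let c : G → ℙ ℂ (E × ℂ) := fun y =>
    if h : F y ≠ 0 then Projectivization.mk ℂ (F y) h else Projectivization.mk ℂ (0, 1) h01
  have hc : ∀ y ∈ O, ∃ h : F y ≠ 0, c y = Projectivization.mk ℂ (F y) h := fun y hy =>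
    ⟨(hinj y (hO y hy).1 y (hO y hy).1).1, dif_pos (hinj y (hO y hy).1 y (hO y hy).1).1⟩
  have hlift : ∀ y ∈ O, IsLiftNear e c F y := by
    intro y hy
    filter_upwards [hOo.mem_nhds hy] with z hz
    exact ⟨(hO z hz).2.2.1.self_of_nhds.1, hc z hz⟩
  refine ⟨⟨O, c, hOo, fun y hy z hz hyz => ?_⟩, ?_, hxO⟩
  · obtain ⟨h1, h2⟩ := hc y hy
    obtain ⟨h3, h4⟩ := hc z hz
    obtain ⟨s, hs⟩ := (Projectivization.mk_eq_mk_iff' ℂ _ _ h1 h3).1 (h2.symm.trans (hyz.trans h4))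
    exact (hinj y (hO y hy).1 z (hO z hz).1).2 s hs
  · exact (mem_projAtlas_iff he).2 ⟨fun y hy => (hO y hy).2.1,
      fun y hy => ⟨F, hlift y hy, (hO y hy).2.2.2⟩, fun y hy => ⟨F, hlift y hy, (hO y hy).2.2.1⟩⟩

theorem IsProjConnection.exists_proj_chart (h : IsProjConnection e Γ a N) :
    ∀ x ∈ N, ∃ c ∈ projAtlas e Γ a N, x ∈ c.source := fun x hx => by
  obtain ⟨F, hF, hb⟩ := h.exists_isSolNear hx
  exact hF.exists_proj_chart h.exp h.isOpen hx hb

theorem IsProjConnection.exists_affine_chart (h : IsProjConnection e Γ a N) :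
    ∀ z ∈ N ×ˢ (univ : Set ℂˣ),
      ∃ d ∈ affineAtlas (expProd e) (fun z => coneForm (Γ z.1) a) (N ×ˢ (univ : Set ℂˣ)),
        z ∈ d.source := fun z hz => by
  obtain ⟨F, hF, hb⟩ := h.exists_isSolNear hz.1
  obtain ⟨d, hd, hzd, -⟩ := hF.exists_affine_chart h.exp h.isOpen hz.1 hb z.2
  exact ⟨d, hd, hzd⟩

theorem IsProjConnection.mem_projAtlas_iff_induced (h : IsProjConnection e Γ a N)
    (c : LocalChart G (ℙ ℂ (E × ℂ))) :
    c ∈ projAtlas e Γ a N ↔ c.source ⊆ N ∧ IsHolProjChart e c ∧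
      ∀ x ∈ c.source, ∃ F : G → E × ℂ, IsLiftNear e c.toFun F x ∧
        ∀ t : ℂˣ, ∃ d ∈ affineAtlas (expProd e) (fun z => coneForm (Γ z.1) a)
          (N ×ˢ (univ : Set ℂˣ)), (x, t) ∈ d.source ∧
            ∀ᶠ z in 𝓝 (x, t), d.toFun z = (z.2 : ℂ) • F z.1 := by
  rw [mem_projAtlas_iff h.exp]
  refine and_congr_right fun hcN => and_congr_right fun hc => forall₂_congr fun x hx =>
    exists_congr fun F => and_congr_right fun hF => ⟨fun hsol t => ?_, fun hd => ?_⟩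
  · obtain ⟨d, hd, hxd, hdF⟩ := hsol.exists_affine_chart h.exp h.isOpen (hcN hx)
      (hc.bijective_frame h.exp hx hF) t
    exact ⟨d, hd, hxd, Eventually.of_forall fun z => congrFun hdF z⟩
  · obtain ⟨d, hd, hxd, hdF⟩ := hd 1
    exact isSolNear_of_affine_chart h.exp (hF.mono fun _ h => h.1) hd hxd hdF

end ProjConnection

/-! ### Symmetries -/

section Symmetry

variable {E G V : Type*} [NormedAddCommGroup E] [NormedSpace ℂ E] [FiniteDimensional ℂ E]
  [CommGroup G] [TopologicalSpace G] [NormedAddCommGroup V] [NormedSpace ℂ V]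
  {e : E → G} (he : IsLieExp e) {σ : G → G} {L : E →L[ℂ] E}
  (hσ : ∀ x u, σ (x * e u) = σ x * e (L u))
include he hσ

omit [FiniteDimensional ℂ E] in
theorem continuous_of_equivariant : Continuous σ := by
  refine continuous_iff_continuousAt.2 fun x => ?_
  rw [ContinuousAt, ← he.map_nhds x, tendsto_map'_iff]
  have h1 : Tendsto L (𝓝 0) (𝓝 0) := by
    have := L.continuous.continuousAt (x := 0)
    rwa [ContinuousAt, map_zero] at this
  exact ((he.tendsto (σ x)).comp h1).congr fun u => (hσ x u).symm

omit [TopologicalSpace G] [FiniteDimensional ℂ E] he in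
theorem isHolAt_comp_equivariant {F : G → V} {x : G} (h : IsHolAt e F (σ x)) :
    IsHolAt e (fun y => F (σ y)) x ∧
      ∀ X, invDeriv e (fun y => F (σ y)) x X = invDeriv e F (σ x) (L X) := by
  have h1 : DifferentiableAt ℂ (fun u => F (σ x * e u)) (L 0) := by rwa [map_zero]
  have h2 : HasFDerivAt (fun u => F (σ x * e (L u))) _ 0 :=
    h1.hasFDerivAt.comp (0 : E) L.hasFDerivAt
  simp only [← hσ] at h2
  refine ⟨h2.differentiableAt, fun X => ?_⟩
  rw [invDeriv, h2.fderiv, invDeriv, map_zero]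
  rfl

/-- The differential of σ carries the invariant vector field of X to that of L X, and L is
compatible with Γ and a. -/
theorem IsSolNear.comp_equivariant [FiniteDimensional ℂ V] {Γ : G → E →ₗ[ℂ] E →ₗ[ℂ] E}
    {a : LinearMap.BilinForm ℂ E} (hΓ : ∀ x u v, Γ (σ x) (L u) (L v) = L (Γ x u v))
    (ha : ∀ u v, a (L u) (L v) = a u v) {F : G → V} {x : G} (h : IsSolNear e Γ a F (σ x)) :
    IsSolNear e Γ a (fun y => F (σ y)) x := by
  have hc := continuous_of_equivariant he hσ
  filter_upwards [hc.continuousAt.eventually h.eventually_nhds] with y hy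
  obtain ⟨h1, h2⟩ := hy.self_of_nhds
  refine ⟨(isHolAt_comp_equivariant hσ h1).1, fun X Y => ?_⟩
  have h3 : (fun z => invDeriv e (fun y => F (σ y)) z Y) =ᶠ[𝓝 y]
      fun z => (fun w => invDeriv e F w (L Y)) (σ z) := by
    filter_upwards [hc.continuousAt.eventually hy] with z hz
    exact (isHolAt_comp_equivariant hσ hz.1).2 Y
  have h4 := isHolAt_invDeriv_apply he (hy.mono fun _ h => h.1) (L Y)
  rw [hess, he.invDeriv_congr h3, (isHolAt_comp_equivariant hσ h4).2,
    (isHolAt_comp_equivariant hσ h1).2, ← hΓ, ← ha]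
  exact h2 (L X) (L Y)

theorem mem_projAtlas_comp_equivariant {Γ : G → E →ₗ[ℂ] E →ₗ[ℂ] E}
    {a : LinearMap.BilinForm ℂ E} (hL : Function.Bijective L)
    (hΓ : ∀ x u v, Γ (σ x) (L u) (L v) = L (Γ x u v)) (ha : ∀ u v, a (L u) (L v) = a u v)
    {N : Set G} (hN : ∀ x, σ x ∈ N → x ∈ N) {c c' : LocalChart G (ℙ ℂ (E × ℂ))}
    (hc : c ∈ projAtlas e Γ a N) (hs : c'.source = σ ⁻¹' c.source)
    (hcc' : ∀ x, c'.toFun x = c.toFun (σ x)) : c' ∈ projAtlas e Γ a N := by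
  have hcont := continuous_of_equivariant he hσ
  obtain ⟨h1, h2, h3⟩ := (mem_projAtlas_iff he).1 hc
  have hlift : ∀ {x F}, IsLiftNear e c.toFun F (σ x) →
      IsLiftNear e c'.toFun (fun y => F (σ y)) x := by
    intro x F hF
    filter_upwards [hcont.continuousAt.eventually hF] with y ⟨h4, h5, h6⟩
    exact ⟨(isHolAt_comp_equivariant hσ h4).1, h5, (hcc' y).trans h6⟩
  refine (mem_projAtlas_iff he).2 ⟨fun x hx => ?_, fun x hx => ?_, fun x hx => ?_⟩ <;>
    rw [hs] at hx
  · exact hN x (h1 hx)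
  · obtain ⟨F, hF, hb⟩ := h2 (σ x) hx
    refine ⟨_, hlift hF, ?_⟩
    have h4 : (fun p : E × ℂ => invDeriv e (fun y => F (σ y)) x p.1 + p.2 • F (σ x)) =
        (fun p : E × ℂ => invDeriv e F (σ x) p.1 + p.2 • F (σ x)) ∘ Prod.map L id := by
      funext p
      rw [(isHolAt_comp_equivariant hσ hF.self_of_nhds.1).2]
      rfl
    rw [h4]
    exact hb.comp (hL.prodMap Function.bijective_id)
  · obtain ⟨F, hF, hsol⟩ := h3 (σ x) hx
    exact ⟨_, hlift hF, hsol.comp_equivariant he hσ hΓ ha⟩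

end Symmetry


/-! ### The Weyl group action on the torus -/

section Weyl

variable {ι M N : Type*} [AddCommGroup M] [Module ℂ M] [NormedAddCommGroup N]
  [NormedSpace ℂ N] {P : RootPairing ι ℂ M N}

theorem weylTorus_mul_torusExp [Finite ι] [P.IsCrystallographic] (w : P.weylGroup)
    (h : AdjointTorus P) (u : N) :
    weylTorus P w (h * torusExp P u) = weylTorus P w h * torusExp P (weylCartan P w u) := by
  refine AdjointTorus.ext_char fun φ => ?_
  ext
  rw [AdjointTorus.char_mul, Units.val_mul, char_torusExp, toLinearMap_weylCartan]
  exact char_mul_torusExp P ⟨w⁻¹ • (φ : M), weyl_smul_mem_rootSpan P w⁻¹ φ.2⟩ h u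

theorem mem_mirrorComplement_of_weylTorus (w : P.weylGroup) {h : AdjointTorus P}
    (hh : weylTorus P w h ∈ mirrorComplement P) : h ∈ mirrorComplement P := fun i => by
  have h1 := hh (P.weylGroupToPerm w i)
  rwa [char_weylTorus, map_inv, ← Equiv.Perm.mul_apply, inv_mul_cancel, Equiv.Perm.one_apply] at h1

end Weyl

theorem mainTheorem1 {ι M N : Type*} [Fintype ι] [AddCommGroup M] [Module ℂ M]
    [NormedAddCommGroup N] [NormedSpace ℂ N] (P : RootPairing ι ℂ M N)
    [P.IsRootSystem] [P.IsCrystallographic] [P.IsReduced] [P.IsIrreducible]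
    (k : ι → ℂ) (hk : ∀ (w : P.weylGroup) (i : ι), k (P.weylGroupToPerm w i) = k i)
    (b : N →ₗ[ℂ] N →ₗ[ℂ] N) (hb : ∀ u v : N, b u v = b v u)
    (hbW : ∀ (w : P.weylGroup) (u v : N),
      b (weylCartan P w u) (weylCartan P w v) = weylCartan P w (b u v)) :
    ∃ a : LinearMap.BilinForm ℂ N,
      (∀ u v : N, a u v = a v u) ∧
      (∀ (w : P.weylGroup) (u v : N), a (weylCartan P w u) (weylCartan P w v) = a u v) ∧
      IsTorsionFree (expProd (torusExp P)) (affineForm P k b a)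
        (mirrorComplement P ×ˢ (Set.univ : Set ℂˣ)) ∧
      IsFlat (expProd (torusExp P)) (affineForm P k b a)
        (mirrorComplement P ×ˢ (Set.univ : Set ℂˣ)) ∧
      ∃ 𝒜 : AffineStructure (expProd (torusExp P))
          (mirrorComplement P ×ˢ (Set.univ : Set ℂˣ)),
        AffineStructure.IsDefinedBy 𝒜 (affineForm P k b a) ∧
        ∃ 𝒬 : ProjectiveStructure (torusExp P) (mirrorComplement P),
          ProjectiveStructure.IsDefinedBy 𝒬 (specialForm P k b) a ∧
          ProjectiveStructure.IsInducedBy 𝒬 𝒜 ∧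
          ProjectiveStructure.IsWeylInvariant 𝒬 := by
  have : FiniteDimensional ℂ N := Module.Finite.equiv (simpleCoordinates P.nonempty_base.some).symm
  obtain ⟨a, ha, haW, hah⟩ := exists_invariant_form hk hb hbW
  have h : IsProjConnection (torusExp P) (specialForm P k b) a (mirrorComplement P) :=
    { exp := isLieExp_torusExp
      isOpen := isOpen_mirrorComplement
      hol := fun x hx => isHolAt_specialForm hx
      symm := specialForm_comm hb
      form_symm := ha
      closed := fun x hx => invDeriv_specialForm_comm hx
      curv := fun x hx X Y Z => (hah x hx X Y Z).1
      compat := fun x hx X Y Z => (hah x hx X Y Z).2 }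
  -- By definition `affineForm` is the `coneForm` of `specialForm`, so the results on the cone apply
  -- as they stand.
  refine ⟨a, ha, haW, h.isTorsionFree_cone, h.isFlat_cone,
    affineStructureOf (isLieExp_expProd h.exp) h.exists_affine_chart, fun c => Iff.rfl,
    projStructureOf h.exp h.exists_proj_chart, fun c => Iff.rfl, h.mem_projAtlas_iff_induced,
    fun w c hc c' hs hcc' => ?_⟩
  exact mem_projAtlas_comp_equivariant h.exp (σ := weylTorus P w)
    (L := (weylCartan P w).toContinuousLinearEquiv) (weylTorus_mul_torusExp w)
    (weylCartan P w).bijective (specialForm_weylTorus P w hk hbW) (haW w)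
    (fun x => mem_mirrorComplement_of_weylTorus w) hc hs hcc'
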